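/- **Setting.** Let $d\ge 1$, let $\Omega\subset\mathbb R^d$ be open and bounded, let $p\in(d,\infty)$ be fixed, let $g\in W^{1,\infty}(\Omega)$, and let $k\ge 1$ be an integer. For $1\le q\le\infty$, $W^{1,q}(\Omega)$ is the Sobolev space of functions in $L^q(\Omega)$ with weak gradient in $L^q(\Omega)$, $W^{1,p}_0(\Omega)$ is the closure of $C_c^\infty(\Omega)$ in $W^{1,p}(\Omega)$, and $W^{1,p}_g(\Omega)=\{u\in W^{1,p}(\Omega): u-g\in W^{1,p}_0(\Omega)\}$. Put $$a_p(u,v)=\int_\Omega |Du|^{p-2}Du\cdot Dv\,dx .$$ A *weak solution* of $\operatorname{div}(|Du|^{p-2}Du)=0$ in $\Omega$, $u=g$ on $\partial\Omega$, is a function $u_p\in W^{1,p}_g(\Omega)$ with $a_p(u_p,v)=0$ for all $v\in W^{1,p}_0(\Omega)$. *Triangulations.* A conforming triangulation $\mathcal T$ of $\Omega$ is a finite family of open $d$-simplices $K\subset\Omega$ with $\bigcup_{K\in\mathcal T}\overline K=\overline\Omega$ such that any two closures $\overline K,\overline J$ meet in the (possibly empty) common face spanned by their common vertices. Let $h_K$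 be the diameter of $K$ and $\rho_K$ the radius of the largest ball contained in $K$. Let $(\mathcal T_n)_{n\in\mathbb N}$ be a sequence of conforming triangulations of $\Omega$ that is shape regular, $\inf_n\min_{K\in\mathcal T_n}\rho_K/h_K>0$, and quasiuniform, $\max_{K\in\mathcal T_n}h_K\le C\min_{K\in\mathcal T_n}h_K$ with $C$ independent of $n$, and whose mesh parameter satisfies $\max_{K\in\mathcal T_n}h_K\to0$ as $n\to\infty$. *Discrete problem.* Let $\mathbb V_n$ be the space of all functions that are continuous on $\Omega$ and whose restriction to each $K\in\mathcal T_n$ is a polynomial of total degree at most $k$. The $L^2(\Omega)$ projection $P_{k,n}g\in\mathbb V_n$ is defined by $\int_\Omega (P_{k,n}g)\,\Phi=\int_\Omega g\,\Phi$ for all $\Phi\in\mathbb V_n$. The discrete solution $U_{p,n}\in\mathbb V_n$ satisfies $U_{p,n}=P_{k,n}g$ on $\partial\Omega$ and $$a_p(U_{p,n},\Phi)=0\qquad\text{for all }\Phi\in\mathbb V_n\text{ with }\Phi=0\text{ on }\partial\Omega .$$ Here $V=W$ on $\partial\Omega$ means that $V(y)-W(y)\to0$ as $y\to x$, $y\in\Omega$,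 for every $x\in\partial\Omega$. **Theorem (convergence of the discrete scheme to weak solutions).** Let $U_{p,n}$ be the discrete solutions and $u_p$ the weak solution. Then $u_p$ has a representative that is continuous on $\Omega$, and for this representative $$U_{p,n}\to u_p\quad\text{in } C^0(\Omega),\qquad\text{that is}\qquad \sup_{x\in\Omega}|U_{p,n}(x)-u_p(x)|\to0\quad\text{as }n\to\infty .$$ -/

import Mathlib

open MeasureTheory Filter Topology
open scoped ENNReal ContDiff

noncomputable section

/-! ### First-order Sobolev spaces on an open set -/

/-- `φ ∈ C_c^∞(Ω)`. -/
structure IsTestFunction {d : ℕ} (Ω : Set (EuclideanSpace ℝ (Fin d)))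
    (φ : EuclideanSpace ℝ (Fin d) → ℝ) : Prop where
  smooth : ContDiff ℝ ∞ φ
  compact : HasCompactSupport φ
  support : tsupport φ ⊆ Ω

/-- `G` is a weak (distributional) gradient of `u` on `Ω`:
`∫_Ω u ∂_v φ = - ∫_Ω φ (G · v)` for all directions `v` and all test functions `φ`. -/
structure HasWeakGradient {d : ℕ} (Ω : Set (EuclideanSpace ℝ (Fin d)))
    (u : EuclideanSpace ℝ (Fin d) → ℝ)
    (G : EuclideanSpace ℝ (Fin d) → EuclideanSpace ℝ (Fin d)) : Prop where
  locInt : LocallyIntegrableOn u Ω volume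
  locInt_grad : LocallyIntegrableOn G Ω volume
  integral_eq : ∀ φ, IsTestFunction Ω φ → ∀ v : EuclideanSpace ℝ (Fin d),
    ∫ x in Ω, u x * fderiv ℝ φ x v = - ∫ x in Ω, φ x * inner ℝ (G x) v

open Classical in
/-- The weak gradient `Du` on `Ω` (unique almost everywhere in `Ω`), and `0` if there is none. -/
def weakGrad {d : ℕ} (Ω : Set (EuclideanSpace ℝ (Fin d)))
    (u : EuclideanSpace ℝ (Fin d) → ℝ) :
    EuclideanSpace ℝ (Fin d) → EuclideanSpace ℝ (Fin d) :=
  if h : ∃ G, HasWeakGradient Ω u G then h.choose else 0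

/-- The Sobolev space `W^{1,p}(Ω)`, `1 ≤ p ≤ ∞`. -/
structure MemW1 {d : ℕ} (Ω : Set (EuclideanSpace ℝ (Fin d))) (p : ℝ≥0∞)
    (u : EuclideanSpace ℝ (Fin d) → ℝ) : Prop where
  memLp : MemLp u p (volume.restrict Ω)
  exists_grad : ∃ G, HasWeakGradient Ω u G
  memLp_grad : MemLp (weakGrad Ω u) p (volume.restrict Ω)

/-- `W_0^{1,p}(Ω)`: the closure of `C_c^∞(Ω)` in `W^{1,p}(Ω)`. -/
structure MemW10 {d : ℕ} (Ω : Set (EuclideanSpace ℝ (Fin d))) (p : ℝ≥0∞)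
    (u : EuclideanSpace ℝ (Fin d) → ℝ) : Prop where
  memW1 : MemW1 Ω p u
  approx : ∃ φ : ℕ → EuclideanSpace ℝ (Fin d) → ℝ, (∀ n, IsTestFunction Ω (φ n)) ∧
    Tendsto (fun n => eLpNorm (fun x => u x - φ n x) p (volume.restrict Ω)) atTop (𝓝 0) ∧
    Tendsto (fun n => eLpNorm (fun x => weakGrad Ω u x - gradient (φ n) x) p
      (volume.restrict Ω)) atTop (𝓝 0)

/-- `W_g^{1,p}(Ω)`: the functions in `W^{1,p}(Ω)` with boundary values `g`. -/
structure MemW1Boundary {d : ℕ} (Ω : Set (EuclideanSpace ℝ (Fin d))) (p : ℝ≥0∞)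
    (g u : EuclideanSpace ℝ (Fin d) → ℝ) : Prop where
  memW1 : MemW1 Ω p u
  boundary : MemW10 Ω p (fun x => u x - g x)

/-! ### The `p`-Laplace problem -/

/-- The semilinear form `∫_Ω |Du|^{p-2} Du · Dv`. -/
def pLaplaceForm {d : ℕ} (Ω : Set (EuclideanSpace ℝ (Fin d))) (p : ℝ)
    (u v : EuclideanSpace ℝ (Fin d) → ℝ) : ℝ :=
  ∫ x in Ω, ‖weakGrad Ω u x‖ ^ (p - 2) * inner ℝ (weakGrad Ω u x) (weakGrad Ω v x)

/-- `u` is a weak solution of `Δ_p u = 0` in `Ω`, `u = g` on `∂Ω`. -/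
structure IsWeakSolution {d : ℕ} (Ω : Set (EuclideanSpace ℝ (Fin d))) (p : ℝ)
    (g u : EuclideanSpace ℝ (Fin d) → ℝ) : Prop where
  mem : MemW1Boundary Ω (ENNReal.ofReal p) g u
  eq_zero : ∀ v, MemW10 Ω (ENNReal.ofReal p) v → pLaplaceForm Ω p u v = 0

/-! ### Triangulations -/

/-- The open simplex with vertex set `s`. -/
def openSimplex {d : ℕ} (s : Finset (EuclideanSpace ℝ (Fin d))) :
    Set (EuclideanSpace ℝ (Fin d)) :=
  interior (convexHull ℝ (s : Set (EuclideanSpace ℝ (Fin d))))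

/-- A conforming triangulation of `Ω`. An element `K` is given by its set of `d + 1` affinely
independent vertices: `K = openSimplex s`, and its closure is `convexHull ℝ s`. Two closed elements
meet exactly in their common face, the (possibly empty) simplex spanned by the common vertices. -/
structure Triangulation {d : ℕ} (Ω : Set (EuclideanSpace ℝ (Fin d))) where
  cells : Finset (Finset (EuclideanSpace ℝ (Fin d)))
  card_eq : ∀ s ∈ cells, s.card = d + 1
  affineIndependent : ∀ s ∈ cells,
    AffineIndependent ℝ ((↑) : s → EuclideanSpace ℝ (Fin d))
  subset : ∀ s ∈ cells, openSimplex s ⊆ Ω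
  conforming : ∀ s ∈ cells, ∀ t ∈ cells,
    convexHull ℝ (s : Set (EuclideanSpace ℝ (Fin d))) ∩
        convexHull ℝ (t : Set (EuclideanSpace ℝ (Fin d))) =
      convexHull ℝ ((s : Set (EuclideanSpace ℝ (Fin d))) ∩ t)
  cover : ⋃ s ∈ cells, convexHull ℝ (s : Set (EuclideanSpace ℝ (Fin d))) = closure Ω

/-- `h_K`, the diameter of the element `K`. -/
def cellDiam {d : ℕ} (s : Finset (EuclideanSpace ℝ (Fin d))) : ℝ :=
  Metric.diam (openSimplex s)

/-- `ρ_K`, the radius of the largest ball contained in the element `K`. -/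
def cellInradius {d : ℕ} (s : Finset (EuclideanSpace ℝ (Fin d))) : ℝ :=
  sSup {r : ℝ | 0 ≤ r ∧ ∃ x, Metric.ball x r ⊆ openSimplex s}

/-- The mesh parameter `h = max_K h_K`. -/
def Triangulation.meshWidth {d : ℕ} {Ω : Set (EuclideanSpace ℝ (Fin d))}
    (T : Triangulation Ω) : ℝ :=
  ⨆ s : T.cells, cellDiam (s : Finset (EuclideanSpace ℝ (Fin d)))

/-- The family `T` is shape regular: `inf_n inf_{K ∈ T_n} ρ_K / h_K > 0`. -/
def ShapeRegular {d : ℕ} {Ω : Set (EuclideanSpace ℝ (Fin d))}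
    (T : ℕ → Triangulation Ω) : Prop :=
  ∃ μ : ℝ, 0 < μ ∧ ∀ n, ∀ s ∈ (T n).cells, μ ≤ cellInradius s / cellDiam s

/-- The family `T` is quasiuniform: `max_K h_K ≤ C min_K h_K` with `C` independent of the mesh. -/
def Quasiuniform {d : ℕ} {Ω : Set (EuclideanSpace ℝ (Fin d))}
    (T : ℕ → Triangulation Ω) : Prop :=
  ∃ C : ℝ, 0 < C ∧ ∀ n, ∀ s ∈ (T n).cells, ∀ t ∈ (T n).cells, cellDiam s ≤ C * cellDiam t

/-! ### The finite element scheme -/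

/-- The finite element space `P_k(T) ∩ C^0(Ω)`. -/
structure MemFESpace {d : ℕ} {Ω : Set (EuclideanSpace ℝ (Fin d))} (T : Triangulation Ω) (k : ℕ)
    (V : EuclideanSpace ℝ (Fin d) → ℝ) : Prop where
  continuousOn : ContinuousOn V Ω
  polynomial : ∀ s ∈ T.cells, ∃ q : MvPolynomial (Fin d) ℝ, q.totalDegree ≤ k ∧
    ∀ x ∈ openSimplex s, V x = MvPolynomial.eval (fun i => x i) q

/-- `w = P_k v`, the `L²(Ω)` projection of `v` onto the finite element space. -/
structure IsL2Projection {d : ℕ} {Ω : Set (EuclideanSpace ℝ (Fin d))} (T : Triangulation Ω)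
    (k : ℕ) (v w : EuclideanSpace ℝ (Fin d) → ℝ) : Prop where
  mem : MemFESpace T k w
  integral_eq : ∀ Φ, MemFESpace T k Φ → ∫ x in Ω, w x * Φ x = ∫ x in Ω, v x * Φ x

/-- `V` and `W` have the same values on `∂Ω`, where the boundary values of functions on `Ω` are
their limits from inside `Ω`. -/
def EqOnBoundary {d : ℕ} (Ω : Set (EuclideanSpace ℝ (Fin d)))
    (V W : EuclideanSpace ℝ (Fin d) → ℝ) : Prop :=
  ∀ x ∈ frontier Ω, Tendsto (fun y => V y - W y) (𝓝[Ω] x) (𝓝 0)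

/-- `U` solves the Galerkin discretisation of the `p`-Laplace problem: `U` lies in the finite
element space, `U = P_k g` on `∂Ω`, and `∫_Ω |DU|^{p-2} DU · DΦ = 0` for all finite element
functions `Φ` that vanish on `∂Ω`. -/
structure IsDiscreteSolution {d : ℕ} {Ω : Set (EuclideanSpace ℝ (Fin d))} (T : Triangulation Ω)
    (k : ℕ) (p : ℝ) (g U : EuclideanSpace ℝ (Fin d) → ℝ) : Prop where
  mem : MemFESpace T k U
  boundary : ∃ w, IsL2Projection T k g w ∧ EqOnBoundary Ω U w
  eq_zero : ∀ Φ, MemFESpace T k Φ → EqOnBoundary Ω Φ 0 → pLaplaceForm Ω p U Φ = 0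

end

noncomputable section

variable {d : ℕ} {Ω : Set (EuclideanSpace ℝ (Fin d))}

local notation "𝔼" d => EuclideanSpace ℝ (Fin d)

/-! ### Weak gradients -/

/-! Both solutions minimise the p-energy in their classes, and the two minimisers are compared by
uniform convexity and Morrey's inequality. Let wₙ be the L² projection of g, let g' be a
representative of g that is Lipschitz along segments in Ω, and put eₙ = (Uₙ - wₙ) - (u - g). Both
brackets have zero boundary values, so eₙ ∈ W₀^{1,p}, and Deₙ = Aₙ - Du with Aₙ = DUₙ - Dwₙ + Dg'.
The midpoint of Aₙ and Du is Du + ½Deₙ, so by minimality of u its energy is at least that of Du. If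
also limsup ‖Aₙ‖ₚ ≤ ‖Du‖ₚ, uniform convexity (`tendsto_of_midpoint`) forces Aₙ → Du in Lᵖ. Since p >
d, Morrey's inequality on W₀^{1,p} (`exists_morrey_const`, `MemW10.ae_enorm_le`) makes eₙ uniformly
small, and Uₙ - u = eₙ + (wₙ - g') almost everywhere.

The limsup bound comes from discrete minimality with competitor wₙ + Vₙ, where Vₙ interpolates a
test function close to u - g (`eventually_eLpNorm_gradient_le`). It needs Dwₙ → Dg' in Lᵖ; the
conclusion also needs wₙ → g' uniformly. These two facts about the projection are the technical
core. A weight that decays exponentially on the scale of the mesh is nearly constant on each cell,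
so the projection can be tested against a discrete substitute for weight times projection
(`exists_modulation_const`, built from Bernstein coefficients). This gives
`exists_projection_weighted_bound`: the value of a projection at a point feels distant data only
with exponential decay. Subtracting a piecewise affine approximant then yields |wₙ - g'| ≤ C L h,
and subtracting the tangent affine function at a point of differentiability yields Dwₙ → Dg' there.
Inverse estimates bound the gradients, and bounded convergence gives convergence in Lᵖ.

No regularity of ∂Ω is available: Ω may lie on both sides of a slit made of mesh faces, and
functions continuous on Ω may jump across it. Hence Lipschitz bounds are imposed only along segments
in Ω (`SegLip`), polynomials are glued only at points of Ω, and one vertex may carry several nodal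
values (`Triangulation.vertexGraph`). -/

theorem MeasureTheory.LocallyIntegrableOn.integrable_smul_of_tsupport_subset {F : Type*}
    [NormedAddCommGroup F] [NormedSpace ℝ F] {f : (𝔼 d) → F}
    (hf : LocallyIntegrableOn f Ω volume) {φ : (𝔼 d) → ℝ} (hφ : Continuous φ)
    (hc : HasCompactSupport φ) (hs : tsupport φ ⊆ Ω) : Integrable (fun x => φ x • f x) := by
  have h1 : IntegrableOn f (tsupport φ) := hf.integrableOn_compact_subset hs hc
  have h2 : IntegrableOn (fun x => φ x • f x) (tsupport φ) :=
    h1.continuousOn_smul hφ.continuousOn hc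
  refine (integrableOn_iff_integrable_of_support_subset ?_).1 h2
  intro x hx
  apply subset_tsupport φ
  rw [Function.mem_support] at hx ⊢
  rintro h
  simp [h] at hx

theorem setIntegral_eq_integral_of_tsupport_subset {F : Type*}
    [NormedAddCommGroup F] [NormedSpace ℝ F] (f : (𝔼 d) → F) {φ : (𝔼 d) → ℝ}
    (hs : tsupport φ ⊆ Ω) : ∫ x in Ω, φ x • f x = ∫ x, φ x • f x := by
  apply setIntegral_eq_integral_of_forall_compl_eq_zero
  intro x hx
  have : φ x = 0 := by
    by_contra h
    exact hx (hs (subset_tsupport φ h))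
  simp [this]

/-- Testing one coordinate direction at a time reduces uniqueness to the fundamental lemma of the
calculus of variations. It is what allows the chosen `weakGrad` to be replaced by any concrete weak
gradient. -/
theorem HasWeakGradient.ae_eq (hΩ : IsOpen Ω) {u : (𝔼 d) → ℝ} {G H : (𝔼 d) → (𝔼 d)}
    (hG : HasWeakGradient Ω u G) (hH : HasWeakGradient Ω u H) :
    G =ᵐ[volume.restrict Ω] H := by
  have key : ∀ v : 𝔼 d, ∀ᵐ x ∂(volume : Measure (𝔼 d)), x ∈ Ω → inner ℝ (G x - H x) v = 0 := by
    intro v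
    have hl : ∀ G : (𝔼 d) → (𝔼 d), LocallyIntegrableOn G Ω volume →
        LocallyIntegrableOn (fun x => inner ℝ (G x) v) Ω volume := by
      intro G hG x hx
      obtain ⟨s, hs, h⟩ := hG x hx
      exact ⟨s, hs, h.inner_const v⟩
    apply hΩ.ae_eq_zero_of_integral_contDiff_smul_eq_zero
    · exact hl _ (hG.locInt_grad.sub hH.locInt_grad)
    · intro φ h1 h2 h3
      have e1 := hG.integral_eq φ ⟨h1, h2, h3⟩ v
      rw [hH.integral_eq φ ⟨h1, h2, h3⟩ v, neg_inj] at e1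
      have e2 := setIntegral_eq_integral_of_tsupport_subset (fun x => inner ℝ (G x) v) h3
      have e3 := setIntegral_eq_integral_of_tsupport_subset (fun x => inner ℝ (H x) v) h3
      simp only [smul_eq_mul] at e2 e3
      rw [e2, e3] at e1
      simp only [inner_sub_left, smul_eq_mul, mul_sub]
      rw [integral_sub, e1, sub_self]
      · exact (hl _ hG.locInt_grad).integrable_smul_of_tsupport_subset h1.continuous h2 h3
      · exact (hl _ hH.locInt_grad).integrable_smul_of_tsupport_subset h1.continuous h2 h3
  have key2 : ∀ᵐ x ∂(volume : Measure (𝔼 d)), ∀ i : Fin d, x ∈ Ω →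
      inner ℝ (G x - H x) (EuclideanSpace.single i (1:ℝ)) = 0 := ae_all_iff.2 fun i => key _
  refine (ae_restrict_iff' hΩ.measurableSet).2 ?_
  filter_upwards [key2] with x hx hxΩ
  ext i
  have := hx i hxΩ
  simp [EuclideanSpace.inner_single_right] at this
  linarith

theorem HasWeakGradient.congr_ae (hΩ : IsOpen Ω) {u v : (𝔼 d) → ℝ} {G : (𝔼 d) → (𝔼 d)}
    (hG : HasWeakGradient Ω u G) (h : u =ᵐ[volume.restrict Ω] v) : HasWeakGradient Ω v G := by
  refine ⟨?_, hG.locInt_grad, ?_⟩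
  · refine (locallyIntegrableOn_iff hΩ.isLocallyClosed).2 ?_
    intro K hK hc
    refine IntegrableOn.congr_fun_ae (hG.locInt.integrableOn_compact_subset hK hc) ?_
    exact ae_restrict_of_ae_restrict_of_subset hK h
  · intro φ hφ w
    rw [← hG.integral_eq φ hφ w]
    apply integral_congr_ae
    filter_upwards [h] with x hx
    rw [hx]

theorem HasWeakGradient.weakGrad_ae_eq (hΩ : IsOpen Ω) {u : (𝔼 d) → ℝ} {G : (𝔼 d) → (𝔼 d)}
    (hG : HasWeakGradient Ω u G) : weakGrad Ω u =ᵐ[volume.restrict Ω] G := by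
  have h : ∃ G, HasWeakGradient Ω u G := ⟨G, hG⟩
  have : HasWeakGradient Ω u (weakGrad Ω u) := by
    rw [weakGrad, dif_pos h]
    exact h.choose_spec
  exact this.ae_eq hΩ hG

theorem hasWeakGradient_weakGrad {u : (𝔼 d) → ℝ} (h : ∃ G, HasWeakGradient Ω u G) :
    HasWeakGradient Ω u (weakGrad Ω u) := by
  rw [weakGrad, dif_pos h]
  exact h.choose_spec

theorem IsTestFunction.fderiv_apply {φ : (𝔼 d) → ℝ} (hφ : IsTestFunction Ω φ) (v : 𝔼 d) :
    IsTestFunction Ω (fun x => fderiv ℝ φ x v) := by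
  refine ⟨?_, hφ.compact.fderiv_apply (𝕜 := ℝ) v, ?_⟩
  · have := hφ.smooth.fderiv_right (m := ∞) (by simp)
    exact this.clm_apply contDiff_const
  · exact (tsupport_fderiv_apply_subset ℝ v).trans hφ.support

theorem IsTestFunction.integrable_smul {F : Type*}
    [NormedAddCommGroup F] [NormedSpace ℝ F] {φ : (𝔼 d) → ℝ} (hφ : IsTestFunction Ω φ)
    {f : (𝔼 d) → F} (hf : LocallyIntegrableOn f Ω volume) :
    Integrable (fun x => φ x • f x) :=
  hf.integrable_smul_of_tsupport_subset hφ.smooth.continuous hφ.compact hφ.support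

theorem HasWeakGradient.sub {u v : (𝔼 d) → ℝ} {G H : (𝔼 d) → (𝔼 d)}
    (hG : HasWeakGradient Ω u G) (hH : HasWeakGradient Ω v H) :
    HasWeakGradient Ω (fun x => u x - v x) (fun x => G x - H x) := by
  refine ⟨hG.locInt.sub hH.locInt, hG.locInt_grad.sub hH.locInt_grad, fun φ hφ w => ?_⟩
  have e1 := (hφ.integrable_smul hG.locInt_grad).inner_const (𝕜 := ℝ) w
  have e2 := (hφ.integrable_smul hH.locInt_grad).inner_const (𝕜 := ℝ) w
  have e3 := (hφ.fderiv_apply w).integrable_smul hG.locInt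
  have e4 := (hφ.fderiv_apply w).integrable_smul hH.locInt
  simp only [inner_smul_left, smul_eq_mul, RCLike.conj_to_real] at e1 e2 e3 e4
  simp only [inner_sub_left, mul_sub, sub_mul]
  simp only [mul_comm _ (fderiv ℝ φ _ w)]
  rw [integral_sub e3.integrableOn e4.integrableOn, integral_sub e1.integrableOn e2.integrableOn]
  have h1 := hG.integral_eq φ hφ w
  have h2 := hH.integral_eq φ hφ w
  simp only [mul_comm _ (fderiv ℝ φ _ w)] at h1 h2
  rw [h1, h2]
  ring

/-! ### Functions that are Lipschitz along segments -/

/-- `f` is `L`-Lipschitz along every segment contained in `Ω`. -/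
def SegLip (Ω : Set (𝔼 d)) (L : ℝ) (f : (𝔼 d) → ℝ) : Prop :=
  ∀ x y, segment ℝ x y ⊆ Ω → |f x - f y| ≤ L * dist x y

namespace SegLip

variable {L : ℝ} {f : (𝔼 d) → ℝ}

theorem lipschitzOnWith (hL : 0 ≤ L) (hf : SegLip Ω L f) {C : Set (𝔼 d)} (hC : Convex ℝ C)
    (hCΩ : C ⊆ Ω) : LipschitzOnWith L.toNNReal f C := by
  apply LipschitzOnWith.of_dist_le_mul
  intro x hx y hy
  rw [Real.coe_toNNReal L hL, Real.dist_eq]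
  exact hf x y ((hC.segment_subset hx hy).trans hCΩ)

theorem locallyLipschitzOn (hΩ : IsOpen Ω) (hL : 0 ≤ L) (hf : SegLip Ω L f) :
    LocallyLipschitzOn Ω f := by
  intro x hx
  obtain ⟨r, hr, hb⟩ := Metric.isOpen_iff.1 hΩ x hx
  exact ⟨_, _, mem_nhdsWithin_of_mem_nhds (Metric.ball_mem_nhds x hr),
    hf.lipschitzOnWith hL (convex_ball x r) hb⟩

theorem continuousOn (hΩ : IsOpen Ω) (hL : 0 ≤ L) (hf : SegLip Ω L f) : ContinuousOn f Ω :=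
  (hf.locallyLipschitzOn hΩ hL).continuousOn

theorem norm_gradient_le (hΩ : IsOpen Ω) (hL : 0 ≤ L) (hf : SegLip Ω L f) {x : 𝔼 d}
    (hx : x ∈ Ω) : ‖gradient f x‖ ≤ L := by
  obtain ⟨r, hr, hb⟩ := Metric.isOpen_iff.1 hΩ x hx
  have := norm_fderiv_le_of_lipschitzOn ℝ (Metric.ball_mem_nhds x hr)
    (hf.lipschitzOnWith hL (convex_ball x r) hb)
  rw [gradient, LinearIsometryEquiv.norm_map]
  rwa [Real.coe_toNNReal L hL] at this

theorem ae_differentiableAt (hΩ : IsOpen Ω) (hL : 0 ≤ L) (hf : SegLip Ω L f) :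
    ∀ᵐ x ∂(volume.restrict Ω), DifferentiableAt ℝ f x := by
  rw [ae_restrict_iff' hΩ.measurableSet]
  have : volume {x | x ∈ Ω ∧ ¬ DifferentiableAt ℝ f x} = 0 := by
    refine measure_null_of_locally_null _ fun x hx => ?_
    obtain ⟨r, hr, hb⟩ := Metric.isOpen_iff.1 hΩ x hx.1
    have h := (hf.lipschitzOnWith hL (convex_ball x r) hb).ae_differentiableWithinAt_of_mem
      (μ := volume)
    refine ⟨Metric.ball x r ∩ {x | x ∈ Ω ∧ ¬ DifferentiableAt ℝ f x},
      inter_mem (mem_nhdsWithin_of_mem_nhds (Metric.ball_mem_nhds x hr)) self_mem_nhdsWithin, ?_⟩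
    refine measure_mono_null ?_ h
    rintro y ⟨hy, -, hy2⟩ hd
    exact hy2 ((hd hy).differentiableAt (Metric.isOpen_ball.mem_nhds hy))
  rw [ae_iff]
  convert this using 2
  ext x
  simp

/-- Integration by parts is used for globally Lipschitz functions, while `SegLip` is only a local
condition. Near a compact set a Lipschitz extension has the same values and the same derivatives. -/
theorem exists_lipschitzWith (hΩ : IsOpen Ω) (hL : 0 ≤ L) (hf : SegLip Ω L f) {K : Set (𝔼 d)}
    (hK : IsCompact K) (hKΩ : K ⊆ Ω) :
    ∃ F : (𝔼 d) → ℝ, (∃ C, LipschitzWith C F) ∧ ∀ x ∈ K, F =ᶠ[𝓝 x] f := by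
  obtain ⟨K', hK', h1, h2⟩ := exists_compact_between hK hΩ hKΩ
  obtain ⟨C, hC⟩ := ((hf.locallyLipschitzOn hΩ hL).mono h2).exists_lipschitzOnWith_of_compact hK'
  obtain ⟨F, hF, he⟩ := hC.extend_real
  refine ⟨F, ⟨C, hF⟩, fun x hx => ?_⟩
  filter_upwards [isOpen_interior.mem_nhds (h1 hx)] with y hy
  exact (he (interior_subset hy)).symm

end SegLip

theorem measurable_gradient (f : (𝔼 d) → ℝ) : Measurable (gradient f) :=
  (LinearIsometryEquiv.continuous _).measurable.comp (measurable_fderiv ℝ f)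

namespace SegLip

variable {L : ℝ} {f : (𝔼 d) → ℝ}

/-- By Rademacher's theorem the pointwise gradient exists almost everywhere. Integrating by parts
with a global Lipschitz extension from the support of the test function identifies it as the weak
gradient. -/
theorem hasWeakGradient (hΩ : IsOpen Ω) (hL : 0 ≤ L) (hf : SegLip Ω L f) :
    HasWeakGradient Ω f (gradient f) := by
  refine ⟨(hf.continuousOn hΩ hL).locallyIntegrableOn hΩ.measurableSet, ?_, fun φ hφ v => ?_⟩
  · refine (locallyIntegrableOn_iff hΩ.isLocallyClosed).2 fun K hK hc => ?_
    refine Measure.integrableOn_of_bounded (M := L) hc.measure_lt_top.ne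
      (measurable_gradient f).aestronglyMeasurable ?_
    rw [ae_restrict_iff' hc.measurableSet]
    exact Eventually.of_forall fun x hx => hf.norm_gradient_le hΩ hL (hK hx)
  · obtain ⟨F, ⟨C, hF⟩, he⟩ := hf.exists_lipschitzWith hΩ hL hφ.compact hφ.support
    obtain ⟨D, hD⟩ := hφ.smooth.lipschitzWith_of_hasCompactSupport hφ.compact (by simp)
    have key := LipschitzWith.integral_lineDeriv_mul_eq (μ := volume) hF hD hφ.compact v
    have e1 := setIntegral_eq_integral_of_tsupport_subset f (hφ.fderiv_apply v).support
    have e2 := setIntegral_eq_integral_of_tsupport_subset (fun x => inner ℝ (gradient f x) v)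
      hφ.support
    simp only [smul_eq_mul] at e1 e2
    simp only [mul_comm (f _)]
    rw [e1, e2]
    have h1 : ∫ x, φ x * inner ℝ (gradient f x) v = ∫ x, lineDeriv ℝ F x v * φ x := by
      apply integral_congr_ae
      filter_upwards [hF.ae_differentiableAt] with x hx
      by_cases hxK : x ∈ tsupport φ
      · rw [inner_gradient_left, hx.lineDeriv_eq_fderiv, (he x hxK).fderiv_eq, mul_comm]
      · simp [image_eq_zero_of_notMem_tsupport hxK]
    have h2 : ∫ x, fderiv ℝ φ x v * f x = - ∫ x, lineDeriv ℝ φ x (-v) * F x := by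
      rw [← integral_neg]
      congr 1
      ext x
      rw [(hφ.smooth.differentiable (by simp) x).lineDeriv_eq_fderiv]
      by_cases hxK : x ∈ tsupport φ
      · rw [(he x hxK).eq_of_nhds]; simp
      · have : fderiv ℝ φ x = 0 := by
          have := (tsupport_fderiv_subset (𝕜 := ℝ) (f := φ)).trans subset_rfl
          exact image_eq_zero_of_notMem_tsupport fun h => hxK (this h)
        simp [this]
    rw [h1, h2, key]

end SegLip

/-! ### Mollification -/

open scoped Convolution in
/-- The mollification of `u` by a bump function. -/
def mollify (φ : ContDiffBump (0 : 𝔼 d)) (u : (𝔼 d) → ℝ) : (𝔼 d) → ℝ :=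
  φ.normed volume ⋆[ContinuousLinearMap.lsmul ℝ ℝ, volume] u

theorem mollify_apply (φ : ContDiffBump (0 : 𝔼 d)) (u : (𝔼 d) → ℝ) (x : 𝔼 d) :
    mollify φ u x = ∫ t, φ.normed volume (x - t) * u t := by
  rw [mollify, convolution_eq_swap]
  rfl

theorem integral_normed_sub (φ : ContDiffBump (0 : 𝔼 d)) (x : 𝔼 d) :
    ∫ t, φ.normed volume (x - t) = 1 := by
  rw [integral_sub_left_eq_self (fun t => φ.normed volume t) volume x, φ.integral_normed]

theorem integrable_normed_sub (φ : ContDiffBump (0 : 𝔼 d)) (x : 𝔼 d) :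
    Integrable fun t => φ.normed volume (x - t) :=
  φ.integrable_normed.comp_sub_left x

theorem norm_integral_normed_sub_mul_le (φ : ContDiffBump (0 : 𝔼 d)) {u : (𝔼 d) → ℝ} {x : 𝔼 d} {B : ℝ}
    (hu : ∀ᵐ t, t ∈ Metric.closedBall x φ.rOut → |u t| ≤ B) :
    |∫ t, φ.normed volume (x - t) * u t| ≤ B := by
  have : ‖∫ t, φ.normed volume (x - t) * u t‖ ≤ ∫ t, φ.normed volume (x - t) * B := by
    apply norm_integral_le_of_norm_le ((integrable_normed_sub φ x).mul_const B)
    filter_upwards [hu] with t ht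
    rw [norm_mul, Real.norm_of_nonneg (φ.nonneg_normed _)]
    by_cases h : t ∈ Metric.closedBall x φ.rOut
    · exact mul_le_mul_of_nonneg_left (ht h) (φ.nonneg_normed _)
    · have : φ.normed volume (x - t) = 0 := by
        by_contra h'
        have h2 : x - t ∈ Function.support (φ.normed volume) := h'
        rw [φ.support_normed_eq] at h2
        rw [mem_ball_zero_iff, ← dist_eq_norm, dist_comm] at h2
        exact h (Metric.mem_closedBall.2 h2.le)
      simp [this]
  rwa [integral_mul_const, integral_normed_sub, one_mul] at this

theorem isTestFunction_normed_sub (φ : ContDiffBump (0 : 𝔼 d)) {x : 𝔼 d}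
    (hb : Metric.closedBall x φ.rOut ⊆ Ω) : IsTestFunction Ω fun t => φ.normed volume (x - t) := by
  have hsub : Function.support (fun t => φ.normed volume (x - t)) ⊆ Metric.closedBall x φ.rOut := by
    intro t ht
    have h2 : x - t ∈ Function.support (φ.normed volume) := ht
    rw [φ.support_normed_eq] at h2
    rw [mem_ball_zero_iff, ← dist_eq_norm, dist_comm] at h2
    exact Metric.mem_closedBall.2 h2.le
  have hs : tsupport (fun t => φ.normed volume (x - t)) ⊆ Metric.closedBall x φ.rOut :=
    closure_minimal hsub Metric.isClosed_closedBall
  exact ⟨φ.contDiff_normed.comp (contDiff_const.sub contDiff_id),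
    HasCompactSupport.of_support_subset_isCompact (isCompact_closedBall _ _) hsub, hs.trans hb⟩

theorem contDiff_mollify (φ : ContDiffBump (0 : 𝔼 d)) {u : (𝔼 d) → ℝ}
    (hu : LocallyIntegrable u volume) : ContDiff ℝ ∞ (mollify φ u) :=
  φ.hasCompactSupport_normed.contDiff_convolution_left _ φ.contDiff_normed hu

/-- The derivative falls on the kernel, and the reflected kernel centred at `x` is a test function
on Ω as soon as its ball lies in Ω. So the weak gradient on Ω suffices, whatever `u` does outside.
-/
theorem fderiv_mollify (φ : ContDiffBump (0 : 𝔼 d)) {u : (𝔼 d) → ℝ} {G : (𝔼 d) → (𝔼 d)}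
    (hu : HasWeakGradient Ω u G) (hloc : LocallyIntegrable u volume) {x : 𝔼 d}
    (hb : Metric.closedBall x φ.rOut ⊆ Ω) (v : 𝔼 d) :
    fderiv ℝ (mollify φ u) x v = ∫ t, φ.normed volume (x - t) * inner ℝ (G t) v := by
  have h1 := φ.hasCompactSupport_normed (μ := volume) |>.hasFDerivAt_convolution_left
    (ContinuousLinearMap.lsmul ℝ ℝ) φ.contDiff_normed hloc x
  have hT := isTestFunction_normed_sub φ hb
  have h2 := hu.integral_eq _ hT v
  have e1 := setIntegral_eq_integral_of_tsupport_subset u (hT.fderiv_apply v).support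
  have e2 := setIntegral_eq_integral_of_tsupport_subset (fun x => inner ℝ (G x) v) hT.support
  simp only [smul_eq_mul] at e1 e2
  simp only [mul_comm (u _)] at h2
  rw [e1, e2] at h2
  have h3 : ∀ t, fderiv ℝ (fun t => φ.normed volume (x - t)) t v
      = - fderiv ℝ (φ.normed volume) (x - t) v := by
    intro t
    have ha : HasFDerivAt (fun t => φ.normed volume (x - t))
        ((fderiv ℝ (φ.normed volume) (x - t)).comp (-ContinuousLinearMap.id ℝ (𝔼 d))) t :=
      HasFDerivAt.comp t ((φ.contDiff_normed (n := 1)).differentiable (by simp) _).hasFDerivAt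
        ((hasFDerivAt_id t).const_sub x)
    rw [ha.fderiv]
    simp
  simp only [h3, neg_mul, integral_neg, neg_inj] at h2
  rw [← h2, mollify, h1.fderiv, convolution_eq_swap]
  rw [ContinuousLinearMap.integral_apply]
  · rfl
  · have := (HasCompactSupport.convolutionExists_left
      (L := (ContinuousLinearMap.lsmul ℝ ℝ : ℝ →L[ℝ] ℝ →L[ℝ] ℝ).precompL (𝔼 d))
      ((φ.hasCompactSupport_normed (μ := volume)).fderiv (𝕜 := ℝ))
      ((φ.contDiff_normed (μ := volume) (n := 1)).continuous_fderiv (by simp)) hloc x).integrable_swap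
    exact this

theorem norm_fderiv_mollify_le (φ : ContDiffBump (0 : 𝔼 d)) {u : (𝔼 d) → ℝ} {G : (𝔼 d) → (𝔼 d)}
    (hu : HasWeakGradient Ω u G) (hloc : LocallyIntegrable u volume) {x : 𝔼 d}
    (hb : Metric.closedBall x φ.rOut ⊆ Ω) {L : ℝ} (hL : 0 ≤ L)
    (hG : ∀ᵐ t, t ∈ Ω → ‖G t‖ ≤ L) : ‖fderiv ℝ (mollify φ u) x‖ ≤ L := by
  apply ContinuousLinearMap.opNorm_le_bound _ hL
  intro v
  rw [fderiv_mollify φ hu hloc hb v]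
  apply norm_integral_normed_sub_mul_le
  filter_upwards [hG] with t ht h
  exact (abs_real_inner_le_norm _ _).trans
    (mul_le_mul_of_nonneg_right (ht (hb h)) (norm_nonneg _))

/-- A sequence of mollifiers. -/
def mollifier (d : ℕ) (n : ℕ) : ContDiffBump (0 : 𝔼 d) :=
  ⟨1 / (n + 1 : ℝ), 2 / (n + 1 : ℝ), by positivity,
    by gcongr; norm_num⟩

theorem tendsto_mollifier_rOut : Tendsto (fun n => (mollifier d n).rOut) atTop (𝓝 0) := by
  have := (tendsto_one_div_add_atTop_nhds_zero_nat (𝕜 := ℝ)).const_mul 2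
  simpa [mollifier, mul_div_assoc, div_eq_mul_inv] using this

theorem ae_tendsto_mollifier_convolution {F : Type*} [NormedAddCommGroup F] [NormedSpace ℝ F]
    [CompleteSpace F] {u : (𝔼 d) → F} (hu : LocallyIntegrable u volume) :
    ∀ᵐ x, Tendsto (fun n => ∫ t, (mollifier d n).normed volume (x - t) • u t) atTop (𝓝 (u x)) := by
  have := ContDiffBump.ae_convolution_tendsto_right_of_locallyIntegrable (φ := mollifier d)
    (K := 2) tendsto_mollifier_rOut (Eventually.of_forall fun n => by
      simp [mollifier, div_eq_mul_inv]) hu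
  simpa only [convolution_eq_swap, ContinuousLinearMap.lsmul_apply] using this

/-- A function with bounded weak gradient has a representative that is Lipschitz along segments. -/
theorem HasWeakGradient.exists_segLip (hΩ : IsOpen Ω) {u : (𝔼 d) → ℝ} {G : (𝔼 d) → (𝔼 d)}
    (hu : HasWeakGradient Ω u G) {B : ℝ} (huB : ∀ᵐ x ∂(volume.restrict Ω), |u x| ≤ B)
    (hmeas : AEStronglyMeasurable u (volume.restrict Ω)) {L : ℝ} (hL : 0 ≤ L)
    (hG : ∀ᵐ x ∂(volume.restrict Ω), ‖G x‖ ≤ L) :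
    ∃ u' : (𝔼 d) → ℝ, SegLip Ω L u' ∧ u' =ᵐ[volume.restrict Ω] u := by
  -- Extension by zero makes the mollification defined everywhere; near a segment in Ω and for small
  -- radii it only sees values inside Ω.
  set w := Ω.indicator u with hw
  have hwu : u =ᵐ[volume.restrict Ω] w := by
    filter_upwards [ae_restrict_mem hΩ.measurableSet] with x hx
    simp [hw, hx]
  have hww := hu.congr_ae hΩ hwu
  have hwB : ∀ᵐ x, |w x| ≤ max B 0 := by
    filter_upwards [(ae_restrict_iff' hΩ.measurableSet).1 huB] with x hx
    by_cases h : x ∈ Ω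
    · simpa [hw, h] using Or.inl (hx h)
    · simp [hw, h]
  have hwm : AEStronglyMeasurable w volume :=
    (aestronglyMeasurable_indicator_iff hΩ.measurableSet).2 hmeas
  have hloc : LocallyIntegrable w volume := by
    have : MemLp w ∞ volume := memLp_top_of_bound hwm (max B 0) hwB
    exact this.locallyIntegrable (by simp)
  have hG' := (ae_restrict_iff' hΩ.measurableSet).1 hG
  -- Mollifications converge only almost everywhere, but the Lipschitz bound is wanted for every
  -- pair of points. An ultrafilter limit of these bounded sequences exists at every point and
  -- preserves the bound.
  have hlim : ∀ x, ∃ a, Tendsto (fun n => mollify (mollifier d n) w x)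
      (hyperfilter ℕ : Filter ℕ) (𝓝 a) := by
    intro x
    have hmem : ∀ n, mollify (mollifier d n) w x ∈ Set.Icc (-(max B 0)) (max B 0) := by
      intro n
      rw [Set.mem_Icc, ← abs_le, mollify_apply]
      apply norm_integral_normed_sub_mul_le
      filter_upwards [hwB] with t ht _ using ht
    obtain ⟨a, -, ha⟩ := isCompact_Icc.ultrafilter_le_nhds
      ((hyperfilter ℕ).map fun n => mollify (mollifier d n) w x)
      (by
        rw [Ultrafilter.coe_map, le_principal_iff, mem_map]
        exact Eventually.of_forall hmem)
    exact ⟨a, ha⟩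
  choose u' hu' using hlim
  refine ⟨u', ?_, ?_⟩
  · intro x y hxy
    have hc : IsCompact (segment ℝ x y) := by
      rw [← convexHull_pair]
      exact (Set.toFinite {x, y}).isCompact_convexHull (𝕜 := ℝ)
    obtain ⟨δ, hδ, hδΩ⟩ := hc.exists_cthickening_subset_open hΩ hxy
    have hev : ∀ᶠ n in atTop, |mollify (mollifier d n) w x - mollify (mollifier d n) w y|
        ≤ L * dist x y := by
      filter_upwards [tendsto_mollifier_rOut.eventually_lt_const hδ] with n hn
      have := Convex.norm_image_sub_le_of_norm_fderiv_le (𝕜 := ℝ) (C := L)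
        (f := mollify (mollifier d n) w)
        (fun z _ => (contDiff_mollify _ hloc).differentiable (by simp) z)
        (fun z hz => norm_fderiv_mollify_le _ hww hloc
          (((Metric.closedBall_subset_closedBall hn.le).trans
            (Metric.closedBall_subset_cthickening hz δ)).trans hδΩ) hL hG')
        (convex_segment x y) (right_mem_segment ℝ x y) (left_mem_segment ℝ x y)
      rwa [← dist_eq_norm] at this
    have h1 := ((hu' x).sub (hu' y)).abs
    refine le_of_tendsto h1 ?_
    exact (Nat.hyperfilter_le_atTop) hev
  · have h1 := ae_tendsto_mollifier_convolution hloc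
    have h2 : u' =ᵐ[volume.restrict Ω] w := by
      refine ae_restrict_of_ae ?_
      filter_upwards [h1] with x hx
      refine tendsto_nhds_unique (hu' x) ?_
      simp only [mollify_apply]
      exact hx.mono_left Nat.hyperfilter_le_atTop
    exact h2.trans hwu.symm

/-! ### Bounded convergence and local Lipschitz bounds -/

theorem tendsto_eLpNorm_zero_of_bounded {α F : Type*} [MeasurableSpace α] {μ : Measure α}
    [IsFiniteMeasure μ] [NormedAddCommGroup F] {p : ℝ} (hp : 0 < p) {H : ℕ → α → F} {C : ℝ}
    (hm : ∀ n, AEStronglyMeasurable (H n) μ) (hC : ∀ n, ∀ᵐ x ∂μ, ‖H n x‖ ≤ C)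
    (h0 : ∀ᵐ x ∂μ, Tendsto (fun n => H n x) atTop (𝓝 0)) :
    Tendsto (fun n => eLpNorm (H n) (ENNReal.ofReal p) μ) atTop (𝓝 0) := by
  have hp0 : ENNReal.ofReal p ≠ 0 := by simpa using hp
  have hpt : (ENNReal.ofReal p).toReal = p := ENNReal.toReal_ofReal hp.le
  simp only [eLpNorm_eq_lintegral_rpow_enorm_toReal hp0 ENNReal.ofReal_ne_top, hpt]
  have h1 : Tendsto (fun n => ∫⁻ x, ‖H n x‖ₑ ^ p ∂μ) atTop (𝓝 (∫⁻ _, 0 ∂μ)) := by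
    refine tendsto_lintegral_of_dominated_convergence' (fun _ => ENNReal.ofReal C ^ p)
      (fun n => (hm n).enorm.pow_const p) (fun n => ?_) ?_ ?_
    · filter_upwards [hC n] with x hx
      gcongr
      rw [← ofReal_norm]
      exact ENNReal.ofReal_le_ofReal hx
    · rw [lintegral_const]
      exact ENNReal.mul_ne_top (ENNReal.rpow_ne_top_of_nonneg hp.le ENNReal.ofReal_ne_top)
        (measure_ne_top _ _)
    · filter_upwards [h0] with x hx
      have : Tendsto (fun n => ‖H n x‖ₑ ^ p) atTop (𝓝 (‖(0 : F)‖ₑ ^ p)) :=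
        (ENNReal.continuous_rpow_const.tendsto _).comp ((continuous_enorm.tendsto _).comp hx)
      simpa [hp] using this
  have h2 := (ENNReal.continuous_rpow_const (y := 1 / p)).tendsto (∫⁻ _, 0 ∂μ) |>.comp h1
  simpa [hp, Function.comp_def] using h2

/-- Continuous induction along the segment: the parameters at which the bound from the starting
point holds form a closed set that can be prolonged to the right. The hypothesis compares nearby
points with `x` only, not with each other, which is what cellwise information provides. -/
theorem segLip_of_eventually {L : ℝ} {f : (𝔼 d) → ℝ}
    (h : ∀ x ∈ Ω, ∀ᶠ y in 𝓝 x, |f y - f x| ≤ L * dist y x) : SegLip Ω L f := by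
  intro x y hxy
  set γ : ℝ → (𝔼 d) := fun t => AffineMap.lineMap x y t with hγ
  have hγc : Continuous γ := AffineMap.lineMap_continuous
  have hγΩ : ∀ t ∈ Set.Icc (0:ℝ) 1, γ t ∈ Ω := fun t ht =>
    hxy (by rw [segment_eq_image_lineMap]; exact ⟨t, ht, rfl⟩)
  have hcont : ContinuousOn (fun t => f (γ t)) (Set.Icc 0 1) := by
    intro t ht
    refine ContinuousAt.comp_continuousWithinAt (f := γ) ?_ hγc.continuousWithinAt
    rw [ContinuousAt, tendsto_iff_dist_tendsto_zero]
    refine squeeze_zero' (Eventually.of_forall fun _ => dist_nonneg) (h _ (hγΩ t ht)) ?_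
    have : Continuous fun y => L * dist y (γ t) := by fun_prop
    simpa using this.tendsto (γ t)
  have key : Set.Icc (0:ℝ) 1 ⊆ {t | |f (γ t) - f (γ 0)| ≤ L * dist x y * t} := by
    apply IsClosed.Icc_subset_of_forall_mem_nhdsWithin
    · have h1 : ContinuousOn (fun t => |f (γ t) - f (γ 0)| - L * dist x y * t) (Set.Icc 0 1) :=
        (hcont.sub continuousOn_const).abs.sub (by fun_prop)
      have h2 := h1.preimage_isClosed_of_isClosed isClosed_Icc (isClosed_Iic (a := 0))
      convert h2 using 1
      ext t
      simp [and_comm]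
    · simp
    · rintro t ⟨ht, ht01⟩
      have h1 := hγc.continuousAt.eventually (h _ (hγΩ t ⟨ht01.1, ht01.2.le⟩))
      filter_upwards [mem_nhdsWithin_of_mem_nhds h1, self_mem_nhdsWithin] with s hs hst
      have h2 : dist (γ s) (γ t) = (s - t) * dist x y := by
        rw [hγ, dist_lineMap_lineMap, Real.dist_eq, abs_of_pos (sub_pos.2 hst)]
      simp only [Set.mem_ofPred_eq] at hs ht ⊢
      calc |f (γ s) - f (γ 0)| ≤ |f (γ s) - f (γ t)| + |f (γ t) - f (γ 0)| := abs_sub_le _ _ _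
        _ ≤ L * ((s - t) * dist x y) + L * dist x y * t := by rw [h2] at hs; gcongr
        _ = L * dist x y * s := by ring
  have := key (Set.right_mem_Icc.2 zero_le_one)
  simp only [Set.mem_ofPred_eq, hγ, AffineMap.lineMap_apply_one, AffineMap.lineMap_apply_zero,
    mul_one] at this
  rwa [abs_sub_comm]

theorem SegLip.eventually (hΩ : IsOpen Ω) {L : ℝ} {f : (𝔼 d) → ℝ} (h : SegLip Ω L f) {x : 𝔼 d}
    (hx : x ∈ Ω) : ∀ᶠ y in 𝓝 x, |f y - f x| ≤ L * dist y x := by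
  obtain ⟨r, hr, hb⟩ := Metric.isOpen_iff.1 hΩ x hx
  filter_upwards [Metric.ball_mem_nhds x hr] with y hy
  exact h y x (((convex_ball x r).segment_subset hy (Metric.mem_ball_self hr)).trans hb)

theorem SegLip.memW1 (hΩ : IsOpen Ω) (hΩb : Bornology.IsBounded Ω) {L : ℝ} (hL : 0 ≤ L)
    {f : (𝔼 d) → ℝ} (hf : SegLip Ω L f) {B : ℝ} (hB : ∀ x ∈ Ω, |f x| ≤ B) (p : ℝ≥0∞) :
    MemW1 Ω p f := by
  have hw := hf.hasWeakGradient hΩ hL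
  have : IsFiniteMeasure (volume.restrict Ω) := ⟨by simpa using hΩb.measure_lt_top⟩
  refine ⟨?_, ⟨_, hw⟩, ?_⟩
  · refine MemLp.of_bound ((hf.continuousOn hΩ hL).aestronglyMeasurable hΩ.measurableSet) B ?_
    filter_upwards [ae_restrict_mem hΩ.measurableSet] with x hx using hB x hx
  · rw [memLp_congr_ae (hw.weakGrad_ae_eq hΩ)]
    refine MemLp.of_bound (measurable_gradient f).aestronglyMeasurable L ?_
    filter_upwards [ae_restrict_mem hΩ.measurableSet] with x hx using hf.norm_gradient_le hΩ hL hx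

/-- A Lipschitz function has vanishing gradient almost everywhere on its zero set. -/
theorem SegLip.ae_gradient_eq_zero (hd : 1 ≤ d) (hΩ : IsOpen Ω) {L : ℝ} (hL : 0 ≤ L)
    {f : (𝔼 d) → ℝ} (hf : SegLip Ω L f) :
    ∀ᵐ x ∂(volume.restrict Ω), f x = 0 → gradient f x = 0 := by
  set e : 𝔼 d := EuclideanSpace.single ⟨0, hd⟩ 1 with he
  have hen : ‖e‖ = 1 := by simp [he]
  set s : Set (𝔼 d) := {x | x ∈ Ω ∧ f x = 0 ∧ DifferentiableAt ℝ f x} with hs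
  have hms : MeasurableSet s := by
    have h1 : MeasurableSet (Ω \ (Ω ∩ f ⁻¹' {0}ᶜ)) :=
      hΩ.measurableSet.diff
        ((hf.continuousOn hΩ hL).isOpen_inter_preimage hΩ isOpen_compl_singleton).measurableSet
    have h2 : MeasurableSet {x | DifferentiableAt ℝ f x} := measurableSet_of_differentiableAt ℝ f
    convert h1.inter h2 using 1
    ext x
    simp only [hs, Set.mem_ofPred_eq, Set.mem_inter_iff, Set.mem_sdiff, Set.mem_preimage,
      Set.mem_compl_iff, Set.mem_singleton_iff]
    tauto
  -- On the zero set the map coincides with zero, so it is approximated linearly with constant `0`,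
  -- and almost everywhere on that set its derivative inherits this constant. The unit vector `e`
  -- turns `f` into a self-map of the space, as the density-point lemma concerns such maps.
  have happ : ApproximatesLinearOn (fun x => f x • e) (0 : (𝔼 d) →L[ℝ] (𝔼 d)) s 0 := by
    intro x hx y hy
    simp [hx.2.1, hy.2.1]
  have key := happ.norm_fderiv_sub_le volume hms
    (fun x => (fderiv ℝ f x).smulRight e) fun x hx =>
      (hx.2.2.hasFDerivAt.smul_const e).hasFDerivWithinAt
  have h3 := (ae_restrict_iff' hms).1 key
  have h4 := hf.ae_differentiableAt hΩ hL
  filter_upwards [h4, ae_restrict_of_ae h3, ae_restrict_mem hΩ.measurableSet] with x hx1 hx2 hx3 hx0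
  have := hx2 ⟨hx3, hx0, hx1⟩
  rw [nonpos_iff_eq_zero, nnnorm_eq_zero, sub_zero] at this
  rw [gradient]
  have h5 : fderiv ℝ f x = 0 := by
    ext v
    have h6 := congrArg (fun T : (𝔼 d) →L[ℝ] (𝔼 d) => T v) this
    have h7 : ‖fderiv ℝ f x v • e‖ = 0 := by simpa using h6
    rw [norm_smul, hen, mul_one] at h7
    simpa using h7
  simp [h5]

/-! ### Lipschitz functions with zero boundary values -/

/-- Soft thresholding at level `ε`. -/
def softThreshold (ε t : ℝ) : ℝ := t - max (-ε) (min ε t)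

theorem softThreshold_of_abs_le {ε t : ℝ} (h : |t| ≤ ε) : softThreshold ε t = 0 := by
  rw [abs_le] at h
  simp [softThreshold, h.1, h.2]

theorem abs_softThreshold_sub_le {ε : ℝ} (s t : ℝ) :
    |softThreshold ε s - softThreshold ε t| ≤ |s - t| := by
  unfold softThreshold
  rw [abs_le]
  constructor <;> rcases max_cases (-ε) (min ε s) with h1 | h1 <;>
    rcases max_cases (-ε) (min ε t) with h2 | h2 <;> rcases min_cases ε s with h3 | h3 <;>
    rcases min_cases ε t with h4 | h4 <;> rcases abs_cases (s - t) with h5 | h5 <;> linarith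

theorem abs_sub_softThreshold_le {ε : ℝ} (hε : 0 ≤ ε) (t : ℝ) : |t - softThreshold ε t| ≤ ε := by
  unfold softThreshold
  rw [sub_sub_cancel, abs_le]
  exact ⟨le_max_left _ _, max_le (by linarith) (min_le_left _ _)⟩

theorem softThreshold_of_lt {ε t : ℝ} (hε : 0 ≤ ε) (h : ε < t) : softThreshold ε t = t - ε := by
  unfold softThreshold
  rw [min_eq_left h.le, max_eq_right (by linarith)]

theorem softThreshold_of_lt_neg {ε t : ℝ} (hε : 0 ≤ ε) (h : t < -ε) :
    softThreshold ε t = t + ε := by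
  unfold softThreshold
  rw [min_eq_right (by linarith), max_eq_left h.le]; ring

open Classical in
/-- Soft thresholding of `f`, extended by zero outside `Ω`. -/
def truncation (Ω : Set (𝔼 d)) (ε : ℝ) (f : (𝔼 d) → ℝ) (x : 𝔼 d) : ℝ :=
  if x ∈ Ω then softThreshold ε (f x) else 0

/-- Points with |f| ≥ ε cannot accumulate at ∂Ω, where `f` tends to zero. This converts boundary
values in the sense of limits into compact support of the truncations. -/
theorem isCompact_superlevel (hΩb : Bornology.IsBounded Ω) {f : (𝔼 d) → ℝ}
    (hΩ : IsOpen Ω) (hf : ContinuousOn f Ω) (h0 : EqOnBoundary Ω f 0) {ε : ℝ} (hε : 0 < ε) :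
    IsCompact {x | x ∈ Ω ∧ ε ≤ |f x|} := by
  refine Metric.isCompact_of_isClosed_isBounded ?_ (hΩb.subset fun x hx => hx.1)
  rw [← isSeqClosed_iff_isClosed]
  intro s x hs hx
  have hcl : x ∈ closure Ω := mem_closure_of_tendsto hx (Eventually.of_forall fun n => (hs n).1)
  have hsx : Tendsto s atTop (𝓝[Ω] x) :=
    tendsto_nhdsWithin_iff.2 ⟨hx, Eventually.of_forall fun n => (hs n).1⟩
  by_cases hxΩ : x ∈ Ω
  · refine ⟨hxΩ, ?_⟩
    have := ((hf x hxΩ).tendsto.comp hsx).abs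
    exact ge_of_tendsto this (Eventually.of_forall fun n => (hs n).2)
  · exfalso
    have hfr : x ∈ frontier Ω := by
      rw [hΩ.frontier_eq]; exact ⟨hcl, hxΩ⟩
    have h1 := ((h0 x hfr).comp hsx).abs
    have h2 := ge_of_tendsto h1 (Eventually.of_forall fun n => by simpa using (hs n).2)
    simp at h2
    linarith

section Truncation

variable {L : ℝ} {f : (𝔼 d) → ℝ}

theorem truncation_eventuallyEq_zero {ε : ℝ} {x : 𝔼 d}
    (hc : IsCompact {x | x ∈ Ω ∧ ε ≤ |f x|}) (hx : ¬(x ∈ Ω ∧ ε ≤ |f x|)) :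
    truncation Ω ε f =ᶠ[𝓝 x] 0 := by
  filter_upwards [hc.isClosed.isOpen_compl.mem_nhds hx] with y hy
  unfold truncation
  split_ifs with h
  · apply softThreshold_of_abs_le
    by_contra h2
    exact hy ⟨h, (not_le.1 h2).le⟩
  · rfl

/-- Off the compact superlevel set, in particular near ∂Ω, the truncation vanishes locally. Hence
extension by zero keeps the Lipschitz constant on the whole space, even though Ω may be irregular.
-/
theorem segLip_truncation (hΩ : IsOpen Ω) (hL : 0 ≤ L)
    (hf : SegLip Ω L f) {ε : ℝ} (hc : IsCompact {x | x ∈ Ω ∧ ε ≤ |f x|}) :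
    SegLip Set.univ L (truncation Ω ε f) := by
  apply segLip_of_eventually
  intro x _
  by_cases hx : x ∈ Ω ∧ ε ≤ |f x|
  · filter_upwards [hΩ.mem_nhds hx.1, hf.eventually hΩ hx.1] with y hy h2
    simp only [truncation, hy, hx.1, if_true]
    exact (abs_softThreshold_sub_le _ _).trans h2
  · filter_upwards [truncation_eventuallyEq_zero hc hx] with y hy
    rw [hy, (truncation_eventuallyEq_zero hc hx).eq_of_nhds]
    simp only [Pi.zero_apply, sub_self, abs_zero]
    positivity

theorem gradient_truncation (hΩ : IsOpen Ω) (hL : 0 ≤ L)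
    (hf : SegLip Ω L f) {ε : ℝ} (hε : 0 < ε) {x : 𝔼 d} (hx : x ∈ Ω) (h : ε < |f x|) :
    gradient (truncation Ω ε f) x = gradient f x := by
  have hcont := (hf.continuousOn hΩ hL).continuousAt (hΩ.mem_nhds hx)
  have hg : ∀ c : ℝ, gradient (fun y => f y + c) x = gradient f x := fun c => by
    simp [gradient]
  rcases lt_abs.1 h with h | h
  · have : truncation Ω ε f =ᶠ[𝓝 x] fun y => f y + (-ε) := by
      filter_upwards [hΩ.mem_nhds hx, hcont.eventually_const_lt h] with y h1 h2
      simp [truncation, h1, softThreshold_of_lt hε.le h2, sub_eq_add_neg]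
    rw [this.gradient_eq, hg]
  · have : truncation Ω ε f =ᶠ[𝓝 x] fun y => f y + ε := by
      filter_upwards [hΩ.mem_nhds hx, hcont.eventually_lt_const (lt_neg.1 h)] with y h1 h2
      simp [truncation, h1, softThreshold_of_lt_neg hε.le h2]
    rw [this.gradient_eq, hg]

/-- Where f ≠ 0 the two gradients agree once ε n < |f|; on the zero set both vanish almost
everywhere. Bounded convergence does the rest. -/
theorem tendsto_truncation (hd : 1 ≤ d) (hΩ : IsOpen Ω) (hΩb : Bornology.IsBounded Ω)
    (hL : 0 ≤ L) (hf : SegLip Ω L f) (h0 : EqOnBoundary Ω f 0) {p : ℝ} (hp : 0 < p)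
    {ε : ℕ → ℝ} (hε : ∀ n, 0 < ε n) (hlim : Tendsto ε atTop (𝓝 0)) :
    Tendsto (fun n => eLpNorm (fun x => f x - truncation Ω (ε n) f x) (ENNReal.ofReal p)
      (volume.restrict Ω)) atTop (𝓝 0) ∧
    Tendsto (fun n => eLpNorm (fun x => gradient f x - gradient (truncation Ω (ε n) f) x)
      (ENNReal.ofReal p) (volume.restrict Ω)) atTop (𝓝 0) := by
  have : IsFiniteMeasure (volume.restrict Ω) := ⟨by simpa using hΩb.measure_lt_top⟩
  have hc : ∀ n, IsCompact {x | x ∈ Ω ∧ ε n ≤ |f x|} := fun n =>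
    isCompact_superlevel hΩb hΩ (hf.continuousOn hΩ hL) h0 (hε n)
  have hs := fun n => segLip_truncation hΩ hL hf (hc n)
  have hle : ∀ n, ∀ x ∈ Ω, |f x - truncation Ω (ε n) f x| ≤ ε n := fun n x hx => by
    simpa [truncation, hx] using abs_sub_softThreshold_le (hε n).le (f x)
  obtain ⟨C, hC⟩ := hlim.bddAbove_range
  constructor
  · refine tendsto_eLpNorm_zero_of_bounded hp (C := C) (fun n => ?_) (fun n => ?_) ?_
    · exact ((hf.continuousOn hΩ hL).sub (((hs n).continuousOn isOpen_univ hL).mono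
        (Set.subset_univ _))).aestronglyMeasurable hΩ.measurableSet
    · filter_upwards [ae_restrict_mem hΩ.measurableSet] with x hx
      exact (hle n x hx).trans (hC ⟨n, rfl⟩)
    · filter_upwards [ae_restrict_mem hΩ.measurableSet] with x hx
      exact squeeze_zero_norm (fun n => hle n x hx) hlim
  · refine tendsto_eLpNorm_zero_of_bounded hp (C := L + L) (fun n => ?_) (fun n => ?_) ?_
    · exact ((measurable_gradient f).sub (measurable_gradient _)).aestronglyMeasurable
    · filter_upwards [ae_restrict_mem hΩ.measurableSet] with x hx
      exact (norm_sub_le _ _).trans (add_le_add (hf.norm_gradient_le hΩ hL hx)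
        ((hs n).norm_gradient_le isOpen_univ hL (Set.mem_univ x)))
    · filter_upwards [ae_restrict_mem hΩ.measurableSet, hf.ae_gradient_eq_zero hd hΩ hL]
        with x hx h0x
      refine tendsto_const_nhds.congr' ?_
      by_cases hfx : f x = 0
      · refine Eventually.of_forall fun n => ?_
        have : ¬(x ∈ Ω ∧ ε n ≤ |f x|) := by simp [hfx, hε n]
        beta_reduce
        rw [(truncation_eventuallyEq_zero (hc n) this).gradient_eq, h0x hfx]
        simp [gradient]
      · filter_upwards [hlim.eventually_lt_const (abs_pos.2 hfx)] with n hn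
        rw [gradient_truncation hΩ hL hf (hε n) hx hn, sub_self]

theorem tsupport_truncation_subset {ε : ℝ} (hc : IsCompact {x | x ∈ Ω ∧ ε ≤ |f x|}) :
    tsupport (truncation Ω ε f) ⊆ {x | x ∈ Ω ∧ ε ≤ |f x|} := by
  refine closure_minimal (fun x hx => ?_) hc.isClosed
  by_contra h
  exact hx (truncation_eventuallyEq_zero hc h).eq_of_nhds

/-! ### Mollifying compactly supported Lipschitz functions -/

theorem tsupport_mollify_subset (φ : ContDiffBump (0 : 𝔼 d)) :
    tsupport (mollify φ f) ⊆ Metric.cthickening φ.rOut (tsupport f) := by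
  refine closure_minimal (fun x hx => ?_) Metric.isClosed_cthickening
  by_contra h
  apply hx
  rw [mollify_apply]
  refine (integral_congr_ae (Eventually.of_forall fun t => ?_)).trans (integral_zero _ _)
  beta_reduce
  by_cases ht : t ∈ tsupport f
  · have : φ.normed volume (x - t) = 0 := by
      by_contra h'
      have h2 : x - t ∈ Function.support (φ.normed volume) := h'
      rw [φ.support_normed_eq, mem_ball_zero_iff, ← dist_eq_norm] at h2
      exact h (Metric.mem_cthickening_of_dist_le x t _ _ ht h2.le)
    simp [this]
  · simp [image_eq_zero_of_notMem_tsupport ht]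

/-- The gradient of the mollification is the mollification of the gradient, so both converge almost
everywhere, and they obey uniform bounds. -/
theorem tendsto_mollify (hΩ : IsOpen Ω) (hΩb : Bornology.IsBounded Ω)
    (hL : 0 ≤ L) (hf : SegLip Set.univ L f) (hfc : HasCompactSupport f) (hfs : tsupport f ⊆ Ω)
    {p : ℝ} (hp : 0 < p) :
    (∀ᶠ n in atTop, IsTestFunction Ω (mollify (mollifier d n) f)) ∧
    Tendsto (fun n => eLpNorm (fun x => f x - mollify (mollifier d n) f x) (ENNReal.ofReal p)
      (volume.restrict Ω)) atTop (𝓝 0) ∧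
    Tendsto (fun n => eLpNorm (fun x => gradient f x - gradient (mollify (mollifier d n) f) x)
      (ENNReal.ofReal p) (volume.restrict Ω)) atTop (𝓝 0) := by
  have : IsFiniteMeasure (volume.restrict Ω) := ⟨by simpa using hΩb.measure_lt_top⟩
  have hcont : Continuous f := continuousOn_univ.1 (hf.continuousOn isOpen_univ hL)
  have hloc : LocallyIntegrable f volume := hcont.locallyIntegrable
  obtain ⟨B, hB⟩ := hfc.exists_bound_of_continuous hcont
  have hw := hf.hasWeakGradient isOpen_univ hL
  have hgl : ∀ x, ‖gradient f x‖ ≤ L := fun x => hf.norm_gradient_le isOpen_univ hL (Set.mem_univ x)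
  have hml : ∀ n x, ‖gradient (mollify (mollifier d n) f) x‖ ≤ L := fun n x => by
    rw [gradient, LinearIsometryEquiv.norm_map]
    exact norm_fderiv_mollify_le _ hw hloc (Set.subset_univ _) hL
      (Eventually.of_forall fun t _ => hgl t)
  have hmc : ∀ n, ContDiff ℝ ∞ (mollify (mollifier d n) f) := fun n => contDiff_mollify _ hloc
  refine ⟨?_, ?_, ?_⟩
  · obtain ⟨δ, hδ, hδΩ⟩ := IsCompact.exists_cthickening_subset_open hfc hΩ hfs
    filter_upwards [tendsto_mollifier_rOut.eventually_lt_const hδ] with n hn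
    have h1 := (tsupport_mollify_subset (f := f) (mollifier d n)).trans
      (Metric.cthickening_mono hn.le _)
    exact ⟨hmc n, (IsCompact.cthickening hfc).of_isClosed_subset (isClosed_tsupport _) h1,
      h1.trans hδΩ⟩
  · refine tendsto_eLpNorm_zero_of_bounded hp (C := B + B) (fun n => ?_) (fun n => ?_) ?_
    · exact (hcont.sub (hmc n).continuous).aestronglyMeasurable
    · refine Eventually.of_forall fun x => ?_
      refine (norm_sub_le _ _).trans (add_le_add (hB x) ?_)
      rw [mollify_apply]
      exact norm_integral_normed_sub_mul_le _ (Eventually.of_forall fun t _ => hB t)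
    · filter_upwards [ae_restrict_of_ae (ae_tendsto_mollifier_convolution hloc)] with x hx
      have := hx.const_sub (f x)
      simp only [smul_eq_mul, sub_self] at this
      simpa only [mollify_apply] using this
  · refine tendsto_eLpNorm_zero_of_bounded hp (C := L + L) (fun n => ?_) (fun n => ?_) ?_
    · exact ((measurable_gradient f).sub (measurable_gradient _)).aestronglyMeasurable
    · exact Eventually.of_forall fun x => (norm_sub_le _ _).trans (add_le_add (hgl x) (hml n x))
    · have hgloc : LocallyIntegrable (gradient f) volume := locallyIntegrableOn_univ.1 hw.locInt_grad
      filter_upwards [ae_restrict_of_ae (ae_tendsto_mollifier_convolution hgloc)] with x hx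
      have := hx.const_sub (gradient f x)
      rw [sub_self] at this
      refine this.congr fun n => ?_
      congr 1
      apply ext_inner_right ℝ
      intro v
      rw [inner_gradient_left, fderiv_mollify _ hw hloc (Set.subset_univ _) v, ← real_inner_comm,
        ← integral_inner]
      · simp only [real_inner_smul_right, real_inner_comm]
      · have := (isTestFunction_normed_sub (Ω := Set.univ) (mollifier d n) (x := x)
          (Set.subset_univ _)).integrable_smul hw.locInt_grad
        exact this

/-- A function that is Lipschitz along segments and has vanishing boundary values lies in
`W_0^{1,p}`. -/
theorem SegLip.memW10 (hd : 1 ≤ d) (hΩ : IsOpen Ω) (hΩb : Bornology.IsBounded Ω)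
    (hL : 0 ≤ L) (hf : SegLip Ω L f) (h0 : EqOnBoundary Ω f 0) {p : ℝ} (hp : 1 ≤ p) :
    MemW10 Ω (ENNReal.ofReal p) f := by
  have hp0 : 0 < p := by linarith
  have hp1 : 1 ≤ ENNReal.ofReal p := by simpa using ENNReal.ofReal_le_ofReal hp
  have hc : ∀ ε : ℝ, 0 < ε → IsCompact {x | x ∈ Ω ∧ ε ≤ |f x|} := fun ε hε =>
    isCompact_superlevel hΩb hΩ (hf.continuousOn hΩ hL) h0 hε
  have hcont := hf.continuousOn hΩ hL
  have hbound : ∃ B, ∀ x ∈ Ω, |f x| ≤ B := by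
    obtain ⟨B, hB⟩ := (hc 1 one_pos).exists_bound_of_continuousOn (hcont.mono fun x hx => hx.1)
    refine ⟨max B 1, fun x hx => ?_⟩
    by_cases h : 1 ≤ |f x|
    · exact (hB x ⟨hx, h⟩).trans (le_max_left _ _)
    · exact (not_le.1 h).le.trans (le_max_right _ _)
  obtain ⟨B, hB⟩ := hbound
  have hw := hf.hasWeakGradient hΩ hL
  refine ⟨hf.memW1 hΩ hΩb hL hB _, ?_⟩
  have key : ∀ δ : ℝ≥0∞, 0 < δ → ∃ φ, IsTestFunction Ω φ ∧
      eLpNorm (fun x => f x - φ x) (ENNReal.ofReal p) (volume.restrict Ω) ≤ δ ∧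
      eLpNorm (fun x => gradient f x - gradient φ x) (ENNReal.ofReal p) (volume.restrict Ω) ≤ δ := by
    intro δ hδ
    -- Truncation makes the support compact and mollification makes the function smooth; each may
    -- cost half of `δ`.
    have hδ2 : 0 < δ / 2 := ENNReal.half_pos hδ.ne'
    obtain ⟨t1, t2⟩ := tendsto_truncation hd hΩ hΩb hL hf h0 hp0 (ε := fun n : ℕ => 1 / ((n : ℝ) + 1))
      (fun n => by positivity) tendsto_one_div_add_atTop_nhds_zero_nat
    obtain ⟨n, hn1, hn2⟩ := ((t1.eventually_lt_const hδ2).and (t2.eventually_lt_const hδ2)).exists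
    set ε := 1 / ((n : ℝ) + 1) with hε
    have hε0 : 0 < ε := by positivity
    have hs := segLip_truncation hΩ hL hf (hc _ hε0)
    have hts := tsupport_truncation_subset (hc _ hε0)
    obtain ⟨m1, m2, m3⟩ := tendsto_mollify hΩ hΩb hL hs
      ((hc _ hε0).of_isClosed_subset (isClosed_tsupport _) hts) (hts.trans fun x hx => hx.1) hp0
    obtain ⟨m, h1, h2, h3⟩ :=
      (m1.and ((m2.eventually_lt_const hδ2).and (m3.eventually_lt_const hδ2))).exists
    have hsc : ContinuousOn (truncation Ω ε f) Ω :=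
      (hs.continuousOn isOpen_univ hL).mono (Set.subset_univ _)
    refine ⟨_, h1, ?_, ?_⟩
    · have e : (fun x => f x - mollify (mollifier d m) (truncation Ω ε f) x) =
        (fun x => f x - truncation Ω ε f x) +
          (fun x => truncation Ω ε f x - mollify (mollifier d m) (truncation Ω ε f) x) := by
        ext x; simp
      rw [e, ← ENNReal.add_halves δ]
      refine (eLpNorm_add_le ?_ ?_ hp1).trans (add_le_add hn1.le h2.le)
      · exact (hcont.sub hsc).aestronglyMeasurable hΩ.measurableSet
      · exact (hsc.sub h1.smooth.continuous.continuousOn).aestronglyMeasurable hΩ.measurableSet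
    · have e : (fun x => gradient f x - gradient (mollify (mollifier d m) (truncation Ω ε f)) x) =
        (fun x => gradient f x - gradient (truncation Ω ε f) x) +
          (fun x => gradient (truncation Ω ε f) x -
            gradient (mollify (mollifier d m) (truncation Ω ε f)) x) := by
        ext x; simp
      rw [e, ← ENNReal.add_halves δ]
      refine (eLpNorm_add_le ?_ ?_ hp1).trans (add_le_add hn2.le h3.le)
      · exact ((measurable_gradient _).sub (measurable_gradient _)).aestronglyMeasurable
      · exact ((measurable_gradient _).sub (measurable_gradient _)).aestronglyMeasurable
  have hpos : ∀ n : ℕ, (0 : ℝ≥0∞) < ((n : ℝ≥0∞) + 1)⁻¹ := fun n => by simp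
  choose φ h1 h2 h3 using fun n : ℕ => key _ (hpos n)
  have hlim : Tendsto (fun n : ℕ => ((n : ℝ≥0∞) + 1)⁻¹) atTop (𝓝 0) := by
    have := (tendsto_add_atTop_iff_nat 1).2 ENNReal.tendsto_inv_nat_nhds_zero
    simpa using this
  refine ⟨φ, h1, tendsto_of_tendsto_of_tendsto_of_le_of_le tendsto_const_nhds hlim
    (fun _ => zero_le) h2, ?_⟩
  refine tendsto_of_tendsto_of_tendsto_of_le_of_le tendsto_const_nhds hlim
    (fun _ => zero_le) fun n => ?_
  refine le_of_eq_of_le (eLpNorm_congr_ae ?_) (h3 n)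
  filter_upwards [hw.weakGrad_ae_eq hΩ] with x hx
  rw [hx]

end Truncation

/-! ### A Morrey inequality -/

/-- The fundamental theorem of calculus along the ray from `x` to a zero of `φ`; the factor 3 is the
bound on the speed ‖y‖. -/
theorem enorm_le_lintegral_ray {φ : (𝔼 d) → ℝ} (hφ : ContDiff ℝ ∞ φ) {x y : 𝔼 d} {R : ℝ}
    (hR : 0 ≤ R) (hy : ‖y‖ ≤ 3) (h0 : φ (x + R • y) = 0) :
    ‖φ x‖ₑ ≤ 3 * ∫⁻ t in Set.Ioc 0 R, ‖gradient φ (x + t • y)‖ₑ := by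
  have hderiv : ∀ t : ℝ, HasDerivAt (fun t : ℝ => φ (x + t • y)) (fderiv ℝ φ (x + t • y) y) t := by
    intro t
    have h1 : HasDerivAt (fun t : ℝ => x + t • y) y t := by
      simpa using ((hasDerivAt_id t).smul_const y).const_add x
    exact ((hφ.differentiable (by simp) _).hasFDerivAt).comp_hasDerivAt t h1
  have hc : Continuous fun t : ℝ => fderiv ℝ φ (x + t • y) y :=
    ((hφ.continuous_fderiv (by simp)).comp (by fun_prop)).clm_apply continuous_const
  have h2 := intervalIntegral.integral_eq_sub_of_hasDerivAt (a := 0) (b := R)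
    (fun t _ => hderiv t) (hc.intervalIntegrable _ _)
  rw [h0, zero_smul, add_zero, zero_sub, intervalIntegral.integral_of_le hR] at h2
  rw [← enorm_neg, ← h2]
  refine (enorm_integral_le_lintegral_enorm _).trans ?_
  rw [← lintegral_const_mul' _ _ (by simp)]
  refine lintegral_mono fun t => ?_
  have : ‖fderiv ℝ φ (x + t • y) y‖ ≤ 3 * ‖gradient φ (x + t • y)‖ := by
    rw [gradient, LinearIsometryEquiv.norm_map, mul_comm]
    exact (ContinuousLinearMap.le_opNorm _ _).trans (by gcongr)
  rw [← ofReal_norm, ← ofReal_norm]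
  refine (ENNReal.ofReal_le_ofReal this).trans ?_
  rw [ENNReal.ofReal_mul (by norm_num)]
  simp

theorem lintegral_comp_add_smul (f : (𝔼 d) → ℝ≥0∞) (hf : Measurable f) (x : 𝔼 d) {t : ℝ}
    (ht : 0 < t) : ∫⁻ y, f (x + t • y) = ENNReal.ofReal (t ^ (-(d : ℝ))) * ∫⁻ y, f y := by
  have h1 := lintegral_map (μ := (volume : Measure (𝔼 d))) (f := fun z => f (x + z))
    (hf.comp (measurable_const_add x)) (measurable_const_smul t)
  rw [Measure.map_addHaar_smul _ ht.ne', lintegral_smul_measure,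
    lintegral_add_left_eq_self (fun z => f z) x] at h1
  rw [← h1, finrank_euclideanSpace_fin, abs_of_pos (by positivity), Real.rpow_neg ht.le,
    Real.rpow_natCast, smul_eq_mul]

/-- Hölder's inequality on `A`, then the substitution z = x + t y. The Jacobian t^(-d), raised to
the power 1/p, leaves the singularity t^(-d/p) that Morrey's inequality has to integrate. -/
theorem lintegral_ball_gradient_le {φ : (𝔼 d) → ℝ} {p : ℝ} (hp : 1 ≤ p)
    (A : Set (𝔼 d)) (x : 𝔼 d) {t : ℝ} (ht : 0 < t) :
    ∫⁻ y in A, ‖gradient φ (x + t • y)‖ₑ ≤ volume A ^ (1 - 1 / p) *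
      (ENNReal.ofReal (t ^ (-(d / p))) * eLpNorm (gradient φ) (ENNReal.ofReal p) volume) := by
  have hp0 : 0 < p := by linarith
  have hm : Measurable fun y => gradient φ (x + t • y) :=
    (measurable_gradient φ).comp (by fun_prop)
  have h1 := eLpNorm_le_eLpNorm_mul_rpow_measure_univ (μ := volume.restrict A) (p := 1)
    (q := ENNReal.ofReal p) (by simpa using ENNReal.ofReal_le_ofReal hp) hm.aestronglyMeasurable
  rw [eLpNorm_one_eq_lintegral_enorm] at h1
  refine h1.trans ?_
  have hp' : (ENNReal.ofReal p).toReal = p := ENNReal.toReal_ofReal hp0.le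
  simp only [Measure.restrict_apply_univ, ENNReal.toReal_one, hp', div_one]
  rw [mul_comm]
  gcongr
  refine (eLpNorm_mono_measure _ Measure.restrict_le_self).trans (le_of_eq ?_)
  rw [eLpNorm_eq_lintegral_rpow_enorm_toReal (by simpa using hp0) ENNReal.ofReal_ne_top,
    eLpNorm_eq_lintegral_rpow_enorm_toReal (by simpa using hp0) ENNReal.ofReal_ne_top, hp',
    lintegral_comp_add_smul (fun z => ‖gradient φ z‖ₑ ^ p)
      ((measurable_gradient φ).enorm.pow_const p) x ht,
    ENNReal.mul_rpow_of_nonneg _ _ (by positivity), ENNReal.ofReal_rpow_of_pos (by positivity),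
    ← Real.rpow_mul ht.le]
  congr 3
  ring

/-- Morrey's inequality for test functions on a bounded set. -/
theorem exists_morrey_const (hd : 1 ≤ d) (hΩb : Bornology.IsBounded Ω) {p : ℝ} (hp : (d : ℝ) < p) :
    ∃ C : ℝ≥0∞, C ≠ ⊤ ∧ ∀ φ : (𝔼 d) → ℝ, IsTestFunction Ω φ → ∀ x,
      ‖φ x‖ₑ ≤ C * eLpNorm (gradient φ) (ENNReal.ofReal p) (volume.restrict Ω) := by
  have hd1 : (1 : ℝ) ≤ d := by exact_mod_cast hd
  have hp1 : 1 ≤ p := by linarith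
  have hp0 : 0 < p := by linarith
  obtain ⟨R, hR0, hR⟩ : ∃ R : ℝ, 0 < R ∧ ∀ x ∈ Ω, ∀ y ∈ Ω, dist x y < R := by
    obtain ⟨C, hC⟩ := Metric.isBounded_iff.1 hΩb
    exact ⟨max C 0 + 1, by positivity, fun x hx y hy =>
      (hC hx hy).trans_lt ((le_max_left _ _).trans_lt (lt_add_one _))⟩
  set e : 𝔼 d := EuclideanSpace.single ⟨0, hd⟩ 1 with he
  have hen : ‖e‖ = 1 := by simp [he]
  -- Velocities with 1 ≤ ‖y‖ ≤ 3: at time `R` each ray has left Ω, because distances in Ω are below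
  -- `R`. Averaging over a set of positive volume turns line integrals into volume integrals.
  set A : Set (𝔼 d) := Metric.ball ((2 : ℝ) • e) 1 with hA
  have h2e : ‖(2 : ℝ) • e‖ = 2 := by simp [norm_smul, hen]
  have hA1 : ∀ y ∈ A, 1 ≤ ‖y‖ ∧ ‖y‖ ≤ 3 := by
    intro y hy
    rw [hA, Metric.mem_ball, dist_eq_norm] at hy
    have h3 := norm_sub_norm_le ((2 : ℝ) • e) y
    have h4 := norm_le_norm_add_norm_sub' y ((2 : ℝ) • e)
    rw [norm_sub_rev, h2e] at h3
    rw [h2e] at h4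
    constructor <;> linarith
  have hV0 : volume A ≠ 0 := (Metric.measure_ball_pos _ _ one_pos).ne'
  have hVt : volume A ≠ ⊤ := measure_ball_lt_top.ne
  set I : ℝ≥0∞ := ∫⁻ t in Set.Ioc 0 R, ENNReal.ofReal (t ^ (-(d / p) : ℝ)) with hI
  have hIt : I ≠ ⊤ := by
    -- Here d < p enters: it makes t^(-d/p) integrable at zero.
    have h1 : IntervalIntegrable (fun t : ℝ => t ^ (-(d / p) : ℝ)) volume 0 R := by
      apply intervalIntegral.intervalIntegrable_rpow'
      rw [neg_lt_neg_iff, div_lt_one hp0]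
      exact hp
    rw [intervalIntegrable_iff_integrableOn_Ioc_of_le hR0.le] at h1
    refine ((hasFiniteIntegral_iff_ofReal ?_).1 h1.2).ne
    filter_upwards [ae_restrict_mem measurableSet_Ioc] with t ht
    exact Real.rpow_nonneg ht.1.le _
  refine ⟨(volume A)⁻¹ * (3 * (volume A ^ (1 - 1 / p) * I)), ?_, ?_⟩
  · refine ENNReal.mul_ne_top (ENNReal.inv_ne_top.2 hV0) (ENNReal.mul_ne_top (by simp)
      (ENNReal.mul_ne_top (ENNReal.rpow_ne_top_of_nonneg ?_ hVt) hIt))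
    rw [sub_nonneg, div_le_one hp0]
    exact hp1
  intro φ hφ x
  by_cases hx : x ∈ Ω
  swap
  · have : φ x = 0 := by
      by_contra h
      exact hx (hφ.support (subset_tsupport φ h))
    simp [this]
  set N := eLpNorm (gradient φ) (ENNReal.ofReal p) (volume : Measure (𝔼 d)) with hN
  have hNle : N ≤ eLpNorm (gradient φ) (ENNReal.ofReal p) (volume.restrict Ω) := by
    have hsub : Function.support (gradient φ) ⊆ Ω := by
      intro y hy
      by_contra h
      apply hy
      have : φ =ᶠ[𝓝 y] 0 := notMem_tsupport_iff_eventuallyEq.1 fun h' => h (hφ.support h')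
      rw [this.gradient_eq]
      simp [gradient]
    rw [hN]
    exact (eLpNorm_restrict_eq_of_support_subset hsub).ge
  refine le_trans ?_ (mul_le_mul_right hNle _)
  have hgm : Continuous (gradient φ) :=
    (LinearIsometryEquiv.continuous _).comp (hφ.smooth.continuous_fderiv (by simp))
  have key : volume A * ‖φ x‖ₑ ≤ 3 * (volume A ^ (1 - 1 / p) * I) * N := by
    calc volume A * ‖φ x‖ₑ = ∫⁻ y in A, ‖φ x‖ₑ := by rw [setLIntegral_const, mul_comm]
      _ ≤ ∫⁻ y in A, 3 * ∫⁻ t in Set.Ioc 0 R, ‖gradient φ (x + t • y)‖ₑ := by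
          refine setLIntegral_mono' Metric.isOpen_ball.measurableSet fun y hy => ?_
          refine enorm_le_lintegral_ray hφ.smooth hR0.le (hA1 y hy).2 ?_
          by_contra h
          have h1 := hR _ (hφ.support (subset_tsupport φ h)) x hx
          rw [dist_eq_norm, add_sub_cancel_left, norm_smul, Real.norm_of_nonneg hR0.le] at h1
          nlinarith [(hA1 y hy).1]
      _ = 3 * ∫⁻ t in Set.Ioc 0 R, ∫⁻ y in A, ‖gradient φ (x + t • y)‖ₑ := by
          rw [lintegral_const_mul' _ _ (by simp), lintegral_lintegral_swap]
          refine Continuous.aemeasurable ?_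
          exact continuous_enorm.comp (hgm.comp (by fun_prop))
      _ ≤ 3 * ∫⁻ t in Set.Ioc 0 R, volume A ^ (1 - 1 / p) *
            (ENNReal.ofReal (t ^ (-(d / p) : ℝ)) * N) := by
          gcongr 3 * ?_
          exact setLIntegral_mono' measurableSet_Ioc fun t ht =>
            lintegral_ball_gradient_le hp1 A x ht.1
      _ = 3 * (volume A ^ (1 - 1 / p) * I) * N := by
          have hm : Measurable fun t : ℝ => ENNReal.ofReal (t ^ (-(d / p) : ℝ)) := by fun_prop
          rw [lintegral_const_mul _ (hm.mul_const _), lintegral_mul_const _ hm]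
          ring
  calc ‖φ x‖ₑ = (volume A)⁻¹ * (volume A * ‖φ x‖ₑ) := by
        rw [← mul_assoc, ENNReal.inv_mul_cancel hV0 hVt, one_mul]
    _ ≤ (volume A)⁻¹ * (3 * (volume A ^ (1 - 1 / p) * I) * N) := by gcongr
    _ = _ := by ring

/-- Morrey's inequality on `W_0^{1,p}`. -/
theorem MemW10.ae_enorm_le {p : ℝ} (hp : 1 ≤ p) {C : ℝ≥0∞} (hC : C ≠ ⊤)
    (hM : ∀ φ : (𝔼 d) → ℝ, IsTestFunction Ω φ → ∀ x,
      ‖φ x‖ₑ ≤ C * eLpNorm (gradient φ) (ENNReal.ofReal p) (volume.restrict Ω))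
    {v : (𝔼 d) → ℝ} (hv : MemW10 Ω (ENNReal.ofReal p) v) :
    ∀ᵐ x ∂(volume.restrict Ω),
      ‖v x‖ₑ ≤ C * eLpNorm (weakGrad Ω v) (ENNReal.ofReal p) (volume.restrict Ω) := by
  have hp0 : ENNReal.ofReal p ≠ 0 := by
    have : 0 < p := by linarith
    simpa using this
  have hp1 : 1 ≤ ENNReal.ofReal p := by simpa using ENNReal.ofReal_le_ofReal hp
  obtain ⟨φ, hφ, h1, h2⟩ := hv.approx
  -- Convergence in Lᵖ gives a subsequence converging almost everywhere, along which the inequality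
  -- for test functions passes to the limit.
  have hmeas : TendstoInMeasure (volume.restrict Ω) φ atTop v := by
    refine tendstoInMeasure_of_tendsto_eLpNorm hp0
      (fun n => (hφ n).smooth.continuous.aestronglyMeasurable) hv.memW1.memLp.1 ?_
    refine h1.congr fun n => ?_
    rw [← eLpNorm_neg]
    congr 1
    ext x
    simp
  obtain ⟨ns, hns, hae⟩ := hmeas.exists_seq_tendsto_ae
  filter_upwards [hae] with x hx
  have hle : ∀ n, ‖φ (ns n) x‖ₑ ≤ C * (eLpNorm (weakGrad Ω v) (ENNReal.ofReal p)
      (volume.restrict Ω) + eLpNorm (fun x => weakGrad Ω v x - gradient (φ (ns n)) x)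
        (ENNReal.ofReal p) (volume.restrict Ω)) := by
    intro n
    refine (hM _ (hφ _) x).trans ?_
    gcongr
    have e : gradient (φ (ns n)) = weakGrad Ω v - fun x => weakGrad Ω v x - gradient (φ (ns n)) x := by
      ext x; simp
    nth_rw 1 [e]
    exact eLpNorm_sub_le hv.memW1.memLp_grad.1
      (hv.memW1.memLp_grad.1.sub (measurable_gradient _).aestronglyMeasurable) hp1
  have hl := (continuous_enorm.tendsto _).comp hx
  have hr := ENNReal.Tendsto.const_mul (a := C)
    ((h2.comp hns.tendsto_atTop).const_add (eLpNorm (weakGrad Ω v) (ENNReal.ofReal p)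
      (volume.restrict Ω))) (Or.inr hC)
  rw [add_zero] at hr
  exact le_of_tendsto_of_tendsto' hl hr hle

/-! ### Uniform convexity of the energy -/

section Convexity

variable {E : Type*} [NormedAddCommGroup E] [InnerProductSpace ℝ E]

/-- If the norms are equal, strict convexity of the norm gives the strict inequality; otherwise
strict convexity of t ↦ t^p does. -/
theorem norm_midpoint_rpow_lt {p : ℝ} (hp : 1 < p) {a b : E} (hab : a ≠ b) :
    ‖(1 / 2 : ℝ) • (a + b)‖ ^ p < (‖a‖ ^ p + ‖b‖ ^ p) / 2 := by
  have hp0 : 0 < p := by linarith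
  by_cases h : ‖a‖ = ‖b‖
  · have h1 := (norm_midpoint_lt_iff h).2 hab
    rw [← h, add_self_div_two]
    exact Real.rpow_lt_rpow (norm_nonneg _) h1 hp0
  · obtain ⟨-, hc⟩ := strictConvexOn_rpow hp
    have h1 := hc (Set.mem_Ici.2 (norm_nonneg a)) (Set.mem_Ici.2 (norm_nonneg b)) h
      (by norm_num : (0 : ℝ) < 1 / 2) (by norm_num : (0 : ℝ) < 1 / 2) (by norm_num)
    simp only [smul_eq_mul] at h1
    have h2 : ‖(1 / 2 : ℝ) • (a + b)‖ ≤ 1 / 2 * ‖a‖ + 1 / 2 * ‖b‖ := by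
      rw [norm_smul, ← mul_add]
      simpa using norm_add_le a b
    calc _ ≤ (1 / 2 * ‖a‖ + 1 / 2 * ‖b‖) ^ p := Real.rpow_le_rpow (norm_nonneg _) h2 hp0.le
      _ < _ := h1
      _ = _ := by ring

/-- Compactness and homogeneity. On the set ‖a‖^p + ‖b‖^p = 1 with ‖a - b‖^p ≥ ε the midpoint
deficit has a positive lower bound, and for the other normalised pairs the ε-term suffices. All
terms are homogeneous of degree p, so scaling gives the general case. -/
theorem exists_uniform_convexity_const [FiniteDimensional ℝ E] {p : ℝ} (hp : 1 < p) {ε : ℝ}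
    (hε : 0 < ε) : ∃ C : ℝ, 0 ≤ C ∧ ∀ a b : E, ‖a - b‖ ^ p ≤ ε * (‖a‖ ^ p + ‖b‖ ^ p) +
      C * ((‖a‖ ^ p + ‖b‖ ^ p) / 2 - ‖(1 / 2 : ℝ) • (a + b)‖ ^ p) := by
  have hp0 : 0 < p := by linarith
  set D : E × E → ℝ := fun z => (‖z.1‖ ^ p + ‖z.2‖ ^ p) / 2 - ‖(1 / 2 : ℝ) • (z.1 + z.2)‖ ^ p with hD
  have hr : Continuous fun t : ℝ => t ^ p := Real.continuous_rpow_const hp0.le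
  have hDc : Continuous D := by
    refine ((hr.comp continuous_fst.norm).add (hr.comp continuous_snd.norm)).div_const 2 |>.sub ?_
    exact hr.comp (by fun_prop)
  have hsc : Continuous fun z : E × E => ‖z.1‖ ^ p + ‖z.2‖ ^ p :=
    (hr.comp continuous_fst.norm).add (hr.comp continuous_snd.norm)
  have hdc : Continuous fun z : E × E => ‖z.1 - z.2‖ ^ p := hr.comp (by fun_prop)
  have hDnn : ∀ z, 0 ≤ D z := by
    intro z
    by_cases h : z.1 = z.2
    · simp only [hD, h]
      rw [add_self_div_two, ← two_smul ℝ z.2, smul_smul]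
      norm_num
    · exact (sub_pos.2 (norm_midpoint_rpow_lt hp h)).le
  set S : Set (E × E) := {z | ‖z.1‖ ^ p + ‖z.2‖ ^ p = 1} with hS
  have hSc : IsCompact S := by
    have := FiniteDimensional.proper_real (E × E)
    refine Metric.isCompact_of_isClosed_isBounded (isClosed_eq hsc continuous_const) ?_
    refine (Metric.isBounded_closedBall (x := (0 : E × E)) (r := 1)).subset fun z hz => ?_
    have h1 : ‖z.1‖ ^ p ≤ 1 := by
      rw [← show ‖z.1‖ ^ p + ‖z.2‖ ^ p = 1 from hz]
      have := Real.rpow_nonneg (norm_nonneg z.2) p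
      linarith
    have h2 : ‖z.2‖ ^ p ≤ 1 := by
      rw [← show ‖z.1‖ ^ p + ‖z.2‖ ^ p = 1 from hz]
      have := Real.rpow_nonneg (norm_nonneg z.1) p
      linarith
    rw [mem_closedBall_zero_iff, Prod.norm_def, max_le_iff]
    exact ⟨(Real.rpow_le_rpow_iff (norm_nonneg _) zero_le_one hp0).1 (by simpa using h1),
      (Real.rpow_le_rpow_iff (norm_nonneg _) zero_le_one hp0).1 (by simpa using h2)⟩
  obtain ⟨M, hM⟩ := hSc.exists_bound_of_continuousOn hdc.continuousOn
  set K : Set (E × E) := S ∩ {z | ε ≤ ‖z.1 - z.2‖ ^ p} with hK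
  have hKc : IsCompact K := hSc.inter_right (isClosed_le continuous_const hdc)
  obtain ⟨m, hm0, hm⟩ : ∃ m : ℝ, 0 < m ∧ ∀ z ∈ K, m ≤ D z := by
    rcases K.eq_empty_or_nonempty with h | h
    · exact ⟨1, one_pos, by simp [h]⟩
    · obtain ⟨z, hz, hmin⟩ := hKc.exists_isMinOn h hDc.continuousOn
      refine ⟨D z, sub_pos.2 (norm_midpoint_rpow_lt hp ?_), fun w hw => hmin hw⟩
      intro h
      have := hz.2
      simp only [Set.mem_ofPred_eq, h, sub_self, norm_zero, Real.zero_rpow hp0.ne'] at this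
      linarith
  refine ⟨max M 0 / m, by positivity, ?_⟩
  have hunit : ∀ z ∈ S, ‖z.1 - z.2‖ ^ p ≤ ε + max M 0 / m * D z := by
    intro z hz
    by_cases h : ε ≤ ‖z.1 - z.2‖ ^ p
    · have h1 := hM z hz
      rw [Real.norm_of_nonneg (by positivity)] at h1
      have h2 : max M 0 ≤ max M 0 / m * D z := by
        rw [div_mul_eq_mul_div, le_div_iff₀ hm0]
        exact mul_le_mul_of_nonneg_left (hm z ⟨hz, h⟩) (le_max_right _ _)
      linarith [le_max_left M 0]
    · have : 0 ≤ max M 0 / m * D z := mul_nonneg (by positivity) (hDnn z)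
      linarith
  intro a b
  by_cases h0 : ‖a‖ ^ p + ‖b‖ ^ p = 0
  · have ha : ‖a‖ ^ p = 0 := by
      have := Real.rpow_nonneg (norm_nonneg b) p
      have := Real.rpow_nonneg (norm_nonneg a) p
      linarith
    have hb : ‖b‖ ^ p = 0 := by linarith
    rw [Real.rpow_eq_zero (norm_nonneg _) hp0.ne', norm_eq_zero] at ha hb
    simp [ha, hb, Real.zero_rpow hp0.ne']
  · set s := ‖a‖ ^ p + ‖b‖ ^ p with hs
    have hs0 : 0 < s := lt_of_le_of_ne (by positivity) (Ne.symm h0)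
    set c := s ^ (-(1 / p)) with hc
    have hc0 : 0 < c := by positivity
    have hcp : c ^ p = s⁻¹ := by
      rw [hc, ← Real.rpow_mul hs0.le, neg_mul, one_div, inv_mul_cancel₀ hp0.ne', Real.rpow_neg_one]
    have hn : ∀ x : E, ‖c • x‖ ^ p = s⁻¹ * ‖x‖ ^ p := by
      intro x
      rw [norm_smul, Real.norm_of_nonneg hc0.le, Real.mul_rpow hc0.le (norm_nonneg _), hcp]
    have hmem : (c • a, c • b) ∈ S := by
      simp only [hS, Set.mem_ofPred_eq, hn, ← mul_add, ← hs]
      exact inv_mul_cancel₀ h0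
    have h1 := hunit _ hmem
    simp only [hD, ← smul_sub, ← smul_add, smul_comm (1 / 2 : ℝ) c, hn] at h1
    have h2 := mul_le_mul_of_nonneg_left h1 hs0.le
    rw [mul_inv_cancel_left₀ h0] at h2
    refine h2.trans (le_of_eq ?_)
    have e : s⁻¹ * s = 1 := inv_mul_cancel₀ h0
    have e2 : s * (s⁻¹ * ‖a‖ ^ p + s⁻¹ * ‖b‖ ^ p) = s := by
      rw [← mul_add, ← hs]; field_simp
    rw [mul_add, mul_left_comm s (max M 0 / m), mul_sub, mul_inv_cancel_left₀ h0, ← mul_div_assoc,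
      e2, mul_comm s ε]

/-! ### Energies of vector fields: strong convergence and minimality -/

variable {α : Type*} [MeasurableSpace α] {μ : Measure α}

theorem MeasureTheory.MemLp.eLpNorm_rpow_eq {F : Type*} [NormedAddCommGroup F] {p : ℝ} (hp : 1 < p)
    {G : α → F} (hG : MemLp G (ENNReal.ofReal p) μ) :
    (eLpNorm G (ENNReal.ofReal p) μ).toReal ^ p = ∫ x, ‖G x‖ ^ p ∂μ := by
  have hp0 : 0 < p := by linarith
  have hpt : (ENNReal.ofReal p).toReal = p := ENNReal.toReal_ofReal hp0.le
  have hnn : 0 ≤ ∫ x, ‖G x‖ ^ p ∂μ := integral_nonneg fun x => by positivity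
  rw [hG.eLpNorm_eq_integral_rpow_norm (by simpa using hp0) ENNReal.ofReal_ne_top, hpt,
    ENNReal.toReal_ofReal (by positivity), ← Real.rpow_mul hnn, inv_mul_cancel₀ hp0.ne',
    Real.rpow_one]

theorem MeasureTheory.MemLp.integrable_rpow {F : Type*} [NormedAddCommGroup F] {p : ℝ} (hp : 1 < p)
    {G : α → F} (hG : MemLp G (ENNReal.ofReal p) μ) : Integrable (fun x => ‖G x‖ ^ p) μ := by
  have hp0 : 0 < p := by linarith
  have := hG.integrable_norm_rpow (by simpa using hp0) ENNReal.ofReal_ne_top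
  rwa [ENNReal.toReal_ofReal hp0.le] at this

/-- The midpoints have at least the energy of `F`, while the energies of `A n` asymptotically do not
exceed it, so the integrated midpoint deficit tends to zero. Uniform convexity turns this directly
into strong convergence; no weak compactness is involved. -/
theorem tendsto_of_midpoint [FiniteDimensional ℝ E] {p : ℝ} (hp : 1 < p) {F : α → E}
    {A : ℕ → α → E} (hF : MemLp F (ENNReal.ofReal p) μ) (hA : ∀ n, MemLp (A n) (ENNReal.ofReal p) μ)
    (hmid : ∀ n, eLpNorm F (ENNReal.ofReal p) μ ≤
      eLpNorm ((1 / 2 : ℝ) • (A n + F)) (ENNReal.ofReal p) μ)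
    (hlim : ∀ ε : ℝ, 0 < ε → ∀ᶠ n in atTop, eLpNorm (A n) (ENNReal.ofReal p) μ ≤
      eLpNorm F (ENNReal.ofReal p) μ + ENNReal.ofReal ε) :
    Tendsto (fun n => eLpNorm (A n - F) (ENNReal.ofReal p) μ) atTop (𝓝 0) := by
  have hp0 : 0 < p := by linarith
  set J : (α → E) → ℝ := fun G => ∫ x, ‖G x‖ ^ p ∂μ with hJ
  have hJnn : ∀ G, 0 ≤ J G := fun G => integral_nonneg fun x => by positivity
  have hM : ∀ n, MemLp ((1 / 2 : ℝ) • (A n + F)) (ENNReal.ofReal p) μ := fun n =>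
    ((hA n).add hF).const_smul _
  have hmidJ : ∀ n, J F ≤ J ((1 / 2 : ℝ) • (A n + F)) := by
    intro n
    simp only [hJ]
    rw [← hF.eLpNorm_rpow_eq hp, ← (hM n).eLpNorm_rpow_eq hp]
    gcongr
    · exact (hM n).2.ne
    · exact hmid n
  have hlimJ : ∀ η : ℝ, 0 < η → ∀ᶠ n in atTop, J (A n) ≤ J F + η := by
    intro η hη
    set f := (eLpNorm F (ENNReal.ofReal p) μ).toReal with hf
    have hcont : Tendsto (fun ε : ℝ => (f + ε) ^ p) (𝓝[>] 0) (𝓝 (f ^ p)) := by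
      have : Continuous fun ε : ℝ => (f + ε) ^ p :=
        (Real.continuous_rpow_const hp0.le).comp (by fun_prop)
      have h := this.tendsto 0
      rw [add_zero] at h
      exact h.mono_left nhdsWithin_le_nhds
    obtain ⟨ε, h1, h2⟩ := ((hcont.eventually_lt_const (lt_add_of_pos_right _ hη)).and
      self_mem_nhdsWithin).exists
    filter_upwards [hlim ε h2] with n hn
    simp only [hJ]
    rw [← hF.eLpNorm_rpow_eq hp, ← (hA n).eLpNorm_rpow_eq hp, ← hf]
    refine le_trans ?_ h1.le
    gcongr
    have h3 := ENNReal.toReal_mono (ENNReal.add_ne_top.2 ⟨hF.2.ne, ENNReal.ofReal_ne_top⟩) hn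
    rwa [ENNReal.toReal_add hF.2.ne ENNReal.ofReal_ne_top,
      ENNReal.toReal_ofReal (le_of_lt h2)] at h3
  have hJ0 : Tendsto (fun n => J (A n - F)) atTop (𝓝 0) := by
    have key : ∀ δ : ℝ, 0 < δ → ∀ᶠ n in atTop, J (A n - F) ≤ δ := by
      intro δ hδ
      have hden : 0 < 2 * J F + 1 := by linarith [hJnn F]
      -- Since eventually J (A n) ≤ J F + 1, the two energies add up to at most 2 J F + 1, and the
      -- ε-term is at most δ / 2.
      set ε := δ / 2 / (2 * J F + 1) with hε
      obtain ⟨C, hC0, hC⟩ := exists_uniform_convexity_const (E := E) hp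
        (show 0 < ε by positivity)
      filter_upwards [hlimJ 1 one_pos, hlimJ (δ / (C + 1)) (by positivity)] with n h1 h2
      have i1 := (hA n).integrable_rpow hp
      have i2 := hF.integrable_rpow hp
      have i3 := (hM n).integrable_rpow hp
      have h3 : J (A n - F) ≤ ε * (J (A n) + J F) +
          C * ((J (A n) + J F) / 2 - J ((1 / 2 : ℝ) • (A n + F))) := by
        simp only [hJ]
        have i4 : Integrable (fun x => ‖A n x‖ ^ p + ‖F x‖ ^ p) μ := i1.add i2
        have i5 : Integrable (fun x => (‖A n x‖ ^ p + ‖F x‖ ^ p) / 2) μ := i4.div_const 2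
        have i6 : Integrable (fun x => (‖A n x‖ ^ p + ‖F x‖ ^ p) / 2 -
            ‖((1 / 2 : ℝ) • (A n + F)) x‖ ^ p) μ := i5.sub i3
        rw [← integral_add i1 i2, ← integral_div, ← integral_sub i5 i3,
          ← integral_const_mul, ← integral_const_mul, ← integral_add (i4.const_mul ε)
            (i6.const_mul C)]
        exact integral_mono (((hA n).sub hF).integrable_rpow hp)
          ((i4.const_mul ε).add (i6.const_mul C)) fun x => hC (A n x) (F x)
      have h4 : ε * (J (A n) + J F) ≤ δ / 2 := by
        calc ε * (J (A n) + J F) ≤ ε * (2 * J F + 1) :=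
            mul_le_mul_of_nonneg_left (by linarith) (by positivity)
          _ = δ / 2 := by rw [hε]; field_simp
      have h5 : C * ((J (A n) + J F) / 2 - J ((1 / 2 : ℝ) • (A n + F))) ≤ δ / 2 := by
        calc _ ≤ C * (δ / (C + 1) / 2) := by
              gcongr
              linarith [hmidJ n]
          _ = (C / (C + 1)) * (δ / 2) := by ring
          _ ≤ 1 * (δ / 2) := by
              gcongr
              rw [div_le_one (by positivity)]
              linarith
          _ = δ / 2 := one_mul _
      linarith
    rw [Metric.tendsto_nhds]
    intro δ hδ
    filter_upwards [key (δ / 2) (by positivity)] with n hn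
    rw [Real.dist_0_eq_abs, abs_of_nonneg (hJnn _)]
    linarith
  have he : ∀ n, eLpNorm (A n - F) (ENNReal.ofReal p) μ = ENNReal.ofReal (J (A n - F) ^ p⁻¹) := by
    intro n
    rw [((hA n).sub hF).eLpNorm_eq_integral_rpow_norm (by simpa using hp0) ENNReal.ofReal_ne_top,
      ENNReal.toReal_ofReal hp0.le]
  simp only [he]
  have h1 : Tendsto (fun n => J (A n - F) ^ p⁻¹) atTop (𝓝 (0 ^ p⁻¹)) :=
    (Real.continuous_rpow_const (inv_nonneg.2 hp0.le)).continuousAt.tendsto.comp hJ0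
  rw [Real.zero_rpow (inv_ne_zero hp0.ne')] at h1
  simpa using ENNReal.tendsto_ofReal h1

/-- The first-order convexity inequality for ‖·‖^p / p, obtained from Young's inequality with
exponents p / (p - 1) and p, without differentiating the norm. -/
theorem rpow_mul_inner_le {p : ℝ} (hp : 1 < p) (a b : E) :
    ‖a‖ ^ (p - 2) * inner ℝ a b ≤ (1 / p) * (‖a + b‖ ^ p - ‖a‖ ^ p) := by
  have hp0 : 0 < p := by linarith
  by_cases ha : a = 0
  · simp only [ha, inner_zero_left, mul_zero, zero_add, norm_zero, Real.zero_rpow hp0.ne', sub_zero]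
    positivity
  have hna : 0 < ‖a‖ := norm_pos_iff.2 ha
  have h1 : inner ℝ a b = inner ℝ a (a + b) - ‖a‖ ^ 2 := by
    rw [inner_add_right, real_inner_self_eq_norm_sq]; ring
  have e1 : ‖a‖ ^ (p - 2) * ‖a‖ ^ 2 = ‖a‖ ^ p := by
    rw [← Real.rpow_natCast, ← Real.rpow_add hna]; norm_num
  have e2 : ‖a‖ ^ (p - 2) * ‖a‖ = ‖a‖ ^ (p - 1) := by
    rw [← Real.rpow_add_one hna.ne']; ring_nf
  have h2 : ‖a‖ ^ (p - 2) * inner ℝ a (a + b) ≤ ‖a‖ ^ (p - 1) * ‖a + b‖ := by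
    rw [← e2, mul_assoc]
    gcongr
    exact real_inner_le_norm _ _
  have hpq : (p / (p - 1)).HolderConjugate p := by
    have := Real.HolderConjugate.conjExponent hp
    exact this.symm
  have h3 := Real.young_inequality_of_nonneg (Real.rpow_nonneg hna.le (p - 1)) (norm_nonneg (a + b))
    hpq
  rw [← Real.rpow_mul hna.le, mul_div_cancel₀ _ (by linarith : p - 1 ≠ 0)] at h3
  rw [h1, mul_sub, e1]
  have e3 : ‖a‖ ^ p / (p / (p - 1)) = ‖a‖ ^ p - (1 / p) * ‖a‖ ^ p := by
    field_simp
  rw [e3] at h3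
  have e4 : ‖a + b‖ ^ p / p = (1 / p) * ‖a + b‖ ^ p := by ring
  rw [e4] at h3
  linarith

/-- An integrable majorant for the p-Laplace form: the product ‖a‖^(p-1) ‖b‖ is at most the p-th
power of the larger norm. -/
theorem abs_rpow_mul_inner_le {p : ℝ} (hp : 1 < p) (a b : E) :
    |‖a‖ ^ (p - 2) * inner ℝ a b| ≤ ‖a‖ ^ p + ‖b‖ ^ p := by
  have hp0 : 0 < p := by linarith
  by_cases ha : a = 0
  · simp only [ha, inner_zero_left, mul_zero, abs_zero]
    positivity
  have hna : 0 < ‖a‖ := norm_pos_iff.2 ha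
  have e2 : ‖a‖ ^ (p - 2) * ‖a‖ = ‖a‖ ^ (p - 1) := by
    rw [← Real.rpow_add_one hna.ne']; ring_nf
  rw [abs_mul, abs_of_nonneg (by positivity : 0 ≤ ‖a‖ ^ (p - 2))]
  have h1 : ‖a‖ ^ (p - 2) * |inner ℝ a b| ≤ ‖a‖ ^ (p - 1) * ‖b‖ := by
    rw [← e2, mul_assoc]
    gcongr
    exact abs_real_inner_le_norm _ _
  refine h1.trans ?_
  have e3 : ∀ t : ℝ, 0 ≤ t → t ^ p = t ^ (p - 1) * t := fun t ht => by
    rcases ht.eq_or_lt with h | h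
    · simp [← h, Real.zero_rpow hp0.ne']
    · rw [← Real.rpow_add_one h.ne']; ring_nf
  rcases le_total ‖a‖ ‖b‖ with h | h
  · have : ‖a‖ ^ (p - 1) * ‖b‖ ≤ ‖b‖ ^ p := by
      rw [e3 _ (norm_nonneg b)]
      gcongr
    have := Real.rpow_nonneg hna.le p
    linarith
  · have : ‖a‖ ^ (p - 1) * ‖b‖ ≤ ‖a‖ ^ p := by
      rw [e3 _ (norm_nonneg a)]
      gcongr
    have := Real.rpow_nonneg (norm_nonneg b) p
    linarith

/-- Critical points of the `p`-energy are minimizers. -/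
theorem eLpNorm_le_of_integral_eq_zero {p : ℝ} (hp : 1 < p) {G K : α → E}
    (hG : MemLp G (ENNReal.ofReal p) μ) (hK : MemLp K (ENNReal.ofReal p) μ)
    (h0 : ∫ x, ‖G x‖ ^ (p - 2) * inner ℝ (G x) (K x) ∂μ = 0) :
    eLpNorm G (ENNReal.ofReal p) μ ≤ eLpNorm (G + K) (ENNReal.ofReal p) μ := by
  have hp0 : 0 < p := by linarith
  have i1 := hG.integrable_rpow hp
  have i2 := (hG.add hK).integrable_rpow hp
  have i3 : Integrable (fun x => ‖G x‖ ^ (p - 2) * inner ℝ (G x) (K x)) μ := by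
    refine Integrable.mono' (i1.add (hK.integrable_rpow hp)) ?_
      (Eventually.of_forall fun x => abs_rpow_mul_inner_le hp _ _)
    exact ((hG.1.norm.aemeasurable.pow_const _).aestronglyMeasurable).mul (hG.1.inner hK.1)
  have h1 : 0 ≤ ∫ x, (1 / p) * (‖(G + K) x‖ ^ p - ‖G x‖ ^ p) ∂μ := by
    rw [← h0]
    exact integral_mono i3 ((i2.sub i1).const_mul _) fun x => rpow_mul_inner_le hp _ _
  rw [integral_const_mul, integral_sub i2 i1] at h1
  have h2 : ∫ x, ‖G x‖ ^ p ∂μ ≤ ∫ x, ‖(G + K) x‖ ^ p ∂μ := by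
    have := (mul_nonneg_iff_of_pos_left (by positivity : 0 < 1 / p)).1 h1
    linarith
  rw [hG.eLpNorm_eq_integral_rpow_norm (by simpa using hp0) ENNReal.ofReal_ne_top,
    (hG.add hK).eLpNorm_eq_integral_rpow_norm (by simpa using hp0) ENNReal.ofReal_ne_top,
    ENNReal.toReal_ofReal hp0.le]
  apply ENNReal.ofReal_le_ofReal
  exact Real.rpow_le_rpow (integral_nonneg fun x => by positivity) h2 (inv_nonneg.2 hp0.le)

end Convexity

/-! ### Polynomials -/

section Polynomials

open MvPolynomial

theorem MvPolynomial.totalDegree_aeval_le_of_le_one {σ τ : Type*} (f : σ → MvPolynomial τ ℝ)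
    (hf : ∀ i, (f i).totalDegree ≤ 1) (q : MvPolynomial σ ℝ) :
    (aeval f q).totalDegree ≤ q.totalDegree := by
  rw [aeval_def, eval₂_eq]
  refine totalDegree_finsetSum_le fun a ha => ?_
  refine (totalDegree_mul _ _).trans ?_
  rw [MvPolynomial.algebraMap_eq, totalDegree_C, zero_add]
  refine (totalDegree_finsetProd _ _).trans ?_
  refine le_trans ?_ (le_totalDegree ha)
  refine Finset.sum_le_sum fun i _ => ?_
  exact (totalDegree_pow _ _).trans (by simpa using Nat.mul_le_mul_left (a i) (hf i))

theorem MvPolynomial.eq_zero_of_isOpen {ι : Type*} [Fintype ι] {U : Set (ι → ℝ)} (hU : IsOpen U)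
    (hne : U.Nonempty) {q : MvPolynomial ι ℝ} (h : ∀ x ∈ U, eval x q = 0) : q = 0 := by
  obtain ⟨x, hx⟩ := hne
  obtain ⟨r, hr, hb⟩ := Metric.isOpen_iff.1 hU x hx
  rw [ball_pi x hr] at hb
  refine funext_set (fun i => Metric.ball (x i) r) (fun i => ?_) fun y hy => ?_
  · rw [Real.ball_eq_Ioo]
    exact Set.Ioo_infinite (by linarith)
  · rw [h y (hb hy), map_zero]

/-- The exponents of degree at most `k`. -/
def degLE (d k : ℕ) : Finset (Fin d →₀ ℕ) :=
  (Finset.range (k + 1)).biUnion fun m => Finset.univ.finsuppAntidiag m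

theorem support_subset_degLE {k : ℕ} {q : MvPolynomial (Fin d) ℝ} (hq : q.totalDegree ≤ k) :
    q.support ⊆ degLE d k := by
  intro a ha
  have h1 := (le_totalDegree ha).trans hq
  simp only [degLE, Finset.mem_biUnion, Finset.mem_range, Finset.mem_finsuppAntidiag]
  refine ⟨a.sum fun _ e => e, by omega, ?_, Finset.subset_univ _⟩
  rw [Finsupp.sum_fintype _ _ (fun _ => rfl)]

theorem eval_eq_sum_degLE {k : ℕ} {q : MvPolynomial (Fin d) ℝ} (hq : q.totalDegree ≤ k)
    (x : Fin d → ℝ) : eval x q = ∑ a ∈ degLE d k, q.coeff a * ∏ i, x i ^ a i := by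
  rw [eval_eq']
  refine Finset.sum_subset (support_subset_degLE hq) fun a _ ha => ?_
  rw [notMem_support_iff.1 ha, zero_mul]

theorem continuous_eval_euclidean (q : MvPolynomial (Fin d) ℝ) :
    Continuous fun x : 𝔼 d => eval (fun i => x i) q := by
  simp only [eval_eq']
  fun_prop

theorem contDiff_eval_euclidean (q : MvPolynomial (Fin d) ℝ) :
    ContDiff ℝ ∞ fun x : 𝔼 d => eval (fun i => x i) q := by
  simp only [eval_eq']
  refine ContDiff.sum fun a _ => contDiff_const.mul (contDiff_prod fun i _ => ?_)
  exact ContDiff.pow (by fun_prop) _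

/-- On polynomials of bounded degree, the coefficients are controlled by the `L²` norm on a ball. -/
theorem exists_sum_coeff_sq_le (d k : ℕ) {κ : ℝ} (hκ : 0 < κ) :
    ∃ C : ℝ, 0 ≤ C ∧ ∀ q : MvPolynomial (Fin d) ℝ, q.totalDegree ≤ k →
      (∑ a ∈ degLE d k, |q.coeff a|) ^ 2 ≤
        C * ∫ x in Metric.closedBall (0 : 𝔼 d) κ, (eval (fun i => x i) q) ^ 2 := by
  set S := degLE d k with hS
  set P : (S → ℝ) → MvPolynomial (Fin d) ℝ := fun c => ∑ a : S, monomial a (c a) with hP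
  have hPe : ∀ c (x : 𝔼 d), eval (fun i => x i) (P c) = ∑ a : S, c a * ∏ i, x i ^ (a : Fin d →₀ ℕ) i := by
    intro c x
    simp only [hP, map_sum, eval_monomial]
    refine Finset.sum_congr rfl fun a _ => ?_
    rw [Finsupp.prod_fintype _ _ (by simp)]
  have hPc : ∀ c (a : S), (P c).coeff a = c a := by
    intro c a
    simp [hP, coeff_sum, coeff_monomial]
  set N : (S → ℝ) → ℝ := fun c =>
    ∫ x in Metric.closedBall (0 : 𝔼 d) κ, (eval (fun i => x i) (P c)) ^ 2 with hN
  have hNc : Continuous N := by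
    refine continuous_parametric_integral_of_continuous ?_ (isCompact_closedBall _ _)
    simp only [hPe, Function.uncurry_def]
    fun_prop
  have hNnn : ∀ c, 0 ≤ N c := fun c => integral_nonneg fun x => sq_nonneg _
  -- A polynomial with zero L² norm on the ball vanishes on an open set, hence identically.
  -- Compactness of the unit sphere of coefficient vectors then gives a uniform lower bound,
  -- extended to all vectors by scaling.
  have hNpos : ∀ c, c ≠ 0 → 0 < N c := by
    intro c hc
    refine lt_of_le_of_ne (hNnn c) fun h0 => hc ?_
    have hcont : Continuous fun x : 𝔼 d => (eval (fun i => x i) (P c)) ^ 2 :=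
      (continuous_eval_euclidean _).pow 2
    have h1 := (integral_eq_zero_iff_of_nonneg (fun x => sq_nonneg _)
      (hcont.continuousOn.integrableOn_compact (isCompact_closedBall (0 : 𝔼 d) κ))).1 h0.symm
    have h2 : (fun x : 𝔼 d => (eval (fun i => x i) (P c)) ^ 2)
        =ᵐ[volume.restrict (Metric.ball (0 : 𝔼 d) κ)] fun _ => 0 :=
      ae_restrict_of_ae_restrict_of_subset Metric.ball_subset_closedBall h1
    have h3 := Measure.eqOn_open_of_ae_eq h2 Metric.isOpen_ball hcont.continuousOn
      continuousOn_const
    have h4 : P c = 0 := by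
      refine MvPolynomial.eq_zero_of_isOpen
        (U := (WithLp.toLp 2) ⁻¹' (Metric.ball (0 : 𝔼 d) κ))
        (Metric.isOpen_ball.preimage (PiLp.continuous_toLp 2 _))
        ⟨0, by simpa using hκ⟩ fun x hx => ?_
      have := h3 hx
      simpa using this
    ext a
    rw [← hPc c a, h4]
    simp
  obtain ⟨m, hm0, hm⟩ : ∃ m : ℝ, 0 < m ∧ ∀ c : S → ℝ, ‖c‖ = 1 → m ≤ N c := by
    rcases (Metric.sphere (0 : S → ℝ) 1).eq_empty_or_nonempty with h | h
    · refine ⟨1, one_pos, fun c hc => ?_⟩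
      have : c ∈ Metric.sphere (0 : S → ℝ) 1 := by simpa using hc
      simp [h] at this
    · obtain ⟨z, hz, hmin⟩ := (isCompact_sphere (0 : S → ℝ) 1).exists_isMinOn h hNc.continuousOn
      refine ⟨N z, hNpos z ?_, fun c hc => hmin (by simpa using hc)⟩
      rintro rfl
      simp at hz
  have hbound : ∀ c : S → ℝ, ‖c‖ ^ 2 * m ≤ N c := by
    intro c
    by_cases hc : c = 0
    · simpa [hc] using hNnn 0
    have hn : ‖c‖ ≠ 0 := norm_ne_zero_iff.2 hc
    have h1 := hm (‖c‖⁻¹ • c) (by rw [norm_smul, norm_inv, norm_norm, inv_mul_cancel₀ hn])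
    have h2 : N (‖c‖⁻¹ • c) = (‖c‖⁻¹) ^ 2 * N c := by
      simp only [hN, hPe, Pi.smul_apply, smul_eq_mul, mul_assoc, ← Finset.mul_sum, mul_pow]
      rw [integral_const_mul]
    rw [h2, inv_pow, ← div_eq_inv_mul, le_div_iff₀ (by positivity)] at h1
    linarith
  refine ⟨(S.card : ℝ) ^ 2 / m, by positivity, fun q hq => ?_⟩
  set c : S → ℝ := fun a => q.coeff a with hc
  have hq' : ∀ x : 𝔼 d, eval (fun i => x i) q = eval (fun i => x i) (P c) := by
    intro x
    rw [hPe, eval_eq_sum_degLE hq, ← hS, ← Finset.sum_coe_sort S]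
  have h1 : ∑ a ∈ S, |q.coeff a| ≤ S.card * ‖c‖ := by
    rw [← nsmul_eq_mul]
    refine Finset.sum_le_card_nsmul _ _ _ fun a ha => ?_
    exact norm_le_pi_norm c ⟨a, ha⟩
  have h0 : 0 ≤ ∑ a ∈ S, |q.coeff a| := Finset.sum_nonneg fun _ _ => abs_nonneg _
  simp only [hq']
  calc (∑ a ∈ S, |q.coeff a|) ^ 2 ≤ (S.card * ‖c‖) ^ 2 := by gcongr
    _ = (S.card : ℝ) ^ 2 / m * (‖c‖ ^ 2 * m) := by field_simp
    _ ≤ (S.card : ℝ) ^ 2 / m * N c := by gcongr; exact hbound c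

/-! ### Inverse estimates by scaling to unit size -/

theorem abs_eval_le_sum_coeff {k : ℕ} {q : MvPolynomial (Fin d) ℝ} (hq : q.totalDegree ≤ k)
    {x : 𝔼 d} (hx : ‖x‖ ≤ 1) : |eval (fun i => x i) q| ≤ ∑ a ∈ degLE d k, |q.coeff a| := by
  rw [eval_eq_sum_degLE hq]
  refine (Finset.abs_sum_le_sum_abs _ _).trans (Finset.sum_le_sum fun a _ => ?_)
  rw [abs_mul]
  refine mul_le_of_le_one_right (abs_nonneg _) ?_
  rw [Finset.abs_prod]
  refine Finset.prod_le_one (fun _ _ => abs_nonneg _) fun i _ => ?_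
  rw [abs_pow]
  exact pow_le_one₀ (abs_nonneg _) ((PiLp.norm_apply_le x i).trans hx)

theorem exists_fderiv_eval_le (d k : ℕ) : ∃ D : ℝ, 0 ≤ D ∧ ∀ q : MvPolynomial (Fin d) ℝ,
    q.totalDegree ≤ k → ∀ x : 𝔼 d, ‖x‖ ≤ 1 →
      ‖fderiv ℝ (fun x : 𝔼 d => eval (fun i => x i) q) x‖ ≤ D * ∑ a ∈ degLE d k, |q.coeff a| := by
  have hm : ∀ a : Fin d →₀ ℕ, ContDiff ℝ ∞ fun x : 𝔼 d => ∏ i, x i ^ a i := fun a =>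
    contDiff_prod fun i _ => ContDiff.pow (by fun_prop) _
  have hb : ∀ a : Fin d →₀ ℕ, ∃ B : ℝ, ∀ x : 𝔼 d, ‖x‖ ≤ 1 →
      ‖fderiv ℝ (fun x : 𝔼 d => ∏ i, x i ^ a i) x‖ ≤ B := by
    intro a
    obtain ⟨B, hB⟩ := (isCompact_closedBall (0 : 𝔼 d) 1).exists_bound_of_continuousOn
      ((hm a).continuous_fderiv (by simp)).continuousOn
    exact ⟨B, fun x hx => hB x (by simpa using hx)⟩
  choose B hB using hb
  have hB0 : ∀ a, 0 ≤ B a := fun a => (norm_nonneg _).trans (hB a 0 (by simp))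
  refine ⟨∑ a ∈ degLE d k, B a, Finset.sum_nonneg fun a _ => hB0 a, fun q hq x hx => ?_⟩
  simp only [eval_eq_sum_degLE hq]
  rw [fderiv_fun_sum fun a _ => ((hm a).differentiable (by simp) x).const_mul _, Finset.mul_sum]
  refine norm_sum_le_of_le _ fun a ha => ?_
  rw [fderiv_const_mul ((hm a).differentiable (by simp) x), norm_smul, mul_comm, Real.norm_eq_abs]
  gcongr
  exact (hB a x hx).trans (Finset.single_le_sum (fun a _ => hB0 a) ha)

/-- The polynomial `t ↦ q (x₀ + h t)`. -/
def rescale (x₀ : 𝔼 d) (h : ℝ) (q : MvPolynomial (Fin d) ℝ) : MvPolynomial (Fin d) ℝ :=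
  aeval (fun i => C (x₀ i) + C h * X i) q

theorem eval_rescale (x₀ : 𝔼 d) (h : ℝ) (q : MvPolynomial (Fin d) ℝ) (t : 𝔼 d) :
    eval (fun i => t i) (rescale x₀ h q) = eval (fun i => (x₀ + h • t) i) q := by
  rw [rescale, aeval_def, eval_eval₂]
  congr 1
  · ext; simp
  · ext i; simp

theorem totalDegree_rescale_le (x₀ : 𝔼 d) (h : ℝ) (q : MvPolynomial (Fin d) ℝ) :
    (rescale x₀ h q).totalDegree ≤ q.totalDegree := by
  refine MvPolynomial.totalDegree_aeval_le_of_le_one _ (fun i => ?_) q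
  refine (totalDegree_add _ _).trans (max_le (by simp) ?_)
  refine (totalDegree_mul _ _).trans ?_
  simp

theorem setIntegral_closedBall_rescale (f : (𝔼 d) → ℝ) (x₀ : 𝔼 d) {h κ : ℝ} (hh : 0 < h) (hκ : 0 ≤ κ) :
    ∫ t in Metric.closedBall (0 : 𝔼 d) κ, f (x₀ + h • t) =
      (h ^ d)⁻¹ * ∫ x in Metric.closedBall x₀ (κ * h), f x := by
  have h1 := Measure.setIntegral_comp_smul_of_pos (volume : Measure (𝔼 d)) (fun x => f (x₀ + x))
    (Metric.closedBall (0 : 𝔼 d) κ) hh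
  rw [h1, finrank_euclideanSpace_fin, smul_eq_mul, _root_.smul_closedBall _ _ hκ,
    smul_zero, Real.norm_of_nonneg hh.le]
  congr 1
  have h2 := (measurePreserving_add_left (volume : Measure (𝔼 d)) x₀).setIntegral_preimage_emb
    (measurableEmbedding_addLeft x₀) f (Metric.closedBall x₀ (κ * h))
  rw [← h2]
  congr 2
  ext t
  simp [mul_comm]

/-- Inverse estimates for polynomials of degree at most `k`. -/
theorem exists_inverse_estimate (d k : ℕ) {κ : ℝ} (hκ : 0 < κ) :
    ∃ C : ℝ, 0 < C ∧ ∀ q : MvPolynomial (Fin d) ℝ, q.totalDegree ≤ k → ∀ (x₀ : 𝔼 d) (h : ℝ), 0 < h →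
      (∀ x, dist x x₀ ≤ h → (eval (fun i => x i) q) ^ 2 ≤
        C * ((h ^ d)⁻¹ * ∫ y in Metric.closedBall x₀ (κ * h), (eval (fun i => y i) q) ^ 2)) ∧
      (∀ M : ℝ, (∀ y ∈ Metric.closedBall x₀ (κ * h), |eval (fun i => y i) q| ≤ M) →
        ∀ x, dist x x₀ ≤ h → ‖gradient (fun x : 𝔼 d => eval (fun i => x i) q) x‖ ≤ C * (M / h)) := by
  obtain ⟨A, hA0, hA⟩ := exists_sum_coeff_sq_le d k hκ
  obtain ⟨D, hD0, hD⟩ := exists_fderiv_eval_le d k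
  set V : ℝ := volume.real (Metric.closedBall (0 : 𝔼 d) κ) with hV
  have hV0 : 0 ≤ V := measureReal_nonneg
  -- `A` serves the estimate of values, `D * √(A * V)` that of gradients, and the 1 ensures
  -- positivity. Rescaling to the unit ball makes the constant independent of `x₀` and `h`.
  refine ⟨A + D * √(A * V) + 1, by positivity, fun q hq x₀ h hh => ?_⟩
  set r := rescale x₀ h q with hr
  have hrd : r.totalDegree ≤ k := (totalDegree_rescale_le _ _ _).trans hq
  have hre : ∀ x : 𝔼 d, eval (fun i => x i) q = eval (fun i => (h⁻¹ • (x - x₀)) i) r := by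
    intro x
    rw [hr, eval_rescale, smul_inv_smul₀ hh.ne', add_sub_cancel]
  have hn : ∀ x : 𝔼 d, dist x x₀ ≤ h → ‖h⁻¹ • (x - x₀)‖ ≤ 1 := by
    intro x hx
    rw [norm_smul, norm_inv, Real.norm_of_nonneg hh.le, ← dist_eq_norm, ← div_eq_inv_mul,
      div_le_one hh]
    exact hx
  have hint : ∫ t in Metric.closedBall (0 : 𝔼 d) κ, (eval (fun i => t i) r) ^ 2 =
      (h ^ d)⁻¹ * ∫ y in Metric.closedBall x₀ (κ * h), (eval (fun i => y i) q) ^ 2 := by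
    rw [← setIntegral_closedBall_rescale (fun y => (eval (fun i => y i) q) ^ 2) x₀ hh hκ.le]
    simp only [hr, eval_rescale]
  have hInn : 0 ≤ ∫ t in Metric.closedBall (0 : 𝔼 d) κ, (eval (fun i => t i) r) ^ 2 :=
    integral_nonneg fun _ => sq_nonneg _
  have hS0 : 0 ≤ ∑ a ∈ degLE d k, |r.coeff a| := Finset.sum_nonneg fun _ _ => abs_nonneg _
  constructor
  · intro x hx
    rw [hre x, ← hint, ← sq_abs]
    have h1 := abs_eval_le_sum_coeff hrd (hn x hx)
    calc _ ≤ (∑ a ∈ degLE d k, |r.coeff a|) ^ 2 := by gcongr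
      _ ≤ _ := hA r hrd
      _ ≤ _ := by
        gcongr
        have : 0 ≤ D * √(A * V) := by positivity
        linarith
  · intro M hM x hx
    have hM0 : 0 ≤ M := (abs_nonneg _).trans (hM x₀ (Metric.mem_closedBall_self (by positivity)))
    have h1 : ∫ t in Metric.closedBall (0 : 𝔼 d) κ, (eval (fun i => t i) r) ^ 2 ≤ V * M ^ 2 := by
      have : ∫ t in Metric.closedBall (0 : 𝔼 d) κ, (eval (fun i => t i) r) ^ 2 ≤
          ∫ t in Metric.closedBall (0 : 𝔼 d) κ, M ^ 2 := by
        refine setIntegral_mono_on (((continuous_eval_euclidean r).pow 2).continuousOn.integrableOn_compact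
          (isCompact_closedBall _ _)) (integrableOn_const measure_closedBall_lt_top.ne)
          Metric.isClosed_closedBall.measurableSet fun t ht => ?_
        rw [hr, eval_rescale, ← sq_abs]
        gcongr
        refine hM _ ?_
        rw [mem_closedBall_zero_iff] at ht
        rw [Metric.mem_closedBall, dist_eq_norm, add_sub_cancel_left, norm_smul,
          Real.norm_of_nonneg hh.le, mul_comm]
        gcongr
      simpa [hV] using this
    have h2 : ∑ a ∈ degLE d k, |r.coeff a| ≤ √(A * V) * M := by
      rw [← Real.sqrt_sq hM0, ← Real.sqrt_mul (by positivity)]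
      refine Real.le_sqrt_of_sq_le ((hA r hrd).trans ?_)
      rw [mul_assoc]
      gcongr
    have h3 : HasFDerivAt (fun x : 𝔼 d => eval (fun i => x i) q)
        ((fderiv ℝ (fun x : 𝔼 d => eval (fun i => x i) r) (h⁻¹ • (x - x₀))).comp
          (h⁻¹ • ContinuousLinearMap.id ℝ (𝔼 d))) x := by
      have h4 : HasFDerivAt (fun x : 𝔼 d => h⁻¹ • (x - x₀)) (h⁻¹ • ContinuousLinearMap.id ℝ (𝔼 d)) x :=
        ((hasFDerivAt_id x).sub_const x₀).const_smul h⁻¹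
      have h5 := (((contDiff_eval_euclidean r).differentiable (by simp) (h⁻¹ • (x - x₀))).hasFDerivAt).comp x h4
      exact h5.congr_of_eventuallyEq (Eventually.of_forall fun y => hre y)
    rw [gradient, LinearIsometryEquiv.norm_map, h3.fderiv]
    refine (ContinuousLinearMap.opNorm_comp_le _ _).trans ?_
    have h6 : ‖h⁻¹ • ContinuousLinearMap.id ℝ (𝔼 d)‖ ≤ h⁻¹ := by
      rw [norm_smul, norm_inv, Real.norm_of_nonneg hh.le]
      exact mul_le_of_le_one_right (by positivity) ContinuousLinearMap.norm_id_le
    calc _ ≤ (D * ∑ a ∈ degLE d k, |r.coeff a|) * h⁻¹ := by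
          gcongr
          exact hD r hrd _ (hn x hx)
      _ ≤ (D * (√(A * V) * M)) * h⁻¹ := by gcongr
      _ = D * √(A * V) * (M / h) := by ring
      _ ≤ _ := by
        gcongr
        linarith

end Polynomials

/-! ### Bernstein form on a cell -/

section Bernstein

open MvPolynomial

/-- The vertex set of a nondegenerate simplex. -/
structure IsCell (s : Finset (𝔼 d)) : Prop where
  card_eq : s.card = d + 1
  affineIndependent : AffineIndependent ℝ ((↑) : s → 𝔼 d)

theorem exists_polynomial_of_affine (f : (𝔼 d) →ᵃ[ℝ] ℝ) :
    ∃ q : MvPolynomial (Fin d) ℝ, q.totalDegree ≤ 1 ∧ ∀ x : 𝔼 d, eval (fun i => x i) q = f x := by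
  refine ⟨C (f 0) + ∑ i, C (f.linear (EuclideanSpace.single i 1)) * X i, ?_, fun x => ?_⟩
  · refine (totalDegree_add _ _).trans (max_le (by simp) ?_)
    refine totalDegree_finsetSum_le fun i _ => ?_
    refine (totalDegree_mul _ _).trans ?_
    simp
  · have h1 : f x = f.linear x + f 0 := by
      have := f.map_vadd 0 x
      simpa using this
    have h2 : x = ∑ i, x i • EuclideanSpace.single i (1 : ℝ) := by
      have := (EuclideanSpace.basisFun (Fin d) ℝ).sum_repr x
      simpa using this.symm
    have h3 : f.linear x = ∑ i, x i * f.linear (EuclideanSpace.single i 1) := by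
      conv_lhs => rw [h2]
      simp
    rw [h1, h3]
    simp only [map_add, eval_C, map_sum, map_mul, eval_X]
    rw [add_comm]
    congr 1
    exact Finset.sum_congr rfl fun i _ => mul_comm _ _

/-- The coordinates are indexed by all points of space and vanish off the vertices of the cell, so
that coordinates coming from different cells are functions on the same index set and can be compared
directly. -/
theorem IsCell.exists_barycentric {s : Finset (𝔼 d)} (hs : IsCell s) :
    ∃ Λ : (𝔼 d) → MvPolynomial (Fin d) ℝ, (∀ v, (Λ v).totalDegree ≤ 1) ∧ (∀ v ∉ s, Λ v = 0) ∧
      (∀ x : 𝔼 d, ∑ v ∈ s, eval (fun i => x i) (Λ v) = 1) ∧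
      (∀ x : 𝔼 d, ∑ v ∈ s, eval (fun i => x i) (Λ v) • v = x) ∧
      (∀ w : (𝔼 d) → ℝ, ∑ v ∈ s, w v = 1 → ∀ v ∈ s,
        eval (fun i => (∑ u ∈ s, w u • u) i) (Λ v) = w v) := by
  classical
  have htop : affineSpan ℝ (Set.range ((↑) : s → 𝔼 d)) = ⊤ := by
    rw [hs.affineIndependent.affineSpan_eq_top_iff_card_eq_finrank_add_one]
    simp [hs.card_eq]
  set b : AffineBasis s ℝ (𝔼 d) := ⟨(↑), hs.affineIndependent, htop⟩ with hb
  choose P hP1 hP2 using fun v : s => exists_polynomial_of_affine (b.coord v)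
  have hsum : ∀ {M : Type} [AddCommMonoid M] (f : (𝔼 d) → M),
      ∑ v ∈ s, f v = ∑ v : s, f v := fun f => (Finset.sum_coe_sort s f).symm
  refine ⟨fun v => if h : v ∈ s then P ⟨v, h⟩ else 0, fun v => ?_, fun v hv => dif_neg hv,
    fun x => ?_, fun x => ?_, fun w hw v hv => ?_⟩
  · dsimp only
    split_ifs with h
    · exact hP1 _
    · simp
  · rw [hsum]
    refine (Finset.sum_congr rfl fun v _ => ?_).trans (b.sum_coord_apply_eq_one x)
    beta_reduce
    rw [dif_pos v.2, hP2]
  · rw [hsum]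
    refine (Finset.sum_congr rfl fun v _ => ?_).trans (b.linear_combination_coord_eq_self x)
    beta_reduce
    rw [dif_pos v.2, hP2]
    rfl
  · simp only [hv, dite_true, hP2]
    have h1 : ∑ u : s, w u = 1 := by rw [← hw, hsum]
    have h2 := b.coord_apply_combination_of_mem (Finset.mem_univ (⟨v, hv⟩ : s))
      (w := fun u : s => w u) h1
    rw [Finset.affineCombination_eq_linear_combination _ _ _ h1] at h2
    rw [hsum]
    exact h2

open Classical in
/-- The barycentric coordinates of a cell, as polynomials. -/
def bary (s : Finset (𝔼 d)) : (𝔼 d) → MvPolynomial (Fin d) ℝ :=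
  if h : IsCell s then h.exists_barycentric.choose else 0

/-- The barycentric coordinates of `x` with respect to a cell. -/
def baryCoord (s : Finset (𝔼 d)) (x : 𝔼 d) (v : 𝔼 d) : ℝ := eval (fun i => x i) (bary s v)

namespace IsCell

variable {s t : Finset (𝔼 d)}

theorem bary_spec (hs : IsCell s) : (∀ v, (bary s v).totalDegree ≤ 1) ∧ (∀ v ∉ s, bary s v = 0) ∧
      (∀ x : 𝔼 d, ∑ v ∈ s, baryCoord s x v = 1) ∧
      (∀ x : 𝔼 d, ∑ v ∈ s, baryCoord s x v • v = x) ∧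
      (∀ w : (𝔼 d) → ℝ, ∑ v ∈ s, w v = 1 → ∀ v ∈ s,
        baryCoord s (∑ u ∈ s, w u • u) v = w v) := by
  have := hs.exists_barycentric.choose_spec
  simp only [baryCoord, bary, dif_pos hs]
  exact this

theorem baryCoord_of_notMem (hs : IsCell s) (x : 𝔼 d) {v : 𝔼 d} (hv : v ∉ s) :
    baryCoord s x v = 0 := by
  simp [baryCoord, hs.bary_spec.2.1 v hv]

/-- Affine independence makes weights unique. Applied to the common face of two cells, this shows
that a shared point has literally the same coordinate function in both. -/
theorem baryCoord_eq_of_subset (hs : IsCell s) {F : Finset (𝔼 d)} (hF : F ⊆ s)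
    {w : (𝔼 d) → ℝ} (hw : ∑ v ∈ F, w v = 1) (hw0 : ∀ v ∉ F, w v = 0) :
    baryCoord s (∑ u ∈ F, w u • u) = w := by
  have h1 : ∑ v ∈ s, w v = 1 := by
    rw [← hw]
    exact (Finset.sum_subset hF fun v _ hv => hw0 v hv).symm
  have h2 : ∑ u ∈ F, w u • u = ∑ u ∈ s, w u • u :=
    Finset.sum_subset hF fun v _ hv => by rw [hw0 v hv, zero_smul]
  ext v
  by_cases hv : v ∈ s
  · rw [h2]
    exact hs.bary_spec.2.2.2.2 w h1 v hv
  · rw [hs.baryCoord_of_notMem _ hv, hw0 v fun h => hv (hF h)]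

theorem exists_weights_of_mem_convexHull {F : Finset (𝔼 d)} {x : 𝔼 d}
    (hx : x ∈ convexHull ℝ (F : Set (𝔼 d))) : ∃ w : (𝔼 d) → ℝ, (∀ v, 0 ≤ w v) ∧ (∀ v ∉ F, w v = 0) ∧
      ∑ v ∈ F, w v = 1 ∧ ∑ v ∈ F, w v • v = x := by
  classical
  obtain ⟨w, h1, h2, h3⟩ := Finset.mem_convexHull'.1 hx
  refine ⟨fun v => if v ∈ F then w v else 0, fun v => ?_, fun v hv => if_neg hv, ?_, ?_⟩
  · dsimp only
    split_ifs with h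
    · exact h1 v h
    · exact le_rfl
  · rw [← h2]
    exact Finset.sum_congr rfl fun v hv => if_pos hv
  · rw [← h3]
    exact Finset.sum_congr rfl fun v hv => by simp only [if_pos hv]

theorem baryCoord_nonneg (hs : IsCell s) {x : 𝔼 d} (hx : x ∈ convexHull ℝ (s : Set (𝔼 d)))
    (v : 𝔼 d) : 0 ≤ baryCoord s x v := by
  obtain ⟨w, h1, h2, h3, rfl⟩ := exists_weights_of_mem_convexHull hx
  rw [hs.baryCoord_eq_of_subset subset_rfl h3 h2]
  exact h1 v

theorem baryCoord_le_one (hs : IsCell s) {x : 𝔼 d} (hx : x ∈ convexHull ℝ (s : Set (𝔼 d)))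
    (v : 𝔼 d) : baryCoord s x v ≤ 1 := by
  by_cases hv : v ∈ s
  · rw [← hs.bary_spec.2.2.1 x]
    exact Finset.single_le_sum (fun v _ => hs.baryCoord_nonneg hx v) hv
  · rw [hs.baryCoord_of_notMem x hv]
    exact zero_le_one

/-- Every polynomial of degree at most `k` is a homogeneous polynomial of degree `k` in the
barycentric coordinates of a cell. -/
theorem exists_bernstein (hs : IsCell s) {k : ℕ} {q : MvPolynomial (Fin d) ℝ}
    (hq : q.totalDegree ≤ k) : ∃ Q : MvPolynomial (𝔼 d) ℝ, Q.IsHomogeneous k ∧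
      Q ∈ supported ℝ (s : Set (𝔼 d)) ∧
      ∀ x : 𝔼 d, eval (baryCoord s x) Q = eval (fun i => x i) q := by
  -- Substitute xᵢ = ∑ λᵥ vᵢ and pad every monomial with powers of 1 = ∑ λᵥ until its degree is
  -- exactly `k`.
  set ℓ : Fin d → MvPolynomial (𝔼 d) ℝ := fun i => ∑ v ∈ s, C (v i) * X v with hℓ
  set o : MvPolynomial (𝔼 d) ℝ := ∑ v ∈ s, X v with ho
  have hℓh : ∀ i, (ℓ i).IsHomogeneous 1 := fun i =>
    IsHomogeneous.sum _ _ _ fun v _ => isHomogeneous_C_mul_X _ _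
  have hoh : o.IsHomogeneous 1 := IsHomogeneous.sum _ _ _ fun v _ => isHomogeneous_X _ _
  refine ⟨∑ a ∈ degLE d k, C (q.coeff a) * ((∏ i, ℓ i ^ a i) * o ^ (k - ∑ i, a i)), ?_, ?_,
    fun x => ?_⟩
  · refine IsHomogeneous.sum _ _ _ fun a ha => IsHomogeneous.C_mul ?_ _
    have h1 : (∏ i, ℓ i ^ a i).IsHomogeneous (∑ i, a i) := by
      refine IsHomogeneous.prod _ _ _ fun i _ => ?_
      simpa using (hℓh i).pow (a i)
    have h2 := hoh.pow (k - ∑ i, a i)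
    rw [one_mul] at h2
    have h3 : ∑ i, a i ≤ k := by
      simp only [degLE, Finset.mem_biUnion, Finset.mem_range, Finset.mem_finsuppAntidiag] at ha
      obtain ⟨m, hm, h4, -⟩ := ha
      change ∑ i, a i = m at h4
      omega
    have := h1.mul h2
    rwa [Nat.add_sub_cancel' h3] at this
  · have hX : ∀ v ∈ s, (X v : MvPolynomial (𝔼 d) ℝ) ∈ supported ℝ (s : Set (𝔼 d)) := fun v hv =>
      X_mem_supported.2 hv
    have hC : ∀ c : ℝ, (C c : MvPolynomial (𝔼 d) ℝ) ∈ supported ℝ (s : Set (𝔼 d)) := fun c =>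
      (supported ℝ (s : Set (𝔼 d))).algebraMap_mem c
    refine Subalgebra.sum_mem _ fun a _ => Subalgebra.mul_mem _ (hC _) (Subalgebra.mul_mem _ ?_ ?_)
    · exact Subalgebra.prod_mem _ fun i _ => Subalgebra.pow_mem _
        (Subalgebra.sum_mem _ fun v hv => Subalgebra.mul_mem _ (hC _) (hX v hv)) _
    · exact Subalgebra.pow_mem _ (Subalgebra.sum_mem _ fun v hv => hX v hv) _
  · have h1 : ∀ i, eval (baryCoord s x) (ℓ i) = x i := by
      intro i
      conv_rhs => rw [← hs.bary_spec.2.2.2.1 x]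
      simp only [hℓ, map_sum, map_mul, eval_C, eval_X, WithLp.ofLp_sum, Finset.sum_apply, PiLp.smul_apply,
        smul_eq_mul]
      exact Finset.sum_congr rfl fun v _ => mul_comm _ _
    have h2 : eval (baryCoord s x) o = 1 := by
      simp only [ho, map_sum, eval_X]
      exact hs.bary_spec.2.2.1 x
    rw [eval_eq_sum_degLE hq]
    simp only [map_sum, map_mul, eval_C, map_prod, map_pow, h1, h2, one_pow, mul_one]

end IsCell

theorem MvPolynomial.IsHomogeneous.eval_smul {σ : Type*} {Q : MvPolynomial σ ℝ} {k : ℕ}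
    (hQ : Q.IsHomogeneous k) (c : ℝ) (w : σ → ℝ) : eval (fun i => c * w i) Q = c ^ k * eval w Q := by
  rw [eval_eq, eval_eq, Finset.mul_sum]
  refine Finset.sum_congr rfl fun a ha => ?_
  have h1 : a.degree = k := by
    by_contra h
    exact (mem_support_iff.1 ha) (hQ.coeff_eq_zero h)
  simp only [mul_pow, Finset.prod_mul_distrib]
  rw [Finset.prod_pow_eq_pow_sum, ← h1]
  rw [show ∑ i ∈ a.support, a i = a.degree from rfl]
  ring

/-- The coefficients of homogeneous polynomials are controlled by the values on the simplex. -/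
theorem exists_sum_coeff_le_stdSimplex (d k : ℕ) : ∃ C : ℝ, 0 ≤ C ∧
    ∀ Q : MvPolynomial (Fin (d + 1)) ℝ, Q.IsHomogeneous k → ∀ M : ℝ,
      (∀ w ∈ stdSimplex ℝ (Fin (d + 1)), |eval w Q| ≤ M) → ∑ a ∈ Q.support, |Q.coeff a| ≤ C * M := by
  classical
  set S : Finset (Fin (d + 1) →₀ ℕ) := Finset.univ.finsuppAntidiag k with hS
  set X := stdSimplex ℝ (Fin (d + 1)) with hX
  have : CompactSpace X := isCompact_iff_compactSpace.1 (isCompact_stdSimplex ℝ (Fin (d + 1)))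
  set P : (S → ℝ) → MvPolynomial (Fin (d + 1)) ℝ := fun c => ∑ a : S, monomial a (c a) with hP
  have hPe : ∀ c x, eval x (P c) = ∑ a : S, c a * ∏ i, x i ^ (a : Fin (d + 1) →₀ ℕ) i := by
    intro c x
    simp only [hP, map_sum, eval_monomial]
    refine Finset.sum_congr rfl fun a _ => ?_
    rw [Finsupp.prod_fintype _ _ (by simp)]
  have hPc : ∀ c (a : S), (P c).coeff a = c a := by
    intro c a
    simp [hP, coeff_sum, coeff_monomial]
  have hPh : ∀ c, (P c).IsHomogeneous k := by
    intro c
    refine IsHomogeneous.sum _ _ _ fun a _ => isHomogeneous_monomial _ ?_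
    have := Finset.mem_finsuppAntidiag.1 a.2
    rw [Finsupp.degree_eq_sum]
    exact this.1
  let T : (S → ℝ) →ₗ[ℝ] C(X, ℝ) :=
    { toFun := fun c => ⟨fun x => ∑ a : S, c a * ∏ i, x.1 i ^ (a : Fin (d + 1) →₀ ℕ) i,
        continuous_finsetSum _ fun a _ => continuous_const.mul (continuous_finsetProd _ fun i _ =>
          ((continuous_apply i).comp continuous_subtype_val).pow _)⟩
      map_add' := fun c c' => by
        ext x
        simp [add_mul, Finset.sum_add_distrib]
      map_smul' := fun r c => by
        ext x
        simp [mul_assoc, Finset.mul_sum] }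
  have hTe : ∀ c (x : X), T c x = eval x.1 (P c) := fun c x => (hPe c x).symm
  -- By homogeneity, vanishing on the simplex means vanishing on the positive orthant, hence
  -- everywhere. An injective linear map on a finite-dimensional space is bounded below, which gives
  -- the constant.
  have hTinj : LinearMap.ker T = ⊥ := by
    rw [LinearMap.ker_eq_bot']
    intro c hc
    have h0 : P c = 0 := by
      refine MvPolynomial.eq_zero_of_isOpen (U := {w | ∀ i, 0 < w i}) ?_ ⟨fun _ => 1, fun _ => one_pos⟩
        fun w hw => ?_
      · simp only [Set.ofPred_forall]
        exact isOpen_iInter_of_finite fun i => isOpen_lt continuous_const (continuous_apply i)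
      · have hsum : 0 < ∑ i, w i := Finset.sum_pos (fun i _ => hw i) Finset.univ_nonempty
        have hmem : (fun i => (∑ i, w i)⁻¹ * w i) ∈ X := by
          refine ⟨fun i => mul_nonneg (by positivity) (hw i).le, ?_⟩
          rw [← Finset.mul_sum, inv_mul_cancel₀ hsum.ne']
        have h1 := hTe c ⟨_, hmem⟩
        rw [hc] at h1
        simp only [ContinuousMap.zero_apply] at h1
        rw [(hPh c).eval_smul] at h1
        rcases mul_eq_zero.1 h1.symm with h2 | h2
        · exact absurd h2 (by positivity)
        · exact h2
    ext a
    rw [← hPc c a, h0]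
    simp
  obtain ⟨K, -, hK⟩ := T.exists_antilipschitzWith hTinj
  refine ⟨S.card * K, by positivity, fun Q hQ M hM => ?_⟩
  have hsub : Q.support ⊆ S := by
    intro a ha
    rw [hS, Finset.mem_finsuppAntidiag]
    refine ⟨?_, Finset.subset_univ _⟩
    rw [← Finsupp.degree_eq_sum]
    by_contra h
    exact (mem_support_iff.1 ha) (hQ.coeff_eq_zero h)
  set c : S → ℝ := fun a => Q.coeff a with hc
  have hQP : ∀ w, eval w Q = eval w (P c) := by
    intro w
    rw [hPe, eval_eq', Finset.sum_subset hsub fun a _ ha => by rw [notMem_support_iff.1 ha, zero_mul],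
      ← Finset.sum_coe_sort S]
  have hM0 : 0 ≤ M := (abs_nonneg _).trans (hM _ (single_mem_stdSimplex ℝ (0 : Fin (d + 1))))
  have h1 : ‖c‖ ≤ K * M := by
    have h2 := hK.le_mul_dist c 0
    rw [map_zero, dist_zero_right, dist_zero_right] at h2
    refine h2.trans ?_
    gcongr
    rw [ContinuousMap.norm_le _ hM0]
    intro x
    rw [hTe, ← hQP]
    exact hM _ x.2
  calc ∑ a ∈ Q.support, |Q.coeff a| ≤ ∑ a ∈ S, |Q.coeff a| :=
        Finset.sum_le_sum_of_subset_of_nonneg hsub fun _ _ _ => abs_nonneg _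
    _ ≤ S.card • ‖c‖ := Finset.sum_le_card_nsmul _ _ _ fun a ha => norm_le_pi_norm c ⟨a, ha⟩
    _ = S.card * ‖c‖ := nsmul_eq_mul _ _
    _ ≤ S.card * (K * M) := by gcongr
    _ = S.card * K * M := by ring

/-- The Bernstein coefficients on a cell are controlled by the values on the cell. -/
theorem exists_sum_coeff_le_cell (d k : ℕ) : ∃ C : ℝ, 0 ≤ C ∧ ∀ s : Finset (𝔼 d), IsCell s →
    ∀ Q : MvPolynomial (𝔼 d) ℝ, Q.IsHomogeneous k → Q ∈ supported ℝ (s : Set (𝔼 d)) → ∀ M : ℝ,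
      (∀ x ∈ convexHull ℝ (s : Set (𝔼 d)), |eval (baryCoord s x) Q| ≤ M) →
        ∑ a ∈ Q.support, |Q.coeff a| ≤ C * M := by
  classical
  obtain ⟨C, hC0, hC⟩ := exists_sum_coeff_le_stdSimplex d k
  refine ⟨C, hC0, fun s hs Q hQ hQs M hM => ?_⟩
  -- Enumerating the vertices transfers the problem to the standard simplex, so the constant does
  -- not depend on the shape or size of the cell.
  set e : Fin (d + 1) ≃ s := (s.equivFinOfCardEq hs.card_eq).symm with he
  set f : Fin (d + 1) → 𝔼 d := fun i => e i with hf
  have hfi : Function.Injective f := Subtype.val_injective.comp e.injective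
  have hfr : Set.range f = s := by
    ext v
    constructor
    · rintro ⟨i, rfl⟩
      exact (e i).2
    · intro hv
      exact ⟨e.symm ⟨v, hv⟩, by simp [hf]⟩
  obtain ⟨Q', rfl⟩ := exists_rename_eq_of_vars_subset_range Q f hfi (by
    rw [hfr]; exact mem_supported.1 hQs)
  have hQ' : Q'.IsHomogeneous k := (IsHomogeneous.rename_isHomogeneous_iff hfi).1 hQ
  have hsum : ∀ {M : Type} [AddCommMonoid M] (g : (𝔼 d) → M), ∑ v ∈ s, g v = ∑ i, g (f i) := by
    intro M _ g
    rw [← Finset.sum_coe_sort s g]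
    exact (Equiv.sum_comp e (fun v : s => g v)).symm
  have h1 := hC Q' hQ' M fun w hw => by
    set w' : (𝔼 d) → ℝ := fun v => if h : v ∈ s then w (e.symm ⟨v, h⟩) else 0 with hw'
    have hwf : ∀ i, w' (f i) = w i := by
      intro i
      have : f i ∈ s := (e i).2
      simp [hw', hf]
    have h2 : ∑ v ∈ s, w' v = 1 := by
      rw [hsum]
      simp only [hwf]
      exact hw.2
    have h3 := hs.baryCoord_eq_of_subset subset_rfl h2 fun v hv => dif_neg hv
    have h4 := hM (∑ u ∈ s, w' u • u) (by
      rw [Finset.mem_convexHull']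
      refine ⟨w', fun v hv => ?_, h2, rfl⟩
      simp only [hw', hv, dite_true]
      exact hw.1 _)
    rw [h3, eval_rename] at h4
    have h5 : w' ∘ f = w := funext hwf
    rwa [h5] at h4
  rw [support_rename_of_injective hfi, Finset.sum_image fun a _ b _ h => Finsupp.mapDomain_injective hfi h]
  simpa only [coeff_rename_mapDomain f hfi] using h1

end Bernstein

/-! ### Cells and gluing -/

namespace IsCell

variable {s : Finset (𝔼 d)}

theorem openSimplex_nonempty (hs : IsCell s) : (openSimplex s).Nonempty := by
  have htop : affineSpan ℝ (s : Set (𝔼 d)) = ⊤ := by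
    have := hs.affineIndependent.affineSpan_eq_top_iff_card_eq_finrank_add_one.2
      (by simp [hs.card_eq])
    simpa using this
  exact interior_convexHull_nonempty_iff_affineSpan_eq_top.2 htop

theorem closure_openSimplex (hs : IsCell s) :
    closure (openSimplex s) = convexHull ℝ (s : Set (𝔼 d)) := by
  rw [openSimplex, (convex_convexHull ℝ _).closure_interior_eq_closure_of_nonempty_interior
    hs.openSimplex_nonempty]
  exact (s.finite_toSet.isCompact_convexHull (𝕜 := ℝ)).isClosed.closure_eq

end IsCell

theorem openSimplex_subset (s : Finset (𝔼 d)) : openSimplex s ⊆ convexHull ℝ (s : Set (𝔼 d)) :=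
  interior_subset

theorem isCompact_cell (s : Finset (𝔼 d)) : IsCompact (convexHull ℝ (s : Set (𝔼 d))) :=
  s.finite_toSet.isCompact_convexHull (𝕜 := ℝ)

namespace Triangulation

variable (T : Triangulation Ω)

theorem isCell {s : Finset (𝔼 d)} (hs : s ∈ T.cells) : IsCell s :=
  ⟨T.card_eq s hs, T.affineIndependent s hs⟩

theorem exists_cell {x : 𝔼 d} (hx : x ∈ Ω) : ∃ s ∈ T.cells, x ∈ convexHull ℝ (s : Set (𝔼 d)) := by
  have : x ∈ closure Ω := subset_closure hx
  rw [← T.cover] at this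
  simpa using this

theorem eventually_mem (x : 𝔼 d) : ∀ᶠ y in 𝓝 x, ∀ s ∈ T.cells,
    y ∈ convexHull ℝ (s : Set (𝔼 d)) → x ∈ convexHull ℝ (s : Set (𝔼 d)) := by
  rw [Filter.eventually_all_finset]
  intro s _
  by_cases h : x ∈ convexHull ℝ (s : Set (𝔼 d))
  · exact Eventually.of_forall fun _ _ => h
  · filter_upwards [(isCompact_cell s).isClosed.isOpen_compl.mem_nhds h] with y hy h2
    exact absurd h2 hy

theorem ae_mem_openSimplex (hΩ : IsOpen Ω) :
    ∀ᵐ x ∂(volume.restrict Ω), ∃ s ∈ T.cells, x ∈ openSimplex s := by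
  have h1 : ∀ᵐ x ∂(volume : Measure (𝔼 d)), ∀ s ∈ T.cells,
      x ∉ frontier (convexHull ℝ (s : Set (𝔼 d))) := by
    rw [Filter.eventually_all_finset]
    intro s _
    exact measure_eq_zero_iff_ae_notMem.1 ((convex_convexHull ℝ _).addHaar_frontier volume)
  filter_upwards [ae_restrict_of_ae h1, ae_restrict_mem hΩ.measurableSet] with x hx hxΩ
  obtain ⟨s, hs, hxs⟩ := T.exists_cell hxΩ
  refine ⟨s, hs, ?_⟩
  by_contra h
  exact hx s hs ⟨subset_closure hxs, h⟩

open MvPolynomial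

/-- A point close to `x` lies in a cell that also contains `x`, so its increment is controlled by
the polynomial of that single cell. Continuous induction passes to whole segments in Ω. -/
theorem segLip_of_polynomial {V : (𝔼 d) → ℝ} {q : Finset (𝔼 d) → MvPolynomial (Fin d) ℝ}
    (hV : ∀ s ∈ T.cells, ∀ x ∈ Ω, x ∈ convexHull ℝ (s : Set (𝔼 d)) →
      V x = eval (fun i => x i) (q s)) (hΩ : IsOpen Ω) :
    ∃ L : ℝ, 0 ≤ L ∧ SegLip Ω L V := by
  have h1 : ∀ s : Finset (𝔼 d), ∃ K : NNReal,
      LipschitzOnWith K (fun x : 𝔼 d => eval (fun i => x i) (q s)) (convexHull ℝ (s : Set (𝔼 d))) :=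
    fun s => (((contDiff_eval_euclidean (q s)).of_le (by simp)).locallyLipschitz.locallyLipschitzOn
      ).exists_lipschitzOnWith_of_compact (isCompact_cell s)
  choose K hK using h1
  refine ⟨∑ s ∈ T.cells, (K s : ℝ), Finset.sum_nonneg fun _ _ => NNReal.coe_nonneg _,
    segLip_of_eventually fun x hx => ?_⟩
  filter_upwards [T.eventually_mem x, hΩ.mem_nhds hx] with y hy hyΩ
  obtain ⟨s, hs, hys⟩ := T.exists_cell hyΩ
  rw [hV s hs y hyΩ hys, hV s hs x hx (hy s hs hys), ← Real.dist_eq]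
  refine ((hK s).dist_le_mul y hys x (hy s hs hys)).trans ?_
  gcongr
  exact Finset.single_le_sum (f := fun s => (K s : ℝ)) (fun _ _ => NNReal.coe_nonneg _) hs

/-- Polynomials on the cells that agree on common points in `Ω` define a finite element function. -/
theorem exists_glue (hΩ : IsOpen Ω) {k : ℕ} {q : Finset (𝔼 d) → MvPolynomial (Fin d) ℝ}
    (hq : ∀ s ∈ T.cells, (q s).totalDegree ≤ k)
    (hc : ∀ s ∈ T.cells, ∀ t ∈ T.cells, ∀ x ∈ Ω, x ∈ convexHull ℝ (s : Set (𝔼 d)) →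
      x ∈ convexHull ℝ (t : Set (𝔼 d)) → eval (fun i => x i) (q s) = eval (fun i => x i) (q t)) :
    ∃ V : (𝔼 d) → ℝ, MemFESpace T k V ∧ ∀ s ∈ T.cells, ∀ x ∈ Ω,
      x ∈ convexHull ℝ (s : Set (𝔼 d)) → V x = eval (fun i => x i) (q s) := by
  classical
  set V : (𝔼 d) → ℝ := fun x => if h : ∃ s ∈ T.cells, x ∈ convexHull ℝ (s : Set (𝔼 d)) then
    eval (fun i => x i) (q h.choose) else 0 with hVdef
  have hV : ∀ s ∈ T.cells, ∀ x ∈ Ω, x ∈ convexHull ℝ (s : Set (𝔼 d)) →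
      V x = eval (fun i => x i) (q s) := by
    intro s hs x hx hxs
    have h : ∃ s ∈ T.cells, x ∈ convexHull ℝ (s : Set (𝔼 d)) := ⟨s, hs, hxs⟩
    rw [hVdef]
    simp only [dif_pos h]
    exact hc _ h.choose_spec.1 s hs x hx h.choose_spec.2 hxs
  obtain ⟨L, hL, hVL⟩ := T.segLip_of_polynomial hV hΩ
  exact ⟨V, ⟨hVL.continuousOn hΩ hL, fun s hs => ⟨q s, hq s hs, fun x hx =>
    hV s hs x (T.subset s hs hx) (openSimplex_subset s hx)⟩⟩, hV⟩

end Triangulation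

namespace MemFESpace

open MvPolynomial

variable {T : Triangulation Ω} {k : ℕ} {V W : (𝔼 d) → ℝ}

/-- Continuity extends the polynomial formula from the open cell to those boundary points of the
cell that lie in Ω. On parts of the boundary outside Ω, such as a slit, nothing is prescribed. -/
theorem exists_polynomial (hV : MemFESpace T k V) : ∃ q : Finset (𝔼 d) → MvPolynomial (Fin d) ℝ,
    (∀ s ∈ T.cells, (q s).totalDegree ≤ k) ∧ ∀ s ∈ T.cells, ∀ x ∈ Ω,
      x ∈ convexHull ℝ (s : Set (𝔼 d)) → V x = eval (fun i => x i) (q s) := by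
  choose! q hq1 hq2 using hV.polynomial
  refine ⟨q, hq1, fun s hs x hx hxs => ?_⟩
  have hcl : x ∈ closure (openSimplex s) := by rwa [(T.isCell hs).closure_openSimplex]
  have : (𝓝[openSimplex s] x).NeBot := mem_closure_iff_nhdsWithin_neBot.1 hcl
  have h1 : Tendsto V (𝓝[openSimplex s] x) (𝓝 (V x)) :=
    (hV.continuousOn x hx).mono_left (nhdsWithin_mono _ (T.subset s hs))
  have h2 : Tendsto (fun x : 𝔼 d => eval (fun i => x i) (q s)) (𝓝[openSimplex s] x)
      (𝓝 (eval (fun i => x i) (q s))) :=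
    ((continuous_eval_euclidean (q s)).tendsto x).mono_left nhdsWithin_le_nhds
  refine tendsto_nhds_unique (h1.congr' ?_) h2
  filter_upwards [self_mem_nhdsWithin] with y hy using hq2 s hs y hy

theorem exists_segLip (hΩ : IsOpen Ω) (hV : MemFESpace T k V) :
    ∃ L : ℝ, 0 ≤ L ∧ SegLip Ω L V := by
  obtain ⟨q, -, hq⟩ := hV.exists_polynomial
  exact T.segLip_of_polynomial hq hΩ

theorem exists_bound (hV : MemFESpace T k V) : ∃ B : ℝ, 0 ≤ B ∧ ∀ x ∈ Ω, |V x| ≤ B := by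
  obtain ⟨q, -, hq⟩ := hV.exists_polynomial
  have h1 : ∀ s : Finset (𝔼 d), ∃ B : ℝ, ∀ x ∈ convexHull ℝ (s : Set (𝔼 d)),
      |eval (fun i => x i) (q s)| ≤ B := fun s =>
    (isCompact_cell s).exists_bound_of_continuousOn (continuous_eval_euclidean (q s)).continuousOn
  choose B hB using h1
  refine ⟨∑ s ∈ T.cells, |B s|, Finset.sum_nonneg fun _ _ => abs_nonneg _, fun x hx => ?_⟩
  obtain ⟨s, hs, hxs⟩ := T.exists_cell hx
  rw [hq s hs x hx hxs]
  exact ((hB s x hxs).trans (le_abs_self _)).trans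
    (Finset.single_le_sum (f := fun s => |B s|) (fun _ _ => abs_nonneg _) hs)

theorem sub (hV : MemFESpace T k V) (hW : MemFESpace T k W) :
    MemFESpace T k fun x => V x - W x := by
  refine ⟨hV.continuousOn.sub hW.continuousOn, fun s hs => ?_⟩
  obtain ⟨q, hq, h1⟩ := hV.polynomial s hs
  obtain ⟨r, hr, h2⟩ := hW.polynomial s hs
  refine ⟨q - r, (totalDegree_sub _ _).trans (max_le hq hr), fun x hx => ?_⟩
  rw [h1 x hx, h2 x hx, map_sub]

theorem add (hV : MemFESpace T k V) (hW : MemFESpace T k W) :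
    MemFESpace T k fun x => V x + W x := by
  refine ⟨hV.continuousOn.add hW.continuousOn, fun s hs => ?_⟩
  obtain ⟨q, hq, h1⟩ := hV.polynomial s hs
  obtain ⟨r, hr, h2⟩ := hW.polynomial s hs
  refine ⟨q + r, (totalDegree_add _ _).trans (max_le hq hr), fun x hx => ?_⟩
  rw [h1 x hx, h2 x hx, map_add]

theorem mono {l : ℕ} (hV : MemFESpace T k V) (hkl : k ≤ l) : MemFESpace T l V :=
  ⟨hV.continuousOn, fun s hs => by
    obtain ⟨q, hq, h⟩ := hV.polynomial s hs
    exact ⟨q, hq.trans hkl, h⟩⟩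

end MemFESpace

/-! ### Modulation of finite element functions -/

section Modulation

open MvPolynomial

/-- The point of a simplex attached to a multi-index of degree `k`. -/
def bernsteinNode (k : ℕ) (a : (𝔼 d) →₀ ℕ) : 𝔼 d := ∑ v ∈ a.support, ((a v : ℝ) / k) • v

/-- Multiply the Bernstein coefficients by the values of `χ` at the nodes. -/
def modulate (k : ℕ) (χ : (𝔼 d) → ℝ) (Q : MvPolynomial (𝔼 d) ℝ) : MvPolynomial (𝔼 d) ℝ :=
  ∑ a ∈ Q.support, monomial a (χ (bernsteinNode k a) * Q.coeff a)

theorem eval_modulate (k : ℕ) (χ : (𝔼 d) → ℝ) (Q : MvPolynomial (𝔼 d) ℝ) (w : (𝔼 d) → ℝ) :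
    eval w (modulate k χ Q) = ∑ a ∈ Q.support,
      χ (bernsteinNode k a) * Q.coeff a * ∏ v ∈ a.support, w v ^ a v := by
  simp only [modulate, map_sum, eval_monomial, Finsupp.prod]

theorem totalDegree_modulate_le {k : ℕ} (χ : (𝔼 d) → ℝ) {Q : MvPolynomial (𝔼 d) ℝ}
    (hQ : Q.IsHomogeneous k) : (modulate k χ Q).totalDegree ≤ k := by
  refine totalDegree_finsetSum_le fun a ha => (totalDegree_monomial_le _ _).trans ?_
  exact (le_totalDegree ha).trans hQ.totalDegree_le

theorem MvPolynomial.IsHomogeneous.sum_eq {σ : Type*} {k : ℕ} {Q : MvPolynomial σ ℝ}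
    (hQ : Q.IsHomogeneous k) {a : σ →₀ ℕ} (ha : a ∈ Q.support) : ∑ v ∈ a.support, a v = k := by
  by_contra h
  exact (mem_support_iff.1 ha) (hQ.coeff_eq_zero h)

theorem support_subset_of_mem_supported {Q : MvPolynomial (𝔼 d) ℝ} {s : Finset (𝔼 d)}
    (hQ : Q ∈ supported ℝ (s : Set (𝔼 d))) {a : (𝔼 d) →₀ ℕ} (ha : a ∈ Q.support) :
    a.support ⊆ s := by
  classical
  intro v hv
  have := mem_supported.1 hQ
  exact_mod_cast this (by
    rw [Finset.mem_coe, mem_vars_iff_mem_support]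
    exact ⟨a, ha, hv⟩)

theorem bernsteinNode_mem {k : ℕ} (hk : 1 ≤ k) {a : (𝔼 d) →₀ ℕ} {s : Finset (𝔼 d)}
    (has : a.support ⊆ s) (hak : ∑ v ∈ a.support, a v = k) :
    bernsteinNode k a ∈ convexHull ℝ (s : Set (𝔼 d)) := by
  have hk0 : (k : ℝ) ≠ 0 := by positivity
  refine (convex_convexHull ℝ _).sum_mem (fun v _ => by positivity) ?_ fun v hv =>
    subset_convexHull ℝ _ (has hv)
  rw [← Finset.sum_div, div_eq_one_iff_eq hk0]
  exact_mod_cast hak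

/-- Bernstein coefficients on a common face are determined by the values on the part of that face
in an open set. -/
theorem coeff_eq_of_face [DecidableEq (𝔼 d)] (hΩ : IsOpen Ω) {s t : Finset (𝔼 d)} (hs : IsCell s)
    (ht : IsCell t) {k : ℕ}
    {Q R : MvPolynomial (𝔼 d) ℝ} (hQ : Q.IsHomogeneous k) (hR : R.IsHomogeneous k)
    (hne : ∃ x ∈ Ω, x ∈ convexHull ℝ ((s ∩ t : Finset (𝔼 d)) : Set (𝔼 d)))
    (heq : ∀ x ∈ Ω, x ∈ convexHull ℝ ((s ∩ t : Finset (𝔼 d)) : Set (𝔼 d)) →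
      eval (baryCoord s x) Q = eval (baryCoord t x) R)
    {a : (𝔼 d) →₀ ℕ} (ha : a.support ⊆ s ∩ t) : Q.coeff a = R.coeff a := by
  set F := s ∩ t with hF
  obtain ⟨x₀, hx₀Ω, hx₀⟩ := hne
  obtain ⟨w₀, hw₀, hw₀F, hw₀1, rfl⟩ := IsCell.exists_weights_of_mem_convexHull hx₀
  have hFne : F.Nonempty := by
    rw [Finset.nonempty_iff_ne_empty]
    intro h
    simp [h] at hw₀1
  have : Nonempty F := hFne.to_subtype
  have hfi : Function.Injective ((↑) : F → 𝔼 d) := Subtype.val_injective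
  set D := Q - R with hD
  have hDh : D.IsHomogeneous k := hQ.sub hR
  set ρ : (F → ℝ) → (𝔼 d) → ℝ := fun w v => if h : v ∈ F then w ⟨v, h⟩ else 0 with hρ
  have hρe : ∀ w, eval w (killCompl hfi D) = eval (ρ w) D := by
    intro w
    rw [killCompl, aeval_def, eval_eval₂]
    congr 1
    · ext; simp
    · ext v
      simp only [hρ]
      by_cases h : v ∈ F
      · have h' : v ∈ Set.range ((↑) : F → 𝔼 d) := ⟨⟨v, h⟩, rfl⟩
        rw [dif_pos h', dif_pos h, eval_X]
        congr 1
        rw [Equiv.symm_apply_eq]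
        rfl
      · have h' : v ∉ Set.range ((↑) : F → 𝔼 d) := by simpa using h
        rw [dif_neg h', dif_neg h, map_zero]
  -- The cone, in unnormalised positive weights, over the part of the face lying in Ω. Homogeneity
  -- spreads the equality on the face over this open set, where the identity theorem applies.
  set U : Set (F → ℝ) := {w | ∀ v, 0 < w v} ∩
    (fun w : F → ℝ => (∑ v, w v)⁻¹ • ∑ v : F, w v • (v : 𝔼 d)) ⁻¹' Ω with hU
  have hpos : IsOpen {w : F → ℝ | ∀ v, 0 < w v} := by
    simp only [Set.ofPred_forall]
    exact isOpen_iInter_of_finite fun i => isOpen_lt continuous_const (continuous_apply i)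
  have hsumpos : ∀ w ∈ {w : F → ℝ | ∀ v, 0 < w v}, 0 < ∑ v, w v := fun w hw =>
    Finset.sum_pos (fun i _ => hw i) Finset.univ_nonempty
  have hUo : IsOpen U := by
    refine ContinuousOn.isOpen_inter_preimage ?_ hpos hΩ
    refine ContinuousOn.smul (ContinuousOn.inv₀ (by fun_prop) fun w hw => (hsumpos w hw).ne') ?_
    fun_prop
  have hsumF : ∀ {M : Type} [AddCommMonoid M] (g : (𝔼 d) → M), ∑ v ∈ F, g v = ∑ v : F, g v :=
    fun g => (Finset.sum_coe_sort F g).symm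
  have hUne : U.Nonempty := by
    have hcard : (0 : ℝ) < F.card := by exact_mod_cast hFne.card_pos
    set c : F → ℝ := fun _ => (F.card : ℝ)⁻¹ with hc
    have hc1 : ∑ v, c v = 1 := by
      simp [hc, hcard.ne']
    have hw1 : ∑ v : F, w₀ v = 1 := by rw [← hw₀1, hsumF]
    -- The given point may have zero weights. A small move towards the barycentre of the face makes
    -- all weights positive and stays in the open set Ω.
    have hcont : Tendsto (fun ε : ℝ => ∑ v : F, ((1 - ε) * w₀ v + ε * c v) • (v : 𝔼 d)) (𝓝[>] 0)
        (𝓝 (∑ v ∈ F, w₀ v • v)) := by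
      have h1 : Continuous fun ε : ℝ => ∑ v : F, ((1 - ε) * w₀ v + ε * c v) • (v : 𝔼 d) := by fun_prop
      have h2 := (h1.tendsto 0).mono_left (nhdsWithin_le_nhds (s := Set.Ioi 0))
      simp only [sub_zero, one_mul, zero_mul, add_zero] at h2
      rwa [hsumF]
    have e2 : ∀ᶠ ε in 𝓝[>] (0 : ℝ), 0 < ε := self_mem_nhdsWithin
    have e3 : ∀ᶠ ε in 𝓝[>] (0 : ℝ), ε < 1 := mem_nhdsWithin_of_mem_nhds (Iio_mem_nhds one_pos)
    obtain ⟨ε, h1, h2, h3⟩ := ((hcont.eventually (hΩ.mem_nhds hx₀Ω)).and (e2.and e3)).exists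
    refine ⟨fun v => (1 - ε) * w₀ v + ε * c v, fun v => ?_, ?_⟩
    · have h4 : 0 < ε * c v := mul_pos h2 (by simpa [hc] using hcard)
      have h5 : 0 ≤ (1 - ε) * w₀ v := mul_nonneg (by linarith) (hw₀ v)
      linarith
    · have h4 : ∑ v : F, ((1 - ε) * w₀ v + ε * c v) = 1 := by
        rw [Finset.sum_add_distrib, ← Finset.mul_sum, ← Finset.mul_sum, hw1, hc1]; ring
      simp only [Set.mem_preimage, h4, inv_one, one_smul]
      exact h1
  have hzero : killCompl hfi D = 0 := by
    refine MvPolynomial.eq_zero_of_isOpen hUo hUne fun w hw => ?_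
    have hs0 := hsumpos w hw.1
    set S := ∑ v, w v with hS
    set w' : (𝔼 d) → ℝ := fun v => S⁻¹ * ρ w v with hw'
    have hρw : ∀ v : F, ρ w v = w v := fun v => by simp [hρ]
    have h1 : ∑ v ∈ F, w' v = 1 := by
      rw [hsumF]
      simp only [hw', hρw]
      rw [← Finset.mul_sum, inv_mul_cancel₀ hs0.ne']
    have h2 : ∀ v ∉ F, w' v = 0 := fun v hv => by simp [hw', hρ, hv]
    have h3 : ∑ v ∈ F, w' v • v ∈ Ω := by
      have := hw.2
      rw [hsumF]
      simp only [hw', hρw, mul_smul, ← Finset.smul_sum]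
      exact this
    have h4 : ∑ v ∈ F, w' v • v ∈ convexHull ℝ (F : Set (𝔼 d)) := by
      rw [Finset.mem_convexHull']
      refine ⟨w', fun v hv => ?_, h1, rfl⟩
      have := (hw.1 ⟨v, hv⟩).le
      simp only [hw', hρ, hv, dite_true]
      positivity
    have h5 := heq _ h3 h4
    rw [hs.baryCoord_eq_of_subset Finset.inter_subset_left h1 h2,
      ht.baryCoord_eq_of_subset Finset.inter_subset_right h1 h2] at h5
    have h6 : eval w' D = 0 := by rw [hD, map_sub, h5, sub_self]
    rw [hw', hDh.eval_smul] at h6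
    rw [hρe]
    rcases mul_eq_zero.1 h6 with h7 | h7
    · exact absurd h7 (by positivity)
    · exact h7
  -- Setting the variables off the face to zero leaves untouched exactly the coefficients of
  -- multi-indices supported on the face.
  have h1 := coeff_killCompl hfi (p := D) (s := a.comapDomain (↑) hfi.injOn)
  rw [hzero, Finsupp.mapDomain_comapDomain _ hfi _ (by
    intro v hv
    exact ⟨⟨v, ha hv⟩, rfl⟩)] at h1
  rw [hD, coeff_sub, coeff_zero] at h1
  linarith

end Modulation

/-! ### Weights on Bernstein coefficients across the mesh -/

section Modulation

open MvPolynomial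

theorem Triangulation.mem_face [DecidableEq (𝔼 d)] (T : Triangulation Ω) {s t : Finset (𝔼 d)}
    (hs : s ∈ T.cells) (ht : t ∈ T.cells) {x : 𝔼 d} (hxs : x ∈ convexHull ℝ (s : Set (𝔼 d)))
    (hxt : x ∈ convexHull ℝ (t : Set (𝔼 d))) :
    x ∈ convexHull ℝ ((s ∩ t : Finset (𝔼 d)) : Set (𝔼 d)) := by
  rw [Finset.coe_inter, ← T.conforming s hs t ht]
  exact ⟨hxs, hxt⟩

theorem Triangulation.baryCoord_eq_baryCoord [DecidableEq (𝔼 d)] (T : Triangulation Ω)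
    {s t : Finset (𝔼 d)} (hs : s ∈ T.cells) (ht : t ∈ T.cells) {x : 𝔼 d}
    (hxs : x ∈ convexHull ℝ (s : Set (𝔼 d))) (hxt : x ∈ convexHull ℝ (t : Set (𝔼 d))) :
    baryCoord s x = baryCoord t x ∧ ∀ v ∉ s ∩ t, baryCoord s x v = 0 := by
  obtain ⟨w, -, hw2, hw3, rfl⟩ := IsCell.exists_weights_of_mem_convexHull (T.mem_face hs ht hxs hxt)
  rw [(T.isCell hs).baryCoord_eq_of_subset Finset.inter_subset_left hw3 hw2,
    (T.isCell ht).baryCoord_eq_of_subset Finset.inter_subset_right hw3 hw2]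
  exact ⟨rfl, hw2⟩

/-- On a face, monomials involving another vertex contain a vanishing coordinate. So the sum can be
taken over an index set `S` common to both neighbouring cells. -/
theorem eval_modulate_of_subset {k : ℕ} (χ : (𝔼 d) → ℝ) {Q : MvPolynomial (𝔼 d) ℝ}
    {F : Finset (𝔼 d)} {S : Finset ((𝔼 d) →₀ ℕ)} (hS : ∀ a ∈ Q.support, a.support ⊆ F → a ∈ S)
    {w : (𝔼 d) → ℝ} (hw : ∀ v ∉ F, w v = 0) :
    eval w (modulate k χ Q) = ∑ a ∈ S,
      χ (bernsteinNode k a) * Q.coeff a * ∏ v ∈ a.support, w v ^ a v := by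
  classical
  rw [eval_modulate]
  have h1 : ∀ a ∈ Q.support, a ∉ S →
      χ (bernsteinNode k a) * Q.coeff a * ∏ v ∈ a.support, w v ^ a v = 0 := by
    intro a ha haS
    have h2 : ¬ a.support ⊆ F := fun h => haS (hS a ha h)
    obtain ⟨v, hv, hvF⟩ := Finset.not_subset.1 h2
    rw [Finset.prod_eq_zero hv, mul_zero]
    rw [hw v hvF, zero_pow (Finsupp.mem_support_iff.1 hv)]
  have h2 : ∀ a ∈ S, a ∉ Q.support →
      χ (bernsteinNode k a) * Q.coeff a * ∏ v ∈ a.support, w v ^ a v = 0 := by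
    intro a _ ha
    rw [notMem_support_iff.1 ha, mul_zero, zero_mul]
  rw [← Finset.sum_subset (Finset.inter_subset_left (s₁ := Q.support) (s₂ := S)),
    ← Finset.sum_subset (Finset.inter_subset_right (s₁ := Q.support) (s₂ := S))]
  · intro a ha ha'
    exact h2 a ha fun h => ha' (Finset.mem_inter.2 ⟨h, ha⟩)
  · intro a ha ha'
    exact h1 a ha fun h => ha' (Finset.mem_inter.2 ⟨ha, h⟩)

/-- A finite element function multiplied by `χ`, on the level of Bernstein coefficients. -/
theorem exists_modulation_const (d : ℕ) {k : ℕ} (hk : 1 ≤ k) : ∃ C : ℝ, 0 ≤ C ∧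
    ∀ {Ω : Set (𝔼 d)}, IsOpen Ω → ∀ (T : Triangulation Ω) {V : (𝔼 d) → ℝ}, MemFESpace T k V →
      ∀ χ : (𝔼 d) → ℝ, ∃ W, MemFESpace T k W ∧ ∀ s ∈ T.cells, ∀ c η M : ℝ,
        (∀ z ∈ convexHull ℝ (s : Set (𝔼 d)), |χ z - c| ≤ η) →
        (∀ x ∈ openSimplex s, |V x| ≤ M) →
        ∀ x ∈ openSimplex s, |W x - c * V x| ≤ C * η * M := by
  classical
  obtain ⟨C, hC0, hC⟩ := exists_sum_coeff_le_cell d k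
  refine ⟨C, hC0, fun {Ω} hΩ T {V} hV χ => ?_⟩
  obtain ⟨q, hqk, hq⟩ := hV.exists_polynomial
  have h1 : ∀ s ∈ T.cells, ∃ Q : MvPolynomial (𝔼 d) ℝ, Q.IsHomogeneous k ∧
      Q ∈ supported ℝ (s : Set (𝔼 d)) ∧
      ∀ x : 𝔼 d, eval (baryCoord s x) Q = eval (fun i => x i) (q s) :=
    fun s hs => (T.isCell hs).exists_bernstein (hqk s hs)
  choose! Q hQh hQs hQe using h1
  have heval : ∀ (s : Finset (𝔼 d)) (R : MvPolynomial (𝔼 d) ℝ) (x : 𝔼 d),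
      eval (fun i => x i) (aeval (bary s) R) = eval (baryCoord s x) R := by
    intro s R x
    rw [aeval_def, eval_eval₂]
    congr 1
    ext; simp
  -- The pieces match because a node depends only on its multi-index, not on the cell, and
  -- neighbouring cells have the same Bernstein coefficients on their common face.
  obtain ⟨W, hW, hWe⟩ := T.exists_glue hΩ (k := k)
    (q := fun s => aeval (bary s) (modulate k χ (Q s)))
    (fun s hs => (totalDegree_aeval_le_of_le_one _ (T.isCell hs).bary_spec.1 _).trans
      (totalDegree_modulate_le χ (hQh s hs))) (by
    intro s hs t ht x hx hxs hxt
    obtain ⟨hst, h0⟩ := T.baryCoord_eq_baryCoord hs ht hxs hxt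
    rw [heval, heval, ← hst]
    set S := ((Q s).support ∪ (Q t).support).filter fun a => a.support ⊆ s ∩ t with hS
    rw [eval_modulate_of_subset (S := S) χ (fun a ha haF => Finset.mem_filter.2
        ⟨Finset.mem_union_left _ ha, haF⟩) h0,
      eval_modulate_of_subset (S := S) χ (fun a ha haF => Finset.mem_filter.2
        ⟨Finset.mem_union_right _ ha, haF⟩) h0]
    refine Finset.sum_congr rfl fun a ha => ?_
    rw [coeff_eq_of_face hΩ (T.isCell hs) (T.isCell ht) (hQh s hs) (hQh t ht)
      ⟨x, hx, T.mem_face hs ht hxs hxt⟩ (fun y hy hyF => ?_) (Finset.mem_filter.1 ha).2]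
    have hys := convexHull_mono (Finset.coe_subset.2 Finset.inter_subset_left) hyF
    have hyt := convexHull_mono (Finset.coe_subset.2 Finset.inter_subset_right) hyF
    rw [hQe s hs, hQe t ht, ← hq s hs y hy hys, ← hq t ht y hy hyt])
  refine ⟨W, hW, fun s hs c η M hχ hM x hx => ?_⟩
  have hxΩ := T.subset s hs hx
  have hxs := openSimplex_subset s hx
  have hcell := T.isCell hs
  have hMcl : ∀ y ∈ convexHull ℝ (s : Set (𝔼 d)), |eval (baryCoord s y) (Q s)| ≤ M := by
    rw [← hcell.closure_openSimplex]
    have hcl : IsClosed {y : 𝔼 d | |eval (fun i => y i) (q s)| ≤ M} :=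
      isClosed_le (continuous_eval_euclidean _).abs continuous_const
    intro y hy
    rw [hQe s hs]
    refine closure_minimal (fun z hz => ?_) hcl hy
    have := hM z hz
    rwa [hq s hs z (T.subset s hs hz) (openSimplex_subset s hz)] at this
  have hη : 0 ≤ η := (abs_nonneg _).trans (hχ x hxs)
  have hsum := hC s hcell (Q s) (hQh s hs) (hQs s hs) M hMcl
  rw [hWe s hs x hxΩ hxs, hq s hs x hxΩ hxs, heval, ← hQe s hs, eval_modulate, eval_eq,
    Finset.mul_sum, ← Finset.sum_sub_distrib]
  refine (Finset.abs_sum_le_sum_abs _ _).trans ?_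
  calc ∑ a ∈ (Q s).support, |χ (bernsteinNode k a) * (Q s).coeff a *
          ∏ v ∈ a.support, baryCoord s x v ^ a v -
          c * ((Q s).coeff a * ∏ v ∈ a.support, baryCoord s x v ^ a v)|
      ≤ ∑ a ∈ (Q s).support, η * |(Q s).coeff a| := by
        refine Finset.sum_le_sum fun a ha => ?_
        have e : χ (bernsteinNode k a) * (Q s).coeff a *
            ∏ v ∈ a.support, baryCoord s x v ^ a v -
            c * ((Q s).coeff a * ∏ v ∈ a.support, baryCoord s x v ^ a v) =
            (χ (bernsteinNode k a) - c) * (Q s).coeff a *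
              ∏ v ∈ a.support, baryCoord s x v ^ a v := by ring
        rw [e, abs_mul, abs_mul]
        have h2 : |∏ v ∈ a.support, baryCoord s x v ^ a v| ≤ 1 := by
          rw [Finset.abs_prod]
          refine Finset.prod_le_one (fun _ _ => abs_nonneg _) fun v _ => ?_
          rw [abs_pow, abs_of_nonneg (hcell.baryCoord_nonneg hxs v)]
          exact pow_le_one₀ (hcell.baryCoord_nonneg hxs v) (hcell.baryCoord_le_one hxs v)
        have h3 := hχ _ (bernsteinNode_mem hk (support_subset_of_mem_supported (hQs s hs) ha)
          ((hQh s hs).sum_eq ha))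
        calc |χ (bernsteinNode k a) - c| * |(Q s).coeff a| *
              |∏ v ∈ a.support, baryCoord s x v ^ a v|
            ≤ |χ (bernsteinNode k a) - c| * |(Q s).coeff a| * 1 := by gcongr
          _ ≤ η * |(Q s).coeff a| := by rw [mul_one]; gcongr
    _ = η * ∑ a ∈ (Q s).support, |(Q s).coeff a| := by rw [Finset.mul_sum]
    _ ≤ η * (C * M) := by gcongr
    _ = C * η * M := by ring

end Modulation

/-! ### Continuous piecewise affine functions -/

section Nodal

open MvPolynomial

/-- Nodal values, one for each vertex of each cell, that agree on neighbouring cells define a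
continuous piecewise affine function. -/
theorem Triangulation.exists_nodal [DecidableEq (𝔼 d)] (T : Triangulation Ω) (hΩ : IsOpen Ω)
    (a : Finset (𝔼 d) → (𝔼 d) → ℝ)
    (ha : ∀ s ∈ T.cells, ∀ t ∈ T.cells, (∃ x ∈ Ω, x ∈ convexHull ℝ (s : Set (𝔼 d)) ∧
      x ∈ convexHull ℝ (t : Set (𝔼 d))) → ∀ v ∈ s ∩ t, a s v = a t v) :
    ∃ V, MemFESpace T 1 V ∧ ∀ s ∈ T.cells, ∀ x ∈ Ω, x ∈ convexHull ℝ (s : Set (𝔼 d)) →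
      V x = ∑ v ∈ s, baryCoord s x v * a s v := by
  have heval : ∀ (s : Finset (𝔼 d)) (x : 𝔼 d),
      eval (fun i => x i) (∑ v ∈ s, bary s v * C (a s v)) = ∑ v ∈ s, baryCoord s x v * a s v := by
    intro s x
    simp [baryCoord]
  obtain ⟨V, hV, hVe⟩ := T.exists_glue hΩ (k := 1) (q := fun s => ∑ v ∈ s, bary s v * C (a s v))
    (fun s hs => totalDegree_finsetSum_le fun v _ => (totalDegree_mul _ _).trans (by
      simpa using (T.isCell hs).bary_spec.1 v)) (by
    intro s hs t ht x hx hxs hxt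
    obtain ⟨hst, h0⟩ := T.baryCoord_eq_baryCoord hs ht hxs hxt
    rw [heval, heval, ← hst,
      ← Finset.sum_subset (Finset.inter_subset_left (s₁ := s) (s₂ := t)) fun v _ hv => by
        rw [h0 v hv, zero_mul],
      ← Finset.sum_subset (Finset.inter_subset_right (s₁ := s) (s₂ := t)) fun v _ hv => by
        rw [h0 v hv, zero_mul]]
    exact Finset.sum_congr rfl fun v hv => by rw [ha s hs t ht ⟨x, hx, hxs, hxt⟩ v hv])
  exact ⟨V, hV, fun s hs x hx hxs => (hVe s hs x hx hxs).trans (heval s x)⟩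

theorem IsCell.abs_sum_baryCoord_mul_le {s : Finset (𝔼 d)} (hs : IsCell s) {x : 𝔼 d}
    (hx : x ∈ convexHull ℝ (s : Set (𝔼 d))) {b : (𝔼 d) → ℝ} {ε : ℝ} (hb : ∀ v ∈ s, |b v| ≤ ε) :
    |∑ v ∈ s, baryCoord s x v * b v| ≤ ε := by
  refine (Finset.abs_sum_le_sum_abs _ _).trans ?_
  calc ∑ v ∈ s, |baryCoord s x v * b v| ≤ ∑ v ∈ s, baryCoord s x v * ε := by
        refine Finset.sum_le_sum fun v hv => ?_
        rw [abs_mul, abs_of_nonneg (hs.baryCoord_nonneg hx v)]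
        exact mul_le_mul_of_nonneg_left (hb v hv) (hs.baryCoord_nonneg hx v)
    _ = ε := by rw [← Finset.sum_mul, hs.bary_spec.2.2.1 x, one_mul]

end Nodal

/-! ### Regular meshes -/

/-- Every cell has diameter at most `h` and contains a ball of radius `κ * h`. -/
structure RegularMesh (T : Triangulation Ω) (κ h : ℝ) : Prop where
  pos : 0 < h
  dist_le : ∀ s ∈ T.cells, ∀ x ∈ convexHull ℝ (s : Set (𝔼 d)),
    ∀ y ∈ convexHull ℝ (s : Set (𝔼 d)), dist x y ≤ h
  exists_ball : ∀ s ∈ T.cells, ∃ x₀, Metric.closedBall x₀ (κ * h) ⊆ openSimplex s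

theorem exists_regularMesh (hΩ : Ω.Nonempty) {T : ℕ → Triangulation Ω} (hshape : ShapeRegular T)
    (hquasi : Quasiuniform T) : ∃ κ : ℝ, 0 < κ ∧ ∀ n, RegularMesh (T n) κ (T n).meshWidth := by
  obtain ⟨μ, hμ, hshape⟩ := hshape
  obtain ⟨C, hC, hquasi⟩ := hquasi
  -- The two mesh conditions give an inradius of at least μ h / C. The factor 2 makes the comparison
  -- strict, since the inradius is a supremum and a closed ball is wanted.
  refine ⟨μ / (2 * C), by positivity, fun n => ?_⟩
  obtain ⟨x, hx⟩ := hΩ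
  obtain ⟨s₀, hs₀, -⟩ := (T n).exists_cell hx
  have hne : Nonempty (T n).cells := ⟨⟨s₀, hs₀⟩⟩
  have hle : ∀ s ∈ (T n).cells, cellDiam s ≤ (T n).meshWidth := fun s hs =>
    le_ciSup (f := fun s : (T n).cells => cellDiam (s : Finset (𝔼 d)))
      (Set.finite_range _).bddAbove ⟨s, hs⟩
  have hge : ∀ s ∈ (T n).cells, (T n).meshWidth ≤ C * cellDiam s := fun s hs =>
    ciSup_le fun t => hquasi n t t.2 s hs
  have hpos : ∀ s ∈ (T n).cells, 0 < cellDiam s := by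
    intro s hs
    -- With the convention x / 0 = 0, a cell of zero diameter would have ratio 0, contradicting μ >
    -- 0.
    refine lt_of_le_of_ne Metric.diam_nonneg fun h => ?_
    have := hshape n s hs
    rw [← h, div_zero] at this
    linarith
  have hh : 0 < (T n).meshWidth := (hpos s₀ hs₀).trans_le (hle s₀ hs₀)
  refine ⟨hh, fun s hs x hx y hy => ?_, fun s hs => ?_⟩
  · refine (Metric.dist_le_diam_of_mem (isCompact_cell s).isBounded hx hy).trans ?_
    rw [← ((T n).isCell hs).closure_openSimplex, Metric.diam_closure]
    exact hle s hs
  · have h1 : μ * cellDiam s ≤ cellInradius s := (le_div_iff₀ (hpos s hs)).1 (hshape n s hs)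
    have h2 : μ / (2 * C) * (T n).meshWidth < cellInradius s := by
      have h3 : μ / (2 * C) * (T n).meshWidth ≤ μ / (2 * C) * (C * cellDiam s) := by
        gcongr; exact hge s hs
      have h4 : μ / (2 * C) * (C * cellDiam s) = μ * cellDiam s / 2 := by field_simp
      have h5 : 0 < μ * cellDiam s := mul_pos hμ (hpos s hs)
      linarith
    have hne' : {r : ℝ | 0 ≤ r ∧ ∃ x, Metric.ball x r ⊆ openSimplex s}.Nonempty :=
      ⟨0, le_rfl, 0, by simp⟩
    obtain ⟨r, ⟨-, x₀, hx₀⟩, hr⟩ := exists_lt_of_lt_csSup hne' h2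
    exact ⟨x₀, (Metric.closedBall_subset_ball hr).trans hx₀⟩

/-! ### Packing of cells around a vertex -/

namespace Triangulation

variable (T : Triangulation Ω)

/-- If the interiors met, the common face would have interior points, hence d + 1 vertices, and both
cells would equal it. -/
theorem disjoint_openSimplex {s t : Finset (𝔼 d)} (hs : s ∈ T.cells) (ht : t ∈ T.cells)
    (hst : s ≠ t) : Disjoint (openSimplex s) (openSimplex t) := by
  classical
  rw [Set.disjoint_iff_inter_eq_empty, openSimplex, openSimplex, ← interior_inter,
    T.conforming s hs t ht]
  by_contra hne
  have h1 := (interior_convexHull_nonempty_iff_affineSpan_eq_top).1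
    (Set.nonempty_iff_ne_empty.2 hne)
  rw [← Finset.coe_inter] at h1
  have hai : AffineIndependent ℝ ((↑) : (s ∩ t : Finset (𝔼 d)) → 𝔼 d) := by
    have := (T.affineIndependent s hs).mono (s := ((s ∩ t : Finset (𝔼 d)) : Set (𝔼 d)))
      (Finset.coe_subset.2 Finset.inter_subset_left)
    exact this
  have h2 := hai.affineSpan_eq_top_iff_card_eq_finrank_add_one.1 (by
    rw [Subtype.range_coe]; exact h1)
  simp only [Fintype.card_coe, finrank_euclideanSpace, Fintype.card_fin] at h2
  have h3 : s ∩ t = s := Finset.eq_of_subset_of_card_le Finset.inter_subset_left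
    (by rw [h2, T.card_eq s hs])
  have h4 : s ∩ t = t := Finset.eq_of_subset_of_card_le Finset.inter_subset_right
    (by rw [h2, T.card_eq t ht])
  exact hst (h3.symm.trans h4)

-- Volume packing: the cells at `z` have disjoint interiors, each contains a ball of radius κ h, and
-- all lie in the ball of radius h about `z`.
open Classical in
theorem card_filter_mem_le {κ h : ℝ} (hT : RegularMesh T κ h) (hκ : 0 < κ) (z : 𝔼 d) :
    ((T.cells.filter (z ∈ ·)).card : ℝ) ≤ (κ ^ d)⁻¹ := by
  set S := T.cells.filter (z ∈ ·) with hS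
  have hh := hT.pos
  have hvol : ∀ (x : 𝔼 d) (r : ℝ), 0 ≤ r →
      volume.real (Metric.closedBall x r) = r ^ d * volume.real (Metric.closedBall (0 : 𝔼 d) 1) := by
    intro x r hr
    rw [measureReal_def, measureReal_def, Measure.addHaar_closedBall' volume x hr,
      ENNReal.toReal_mul, ENNReal.toReal_ofReal (by positivity)]
    simp
  have h0 : 0 < volume.real (Metric.closedBall (0 : 𝔼 d) 1) :=
    ENNReal.toReal_pos (Metric.measure_closedBall_pos volume _ one_pos).ne'
      measure_closedBall_lt_top.ne
  have h1 : volume.real (⋃ s ∈ S, openSimplex s) = ∑ s ∈ S, volume.real (openSimplex s) := by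
    refine measureReal_biUnion_finset (fun s hs t ht hst => ?_)
      (fun s _ => isOpen_interior.measurableSet) fun s _ => ?_
    · exact T.disjoint_openSimplex (Finset.mem_filter.1 hs).1 (Finset.mem_filter.1 ht).1 hst
    · exact (measure_mono (openSimplex_subset s)).trans_lt (isCompact_cell s).measure_lt_top |>.ne
  have h2 : volume.real (⋃ s ∈ S, openSimplex s) ≤ volume.real (Metric.closedBall z h) := by
    refine measureReal_mono (Set.iUnion₂_subset fun s hs x hx => ?_) measure_closedBall_lt_top.ne
    rw [hS, Finset.mem_filter] at hs
    exact hT.dist_le s hs.1 x (openSimplex_subset s hx) z (subset_convexHull ℝ _ hs.2)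
  have h3 : ∑ s ∈ S, (κ * h) ^ d * volume.real (Metric.closedBall (0 : 𝔼 d) 1) ≤
      ∑ s ∈ S, volume.real (openSimplex s) := by
    refine Finset.sum_le_sum fun s hs => ?_
    obtain ⟨x₀, hx₀⟩ := hT.exists_ball s (Finset.mem_filter.1 hs).1
    rw [← hvol x₀ _ (by positivity)]
    exact measureReal_mono hx₀
      ((measure_mono (openSimplex_subset s)).trans_lt (isCompact_cell s).measure_lt_top).ne
  rw [← h1] at h3
  have h4 := h3.trans h2
  rw [hvol z h hh.le, Finset.sum_const, nsmul_eq_mul, ← mul_assoc] at h4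
  have h5 := le_of_mul_le_mul_right h4 h0
  rw [mul_pow, ← mul_assoc] at h5
  have h6 := le_of_mul_le_mul_right (h5.trans_eq (one_mul _).symm) (pow_pos hh d)
  rw [inv_eq_one_div, le_div_iff₀ (pow_pos hκ d)]
  exact h6

end Triangulation

/-- The segment from an interior point of a cell to `x` stays in the open cell until it reaches `x`,
hence in Ω. Between two boundary points it might run inside a face outside Ω; this is why
comparisons pass through interior points. -/
theorem SegLip.abs_sub_le_cell {T : Triangulation Ω} {κ h : ℝ} (hT : RegularMesh T κ h) {L : ℝ}
    (hL : 0 ≤ L) {f : (𝔼 d) → ℝ} (hf : SegLip Ω L f) {s : Finset (𝔼 d)} (hs : s ∈ T.cells)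
    {c x : 𝔼 d} (hc : c ∈ openSimplex s) (hx : x ∈ Ω) (hxs : x ∈ convexHull ℝ (s : Set (𝔼 d))) :
    |f c - f x| ≤ L * h := by
  refine (hf c x fun y hy => ?_).trans
    (mul_le_mul_of_nonneg_left (hT.dist_le s hs c (openSimplex_subset s hc) x hxs) hL)
  rw [← insert_endpoints_openSegment] at hy
  rcases hy with rfl | rfl | hy
  · exact T.subset s hs hc
  · exact hx
  · exact T.subset s hs ((convex_convexHull ℝ _).openSegment_interior_self_subset_interior hc hxs hy)

/-- The cells with vertex `z`; two of them are adjacent if their closures meet in `Ω`. -/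
def Triangulation.vertexGraph (T : Triangulation Ω) (z : 𝔼 d) :
    SimpleGraph {s // s ∈ T.cells ∧ z ∈ s} where
  Adj s t := s ≠ t ∧ ∃ x ∈ Ω, x ∈ convexHull ℝ ((s : Finset (𝔼 d)) : Set (𝔼 d)) ∧
    x ∈ convexHull ℝ ((t : Finset (𝔼 d)) : Set (𝔼 d))
  symm := ⟨fun _ _ h => ⟨h.1.symm, h.2.imp fun _ hx => ⟨hx.1, hx.2.2, hx.2.1⟩⟩⟩
  loopless := ⟨fun _ h => h.1 rfl⟩

/-- Functions with bounded gradient are approximated to first order by piecewise affine ones. -/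
theorem SegLip.exists_memFESpace_abs_sub_le (hΩ : IsOpen Ω) {T : Triangulation Ω} {κ h : ℝ}
    (hκ : 0 < κ) (hT : RegularMesh T κ h) {L : ℝ} (hL : 0 ≤ L) {f : (𝔼 d) → ℝ}
    (hf : SegLip Ω L f) :
    ∃ V, MemFESpace T 1 V ∧ ∀ x ∈ Ω, |V x - f x| ≤ (2 * (κ ^ d)⁻¹ + 1) * (L * h) := by
  classical
  have hc : ∀ s ∈ T.cells, (openSimplex s).Nonempty := fun s hs =>
    (T.isCell hs).openSimplex_nonempty
  choose! c hc using hc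
  have hLh : 0 ≤ L * h := mul_nonneg hL hT.pos.le
  -- One value per connected component of the graph of cells at `z`, taken at an interior point of a
  -- representative cell. Cells at `z` separated by a slit may receive different values.
  set a : Finset (𝔼 d) → (𝔼 d) → ℝ := fun s z => if hs : s ∈ T.cells ∧ z ∈ s then
    f (c ((T.vertexGraph z).connectedComponentMk ⟨s, hs⟩).out.1) else 0 with ha
  -- Each step of the walk passes through a common point of the two cells in Ω and costs L h on
  -- either side.
  have hwalk : ∀ z, ∀ s t, (w : (T.vertexGraph z).Walk s t) →
      |f (c s.1) - f (c t.1)| ≤ w.length * (2 * (L * h)) := by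
    intro z s t w
    induction w with
    | nil => simp
    | @cons s r t hsr w ih =>
      obtain ⟨x, hx, hxs, hxr⟩ := hsr.2
      have h1 := hf.abs_sub_le_cell hT hL s.2.1 (hc s.1 s.2.1) hx hxs
      have h2 := hf.abs_sub_le_cell hT hL r.2.1 (hc r.1 r.2.1) hx hxr
      rw [SimpleGraph.Walk.length_cons]
      push_cast
      rw [abs_le] at h1 h2 ih ⊢
      constructor <;> linarith [h1.1, h1.2, h2.1, h2.2, ih.1, ih.2]
  have hac : ∀ s ∈ T.cells, ∀ v ∈ s, |a s v - f (c s)| ≤ (κ ^ d)⁻¹ * (2 * (L * h)) := by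
    intro s hs v hv
    have hsv : s ∈ T.cells ∧ v ∈ s := ⟨hs, hv⟩
    simp only [ha, dif_pos hsv]
    have hfin : Finite {s // s ∈ T.cells ∧ v ∈ s} :=
      Finite.of_injective (fun s => (⟨s.1, s.2.1⟩ : T.cells)) fun s t h => by
        simpa [Subtype.ext_iff] using h
    have := Fintype.ofFinite {s // s ∈ T.cells ∧ v ∈ s}
    obtain ⟨w⟩ : (T.vertexGraph v).Reachable
        ((T.vertexGraph v).connectedComponentMk ⟨s, hsv⟩).out ⟨s, hsv⟩ := by
      rw [← SimpleGraph.ConnectedComponent.eq]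
      exact Quot.out_eq _
    refine (hwalk v _ _ w.toPath.1).trans ?_
    -- A path visits no cell twice, so its length is bounded by the number of cells at the vertex.
    have h1 : w.toPath.1.length < Fintype.card {s // s ∈ T.cells ∧ v ∈ s} := w.toPath.2.length_lt
    have h2 : Fintype.card {s // s ∈ T.cells ∧ v ∈ s} = (T.cells.filter (v ∈ ·)).card :=
      Fintype.card_of_subtype _ fun s => by rw [Finset.mem_filter]
    have h3 : (w.toPath.1.length : ℝ) ≤ (κ ^ d)⁻¹ := by
      refine le_trans ?_ (T.card_filter_mem_le hT hκ v)
      rw [← h2]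
      exact_mod_cast h1.le
    gcongr
  obtain ⟨V, hV, hVe⟩ := T.exists_nodal hΩ a (by
    intro s hs t ht hx v hv
    have hsv : s ∈ T.cells ∧ v ∈ s := ⟨hs, (Finset.mem_inter.1 hv).1⟩
    have htv : t ∈ T.cells ∧ v ∈ t := ⟨ht, (Finset.mem_inter.1 hv).2⟩
    simp only [ha, dif_pos hsv, dif_pos htv]
    by_cases hst : s = t
    · subst hst; rfl
    have hadj : (T.vertexGraph v).Adj ⟨s, hsv⟩ ⟨t, htv⟩ :=
      ⟨fun h => hst (congrArg Subtype.val h), hx⟩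
    rw [SimpleGraph.ConnectedComponent.eq.2 hadj.reachable])
  refine ⟨V, hV, fun x hx => ?_⟩
  obtain ⟨s, hs, hxs⟩ := T.exists_cell hx
  have h1 : V x - f x = ∑ v ∈ s, baryCoord s x v * (a s v - f x) := by
    simp only [mul_sub, Finset.sum_sub_distrib]
    rw [← hVe s hs x hx hxs, ← Finset.sum_mul, (T.isCell hs).bary_spec.2.2.1 x, one_mul]
  rw [h1]
  refine (T.isCell hs).abs_sum_baryCoord_mul_le hxs fun v hv => ?_
  calc |a s v - f x| ≤ |a s v - f (c s)| + |f (c s) - f x| := abs_sub_le _ _ _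
    _ ≤ (κ ^ d)⁻¹ * (2 * (L * h)) + L * h :=
      add_le_add (hac s hs v hv) (hf.abs_sub_le_cell hT hL hs (hc s hs) hx hxs)
    _ = _ := by ring

/-! ### Inverse estimates on regular meshes -/

theorem volume_openSimplex_ne_top (s : Finset (𝔼 d)) :
    volume (openSimplex s) ≠ ⊤ :=
  ((measure_mono (openSimplex_subset s)).trans_lt (isCompact_cell s).measure_lt_top).ne

/-- Each cell contains a ball of radius κ h and lies within distance h of its centre, so the scaled
polynomial estimates hold with a constant depending only on `d`, `k` and `κ`. -/
theorem exists_inverse_estimate_mesh (d k : ℕ) {κ : ℝ} (hκ : 0 < κ) : ∃ C : ℝ, 0 < C ∧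
    ∀ {Ω : Set (𝔼 d)} {T : Triangulation Ω} {h : ℝ}, RegularMesh T κ h →
      ∀ {V : (𝔼 d) → ℝ}, MemFESpace T k V → ∀ s ∈ T.cells,
        (∀ x ∈ Ω, x ∈ convexHull ℝ (s : Set (𝔼 d)) →
          V x ^ 2 ≤ C * ((h ^ d)⁻¹ * ∫ y in openSimplex s, V y ^ 2)) ∧
        ∀ M : ℝ, (∀ y ∈ openSimplex s, |V y| ≤ M) → ∀ x ∈ openSimplex s,
          ‖gradient V x‖ ≤ C * (M / h) := by
  obtain ⟨C, hC, hinv⟩ := exists_inverse_estimate d k hκ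
  refine ⟨C, hC, fun {Ω T h} hT {V} hV s hs => ?_⟩
  obtain ⟨q, hqk, hq⟩ := hV.exists_polynomial
  obtain ⟨x₀, hx₀⟩ := hT.exists_ball s hs
  have hh := hT.pos
  have hx₀s : x₀ ∈ convexHull ℝ (s : Set (𝔼 d)) := openSimplex_subset s
    (hx₀ (Metric.mem_closedBall_self (by positivity)))
  obtain ⟨h1, h2⟩ := hinv (q s) (hqk s hs) x₀ h hh
  have hqV : ∀ x ∈ openSimplex s, V x = MvPolynomial.eval (fun i => x i) (q s) := fun x hx =>
    hq s hs x (T.subset s hs hx) (openSimplex_subset s hx)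
  constructor
  · intro x hx hxs
    rw [hq s hs x hx hxs]
    refine (h1 x (hT.dist_le s hs x hxs x₀ hx₀s)).trans ?_
    have h3 : ∫ y in openSimplex s, V y ^ 2 =
        ∫ y in openSimplex s, MvPolynomial.eval (fun i => y i) (q s) ^ 2 :=
      setIntegral_congr_fun isOpen_interior.measurableSet fun y hy => by
        simp only [hqV y hy]
    rw [h3]
    gcongr
    · exact Eventually.of_forall fun y => sq_nonneg _
    · exact (((continuous_eval_euclidean (q s)).pow 2).continuousOn.integrableOn_compact
        (isCompact_cell s)).mono_set (openSimplex_subset s)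
  · intro M hM x hx
    have h3 := h2 M (fun y hy => by rw [← hqV y (hx₀ hy)]; exact hM y (hx₀ hy)) x
      (hT.dist_le s hs x (openSimplex_subset s hx) x₀ hx₀s)
    have h4 : V =ᶠ[𝓝 x] fun x : 𝔼 d => MvPolynomial.eval (fun i => x i) (q s) := by
      filter_upwards [isOpen_interior.mem_nhds hx] with y hy using hqV y hy
    rwa [gradient, h4.fderiv_eq]

theorem Triangulation.setIntegral_eq_sum (T : Triangulation Ω) (hΩ : IsOpen Ω) {F : (𝔼 d) → ℝ}
    (hF : IntegrableOn F Ω) : ∫ x in Ω, F x = ∑ s ∈ T.cells, ∫ x in openSimplex s, F x := by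
  rw [← integral_biUnion_finset]
  · refine setIntegral_congr_set ?_
    have h1 := (ae_restrict_iff' hΩ.measurableSet).1 (T.ae_mem_openSimplex hΩ)
    filter_upwards [h1] with x hx
    refine propext ⟨fun h => ?_, fun h => ?_⟩
    · obtain ⟨s, hs, hxs⟩ := hx h
      exact Set.mem_iUnion₂.2 ⟨s, hs, hxs⟩
    · obtain ⟨s, hs, hxs⟩ := Set.mem_iUnion₂.1 h
      exact T.subset s hs hxs
  · exact fun s _ => isOpen_interior.measurableSet
  · exact fun s hs t ht hst => T.disjoint_openSimplex hs ht hst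
  · exact fun s hs => hF.mono_set (T.subset s hs)

/-! ### Bounded measurable functions -/

/-- A measurable function on `Ω` that is bounded. -/
structure BddMeasurableOn (Ω : Set (𝔼 d)) (f : (𝔼 d) → ℝ) : Prop where
  aestronglyMeasurable : AEStronglyMeasurable f (volume.restrict Ω)
  exists_bound : ∃ B, ∀ x ∈ Ω, |f x| ≤ B

namespace BddMeasurableOn

variable {f g : (𝔼 d) → ℝ}

theorem integrableOn (hf : BddMeasurableOn Ω f) (hΩ : IsOpen Ω) (hΩb : Bornology.IsBounded Ω) :
    IntegrableOn f Ω := by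
  obtain ⟨B, hB⟩ := hf.exists_bound
  have : IsFiniteMeasure (volume.restrict Ω) :=
    isFiniteMeasure_restrict.2 hΩb.measure_lt_top.ne
  refine Integrable.of_bound hf.aestronglyMeasurable B ?_
  filter_upwards [ae_restrict_mem hΩ.measurableSet] with x hx using hB x hx

theorem mul (hf : BddMeasurableOn Ω f) (hg : BddMeasurableOn Ω g) :
    BddMeasurableOn Ω fun x => f x * g x := by
  obtain ⟨B, hB⟩ := hf.exists_bound
  obtain ⟨C, hC⟩ := hg.exists_bound
  refine ⟨hf.1.mul hg.1, B * C, fun x hx => ?_⟩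
  rw [abs_mul]
  exact mul_le_mul (hB x hx) (hC x hx) (abs_nonneg _) ((abs_nonneg _).trans (hB x hx))

theorem sub (hf : BddMeasurableOn Ω f) (hg : BddMeasurableOn Ω g) :
    BddMeasurableOn Ω fun x => f x - g x := by
  obtain ⟨B, hB⟩ := hf.exists_bound
  obtain ⟨C, hC⟩ := hg.exists_bound
  exact ⟨hf.1.sub hg.1, B + C, fun x hx => (abs_sub _ _).trans (add_le_add (hB x hx) (hC x hx))⟩

theorem sq (hf : BddMeasurableOn Ω f) : BddMeasurableOn Ω fun x => f x ^ 2 := by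
  simpa only [pow_two] using hf.mul hf

theorem _root_.MemFESpace.bddMeasurableOn {T : Triangulation Ω} {k : ℕ} {V : (𝔼 d) → ℝ}
    (hV : MemFESpace T k V) (hΩ : IsOpen Ω) : BddMeasurableOn Ω V :=
  ⟨hV.continuousOn.aestronglyMeasurable hΩ.measurableSet,
    let ⟨B, _, hB⟩ := hV.exists_bound; ⟨B, hB⟩⟩

end BddMeasurableOn

/-! ### Weighted stability of the `L²` projection -/

-- Exponential decay of the L² projection. Let χ be the weight and `W` the modulated projection.
-- Orthogonality of w - f to `W` gives ∫ χ w² ≤ ∫ χ f w + ∫ |(w - f)(W - χ w)|. On a cell χ varies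
-- by a factor at most 1 + θ, so by the modulation and inverse estimates the last integral is of
-- order θ times the weighted norms, and its w-part is absorbed. A final inverse estimate passes
-- from the weighted norm to the value at `x`.
set_option maxHeartbeats 800000 in
theorem exists_projection_weighted_bound (d : ℕ) {k : ℕ} (hk : 1 ≤ k) {κ : ℝ} (hκ : 0 < κ) :
    ∃ β : ℝ, 0 < β ∧ ∃ C : ℝ, 0 < C ∧ ∀ {Ω : Set (𝔼 d)}, IsOpen Ω → Bornology.IsBounded Ω →
      ∀ {T : Triangulation Ω} {h : ℝ}, RegularMesh T κ h → ∀ {f w : (𝔼 d) → ℝ},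
        BddMeasurableOn Ω f → IsL2Projection T k f w → ∀ x₀, ∀ x ∈ Ω, dist x x₀ ≤ h →
          w x ^ 2 ≤ C * ((h ^ d)⁻¹ * ∫ y in Ω, Real.exp (-(β * (dist y x₀ / h))) * f y ^ 2) := by
  obtain ⟨C₁, hC₁, hinv⟩ := exists_inverse_estimate_mesh d k hκ
  obtain ⟨C₃, hC₃, hmod⟩ := exists_modulation_const d hk
  set ν : ℝ := volume.real (Metric.closedBall (0 : 𝔼 d) 1) with hν
  have hν0 : 0 ≤ ν := measureReal_nonneg
  set C₂ : ℝ := 2 * C₁ * ν with hC₂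
  have hC₂0 : 0 ≤ C₂ := by positivity
  -- Chosen to give C₃ θ (C₂ + 1) ≤ 1/4. With A and B the weighted squares of `w` and `f`,
  -- absorption reads A ≤ A/2 + B/2 + A/4 + B/4, that is A ≤ 3 B. The cap 1 allows 1 + θ to be
  -- replaced by 2.
  set θ : ℝ := min 1 (1 / (4 * (C₃ + 1) * (C₂ + 1))) with hθ
  have hθ0 : 0 < θ := by positivity
  have hθ1 : θ ≤ 1 := min_le_left _ _
  have hθC : C₃ * θ * (C₂ + 1) ≤ 1 / 4 := by
    have h1 : C₃ * θ * (C₂ + 1) ≤ (C₃ + 1) * (1 / (4 * (C₃ + 1) * (C₂ + 1))) * (C₂ + 1) := by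
      gcongr
      · linarith
      · exact min_le_right _ _
    refine h1.trans (le_of_eq ?_)
    field_simp
  have hβ : 0 < Real.log (1 + θ) := Real.log_pos (by linarith)
  -- The rate makes the weight change by a factor at most 1 + θ over distance `h`. The constant 12 =
  -- 4 * 3 combines χ ≥ 1/4 on the cell of `x` with A ≤ 3 B.
  refine ⟨Real.log (1 + θ), hβ, 12 * C₁, by positivity, ?_⟩
  intro Ω hΩ hΩb T h hT f w hf hw x₀
  set β := Real.log (1 + θ) with hβdef
  have hexpβ : Real.exp β = 1 + θ := Real.exp_log (by linarith)
  have hh := hT.pos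
  have hw' := hw.mem
  set χ : (𝔼 d) → ℝ := fun y => Real.exp (-(β * (dist y x₀ / h))) with hχ
  have hχ0 : ∀ y, 0 < χ y := fun y => Real.exp_pos _
  have hχ1 : ∀ y, χ y ≤ 1 := fun y => Real.exp_le_one_iff.2 (neg_nonpos.2 (by positivity))
  have hχmul : ∀ y z, dist y z ≤ h → χ z ≤ (1 + θ) * χ y := by
    intro y z hyz
    rw [← hexpβ]
    simp only [hχ]
    rw [← Real.exp_add, Real.exp_le_exp]
    have h1 : dist y x₀ / h ≤ 1 + dist z x₀ / h := by
      rw [← sub_le_iff_le_add, ← sub_div, div_le_one hh]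
      linarith [dist_triangle y z x₀]
    nlinarith
  have hχsub : ∀ y z, dist y z ≤ h → |χ z - χ y| ≤ θ * χ y := by
    intro y z hyz
    have h1 := hχmul y z hyz
    have h2 := hχmul z y (by rwa [dist_comm])
    rw [abs_le]
    constructor
    · nlinarith [mul_le_mul_of_nonneg_left h1 hθ0.le, hχ0 y, hχ0 z]
    · linarith
  have hχc : Continuous χ := by
    refine Real.continuous_exp.comp ?_
    fun_prop
  have hχb : BddMeasurableOn Ω χ := ⟨hχc.aestronglyMeasurable, 1, fun x _ => by
    rw [abs_of_pos (hχ0 x)]; exact hχ1 x⟩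
  have hwb := hw'.bddMeasurableOn hΩ
  obtain ⟨W, hW, hWχ⟩ := hmod hΩ T hw' χ
  have hWb := hW.bddMeasurableOn hΩ
  have hw2 := (hχb.mul hwb.sq).integrableOn hΩ hΩb
  have hf2 := (hχb.mul hf.sq).integrableOn hΩ hΩb
  set A := ∫ y in Ω, χ y * w y ^ 2 with hA
  set B := ∫ y in Ω, χ y * f y ^ 2 with hB
  have hvol : ∀ s ∈ T.cells, volume.real (openSimplex s) ≤ h ^ d * ν := by
    intro s hs
    obtain ⟨z, hz⟩ := (T.isCell hs).openSimplex_nonempty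
    have h1 : volume.real (openSimplex s) ≤ volume.real (Metric.closedBall z h) :=
      measureReal_mono (fun y hy => hT.dist_le s hs y (openSimplex_subset s hy) z
        (openSimplex_subset s hz)) measure_closedBall_lt_top.ne
    refine h1.trans (le_of_eq ?_)
    rw [measureReal_def, Measure.addHaar_closedBall' volume z hh.le,
      ENNReal.toReal_mul, ENNReal.toReal_ofReal (by positivity)]
    simp [hν, measureReal_def]
  have hcell : ∀ s ∈ T.cells, ∫ y in openSimplex s, |(w y - f y) * (W y - χ y * w y)| ≤
      C₃ * θ * ((C₂ + 1) * (∫ y in openSimplex s, χ y * w y ^ 2) +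
        ∫ y in openSimplex s, χ y * f y ^ 2) := by
    intro s hs
    have hsΩ := T.subset s hs
    set M := √(C₁ * ((h ^ d)⁻¹ * ∫ y in openSimplex s, w y ^ 2)) with hM
    have hI0 : 0 ≤ ∫ y in openSimplex s, w y ^ 2 := integral_nonneg fun _ => sq_nonneg _
    have hM2 : M ^ 2 = C₁ * ((h ^ d)⁻¹ * ∫ y in openSimplex s, w y ^ 2) :=
      Real.sq_sqrt (by positivity)
    have hwM : ∀ y ∈ openSimplex s, |w y| ≤ M := fun y hy => Real.abs_le_sqrt
      ((hinv hT hw' s hs).1 y (hsΩ hy) (openSimplex_subset s hy))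
    set K := 2 * C₁ * ((h ^ d)⁻¹ * ∫ z in openSimplex s, χ z * w z ^ 2) with hK
    have hdist : ∀ y ∈ openSimplex s, ∀ z ∈ convexHull ℝ (s : Set (𝔼 d)), dist y z ≤ h :=
      fun y hy z hz => hT.dist_le s hs y (openSimplex_subset s hy) z hz
    have hKM : ∀ y ∈ openSimplex s, χ y * M ^ 2 ≤ K := by
      intro y hy
      have h1 : χ y * ∫ z in openSimplex s, w z ^ 2 ≤ 2 * ∫ z in openSimplex s, χ z * w z ^ 2 := by
        rw [← integral_const_mul, ← integral_const_mul]
        refine setIntegral_mono_on ?_ ?_ isOpen_interior.measurableSet fun z hz => ?_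
        · exact ((hwb.sq.integrableOn hΩ hΩb).mono_set hsΩ).const_mul _
        · exact (hw2.mono_set hsΩ).const_mul _
        · have h2 : χ y ≤ (1 + θ) * χ z := hχmul z y (hdist z hz y (openSimplex_subset s hy))
          have h3 : χ y ≤ 2 * χ z := h2.trans (by nlinarith [hχ0 z])
          nlinarith [sq_nonneg (w z)]
      rw [hM2, hK]
      calc χ y * (C₁ * ((h ^ d)⁻¹ * ∫ z in openSimplex s, w z ^ 2))
          = C₁ * (h ^ d)⁻¹ * (χ y * ∫ z in openSimplex s, w z ^ 2) := by ring
        _ ≤ C₁ * (h ^ d)⁻¹ * (2 * ∫ z in openSimplex s, χ z * w z ^ 2) := by gcongr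
        _ = _ := by ring
    have hpt : ∀ y ∈ openSimplex s, |(w y - f y) * (W y - χ y * w y)| ≤
        C₃ * θ * (K + (χ y * w y ^ 2 + χ y * f y ^ 2)) := by
      intro y hy
      -- The comparison constant for the weight is its value at the point `y` itself, so it changes
      -- from point to point.
      have h1 := hWχ s hs (χ y) (θ * χ y) M (fun z hz => hχsub y z (hdist y hy z hz)) hwM y hy
      rw [abs_mul]
      have hM0 : 0 ≤ M := Real.sqrt_nonneg _
      have h2 : |w y - f y| * M ≤ M ^ 2 + (w y ^ 2 + f y ^ 2) := by
        have e1 : |w y - f y| ^ 2 ≤ 2 * (w y ^ 2 + f y ^ 2) := by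
          rw [sq_abs]; nlinarith [sq_nonneg (w y + f y)]
        nlinarith [sq_nonneg (|w y - f y| - 2 * M)]
      calc |w y - f y| * |W y - χ y * w y| ≤ |w y - f y| * (C₃ * (θ * χ y) * M) := by gcongr
        _ = C₃ * θ * χ y * (|w y - f y| * M) := by ring
        _ ≤ C₃ * θ * χ y * (M ^ 2 + (w y ^ 2 + f y ^ 2)) := by
            have := hχ0 y
            gcongr
        _ = C₃ * θ * (χ y * M ^ 2 + (χ y * w y ^ 2 + χ y * f y ^ 2)) := by ring
        _ ≤ _ := by
            gcongr
            exact hKM y hy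
    have hi1 := hw2.mono_set hsΩ
    have hi2 := hf2.mono_set hsΩ
    have hiK : IntegrableOn (fun _ => K) (openSimplex s) :=
      integrableOn_const (volume_openSimplex_ne_top s)
    calc ∫ y in openSimplex s, |(w y - f y) * (W y - χ y * w y)|
        ≤ ∫ y in openSimplex s, C₃ * θ * (K + (χ y * w y ^ 2 + χ y * f y ^ 2)) := by
          refine setIntegral_mono_on ?_ ((hiK.add (hi1.add hi2)).const_mul _)
            isOpen_interior.measurableSet hpt
          exact ((((hwb.sub hf).mul (hWb.sub (hχb.mul hwb))).integrableOn hΩ hΩb).mono_set hsΩ).abs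
      _ = C₃ * θ * (volume.real (openSimplex s) * K + ((∫ y in openSimplex s, χ y * w y ^ 2) +
            ∫ y in openSimplex s, χ y * f y ^ 2)) := by
          have e1 : ∫ y in openSimplex s, K + (χ y * w y ^ 2 + χ y * f y ^ 2) =
              (∫ _ in openSimplex s, K) + ∫ y in openSimplex s, χ y * w y ^ 2 + χ y * f y ^ 2 :=
            integral_add hiK (hi1.add hi2)
          rw [integral_const_mul, e1, integral_add hi1 hi2, setIntegral_const, smul_eq_mul]
      _ ≤ _ := by
          have hI : 0 ≤ ∫ y in openSimplex s, χ y * w y ^ 2 :=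
            integral_nonneg fun y => mul_nonneg (hχ0 y).le (sq_nonneg _)
          have h1 : volume.real (openSimplex s) * K ≤ C₂ * ∫ y in openSimplex s, χ y * w y ^ 2 := by
            calc volume.real (openSimplex s) * K ≤ (h ^ d * ν) * K := by
                  gcongr
                  exact hvol s hs
              _ = C₂ * ∫ y in openSimplex s, χ y * w y ^ 2 := by
                  rw [hK, hC₂]; field_simp
          have : 0 ≤ C₃ * θ := by positivity
          refine mul_le_mul_of_nonneg_left ?_ this
          linarith
  have hFi := ((hwb.sub hf).mul (hWb.sub (hχb.mul hwb))).integrableOn hΩ hΩb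
  have hglob : |∫ y in Ω, (w y - f y) * (W y - χ y * w y)| ≤ C₃ * θ * ((C₂ + 1) * A + B) := by
    refine (abs_integral_le_integral_abs).trans ?_
    rw [T.setIntegral_eq_sum hΩ hFi.abs, hA, hB, T.setIntegral_eq_sum hΩ hw2,
      T.setIntegral_eq_sum hΩ hf2, Finset.mul_sum, ← Finset.sum_add_distrib, Finset.mul_sum]
    exact Finset.sum_le_sum hcell
  have hA0 : 0 ≤ A := integral_nonneg fun y => mul_nonneg (hχ0 y).le (sq_nonneg _)
  have hB0 : 0 ≤ B := integral_nonneg fun y => mul_nonneg (hχ0 y).le (sq_nonneg _)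
  have hAB : A ≤ 3 * B := by
    have i1 := (hwb.mul hWb).integrableOn hΩ hΩb
    have i2 := (hf.mul hWb).integrableOn hΩ hΩb
    have i3 := (hχb.mul (hf.mul hwb)).integrableOn hΩ hΩb
    have e1 : ∫ y in Ω, (w y - f y) * (W y - χ y * w y) =
        (∫ y in Ω, w y * W y) - (∫ y in Ω, f y * W y) - (A - ∫ y in Ω, χ y * (f y * w y)) := by
      rw [hA, ← integral_sub i1 i2, ← integral_sub hw2 i3]
      refine Eq.trans ?_ (integral_sub (i1.sub i2) (hw2.sub i3))
      exact integral_congr_ae (Eventually.of_forall fun y => by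
        show (w y - f y) * (W y - χ y * w y) =
          (w y * W y - f y * W y) - (χ y * w y ^ 2 - χ y * (f y * w y))
        ring)
    rw [e1, hw.integral_eq W hW, sub_self, zero_sub, abs_neg] at hglob
    have e2 : ∫ y in Ω, χ y * (f y * w y) ≤ (1 / 2) * A + (1 / 2) * B := by
      rw [hA, hB, ← integral_const_mul, ← integral_const_mul,
        ← integral_add (hw2.const_mul _) (hf2.const_mul _)]
      refine integral_mono i3 ((hw2.const_mul _).add (hf2.const_mul _)) fun y => ?_
      show χ y * (f y * w y) ≤ 1 / 2 * (χ y * w y ^ 2) + 1 / 2 * (χ y * f y ^ 2)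
      nlinarith [mul_nonneg (hχ0 y).le (sq_nonneg (f y - w y))]
    have e3 := (le_abs_self _).trans hglob
    have e4 : C₃ * θ * ((C₂ + 1) * A + B) ≤ 1 / 4 * A + 1 / 4 * B := by
      have h5 : C₃ * θ ≤ C₃ * θ * (C₂ + 1) := le_mul_of_one_le_right (by positivity) (by linarith)
      have h6 : C₃ * θ * (C₂ + 1) * A ≤ 1 / 4 * A := by gcongr
      have h7 : C₃ * θ * B ≤ 1 / 4 * B := mul_le_mul_of_nonneg_right (h5.trans hθC) hB0
      linarith
    linarith
  intro x hx hxx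
  obtain ⟨s, hs, hxs⟩ := T.exists_cell hx
  have hsΩ := T.subset s hs
  have h1 : ∫ y in openSimplex s, w y ^ 2 ≤ 4 * A := by
    have h2 : ∫ y in openSimplex s, w y ^ 2 ≤ ∫ y in openSimplex s, 4 * (χ y * w y ^ 2) := by
      refine setIntegral_mono_on ((hwb.sq.integrableOn hΩ hΩb).mono_set hsΩ)
        ((hw2.mono_set hsΩ).const_mul _) isOpen_interior.measurableSet fun y hy => ?_
      have h3 : χ x₀ ≤ (1 + θ) * χ x := hχmul x x₀ hxx
      have h4 : χ x ≤ (1 + θ) * χ y :=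
        hχmul y x (hT.dist_le s hs y (openSimplex_subset s hy) x hxs)
      have h5 : χ x₀ = 1 := by simp [hχ]
      have h6 : 1 ≤ 4 * χ y := by
        have h7 : (1 + θ) * χ x ≤ 2 * χ x := mul_le_mul_of_nonneg_right (by linarith) (hχ0 x).le
        have h8 : (1 + θ) * χ y ≤ 2 * χ y := mul_le_mul_of_nonneg_right (by linarith) (hχ0 y).le
        linarith
      rw [← mul_assoc]
      exact le_mul_of_one_le_left (sq_nonneg _) h6
    refine h2.trans ?_
    rw [integral_const_mul, hA]
    refine mul_le_mul_of_nonneg_left (setIntegral_mono_set hw2 ?_ hsΩ.eventuallyLE) (by norm_num)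
    exact Eventually.of_forall fun y => mul_nonneg (hχ0 y).le (sq_nonneg _)
  calc w x ^ 2 ≤ C₁ * ((h ^ d)⁻¹ * ∫ y in openSimplex s, w y ^ 2) := (hinv hT hw' s hs).1 x hx hxs
    _ ≤ C₁ * ((h ^ d)⁻¹ * (4 * (3 * B))) := by
        gcongr
        linarith
    _ = _ := by ring

/-! ### Moments of the exponential weight -/

/-- One term of the exponential series, of order m + d + 1, bounds the integrand by a multiple of (1
+ ‖t‖)^(-(d+1)), which is integrable in dimension `d`. -/
theorem integrable_exp_neg_mul_norm_mul_pow (d : ℕ) {β : ℝ} (hβ : 0 < β) (m : ℕ) :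
    Integrable fun t : 𝔼 d => Real.exp (-(β * ‖t‖)) * ‖t‖ ^ m := by
  have h1 : Integrable fun t : 𝔼 d => (1 + ‖t‖) ^ (-((d : ℝ) + 1)) := by
    refine integrable_one_add_norm ?_
    rw [finrank_euclideanSpace, Fintype.card_fin]
    linarith
  set N := m + (d + 1) with hN
  set C : ℝ := Real.exp β * (N.factorial / β ^ N) with hC
  refine (h1.const_mul C).mono' ?_ (Eventually.of_forall fun t => ?_)
  · exact Continuous.aestronglyMeasurable (by fun_prop)
  rw [Real.norm_of_nonneg (by positivity)]
  set r := ‖t‖ with hr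
  have hr0 : 0 ≤ r := norm_nonneg t
  have hr1 : 0 < 1 + r := by linarith
  have h2 : (β * (1 + r)) ^ N / N.factorial ≤ Real.exp (β * (1 + r)) :=
    Real.pow_div_factorial_le_exp _ (by positivity) N
  have hfac : (0 : ℝ) < N.factorial := by exact_mod_cast N.factorial_pos
  have h3 : Real.exp (-(β * (1 + r))) ≤ N.factorial / (β * (1 + r)) ^ N := by
    rw [Real.exp_neg, ← inv_div]
    exact inv_anti₀ (by positivity) h2
  have h4 : Real.exp (-(β * r)) = Real.exp β * Real.exp (-(β * (1 + r))) := by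
    rw [← Real.exp_add]; congr 1; ring
  rw [h4, Real.rpow_neg hr1.le, show (d : ℝ) + 1 = ((d + 1 : ℕ) : ℝ) by push_cast; ring,
    Real.rpow_natCast]
  calc Real.exp β * Real.exp (-(β * (1 + r))) * r ^ m
      ≤ Real.exp β * (N.factorial / (β * (1 + r)) ^ N) * (1 + r) ^ m := by
        gcongr
        linarith
    _ = C * ((1 + r) ^ (d + 1))⁻¹ := by
        rw [hC, mul_pow, hN, pow_add (1 + r)]
        field_simp

/-- Substituting y = x₀ + h t removes `h` from the weight; `J` is the moment at unit scale. -/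
theorem exists_weighted_moment_le (d : ℕ) {β : ℝ} (hβ : 0 < β) (m : ℕ) : ∃ J : ℝ, 0 ≤ J ∧
    ∀ (x₀ : 𝔼 d) {h : ℝ}, 0 < h →
      Integrable (fun y => Real.exp (-(β * (dist y x₀ / h))) * dist y x₀ ^ m) ∧
      (h ^ d)⁻¹ * ∫ y, Real.exp (-(β * (dist y x₀ / h))) * dist y x₀ ^ m ≤ J * h ^ m := by
  set F : (𝔼 d) → ℝ := fun t => Real.exp (-(β * ‖t‖)) * ‖t‖ ^ m with hF
  have hFi : Integrable F := integrable_exp_neg_mul_norm_mul_pow d hβ m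
  refine ⟨∫ t, F t, integral_nonneg fun t => by positivity, fun x₀ h hh => ?_⟩
  have h1 : (fun y : 𝔼 d => Real.exp (-(β * (dist y x₀ / h))) * dist y x₀ ^ m) =
      fun y => h ^ m * F (h⁻¹ • (y - x₀)) := by
    ext y
    simp only [hF, norm_smul, norm_inv, Real.norm_of_nonneg hh.le, dist_eq_norm, mul_pow, inv_pow]
    rw [div_eq_inv_mul]
    field_simp
  have h2 : Integrable fun y : 𝔼 d => F (h⁻¹ • (y - x₀)) :=
    (hFi.comp_smul (inv_ne_zero hh.ne')).comp_sub_right x₀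
  rw [h1]
  refine ⟨h2.const_mul _, le_of_eq ?_⟩
  rw [integral_const_mul, integral_sub_right_eq_self (fun y => F (h⁻¹ • y)) x₀,
    Measure.integral_comp_inv_smul_of_nonneg _ _ hh.le, finrank_euclideanSpace, Fintype.card_fin,
    smul_eq_mul]
  field_simp

/-! ### Affine functions and comparison of gradients -/

theorem memFESpace_affine (T : Triangulation Ω) (a : ℝ) (b x₀ : 𝔼 d) :
    MemFESpace T 1 fun y => a + inner ℝ b (y - x₀) := by
  refine ⟨by fun_prop, fun s _ => ?_⟩
  obtain ⟨q, hq, he⟩ := exists_polynomial_of_affine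
    ((innerSL ℝ b : (𝔼 d) →L[ℝ] ℝ).toLinearMap.toAffineMap + AffineMap.const ℝ (𝔼 d)
      (a - inner ℝ b x₀))
  refine ⟨q, hq, fun x _ => ?_⟩
  rw [he, inner_sub_right]
  simp
  ring

theorem hasGradientAt_affine (a : ℝ) (b x₀ x : 𝔼 d) :
    HasGradientAt (fun y => a + inner ℝ b (y - x₀)) b x := by
  rw [hasGradientAt_iff_hasFDerivAt]
  have h1 : HasFDerivAt (fun y : 𝔼 d => (innerSL ℝ b) (y - x₀)) (innerSL ℝ b) x := by
    have := (innerSL ℝ b : (𝔼 d) →L[ℝ] ℝ).hasFDerivAt.comp x ((hasFDerivAt_id x).sub_const x₀)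
    rwa [ContinuousLinearMap.comp_id] at this
  exact h1.const_add a

theorem MemFESpace.differentiableAt {T : Triangulation Ω} {k : ℕ} {V : (𝔼 d) → ℝ}
    (hV : MemFESpace T k V) {s : Finset (𝔼 d)} (hs : s ∈ T.cells) {x : 𝔼 d}
    (hx : x ∈ openSimplex s) : DifferentiableAt ℝ V x := by
  obtain ⟨q, -, hq⟩ := hV.polynomial s hs
  have h1 : V =ᶠ[𝓝 x] fun x : 𝔼 d => MvPolynomial.eval (fun i => x i) q := by
    filter_upwards [isOpen_interior.mem_nhds hx] with y hy using hq y hy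
  exact ((contDiff_eval_euclidean q).contDiffAt.differentiableAt (by simp)).congr_of_eventuallyEq h1

/-- Affine functions belong to the finite element space since k ≥ 1, so the inverse estimate applies
to the difference: an error ε h in values costs a multiple of ε in gradients. -/
theorem exists_gradient_sub_le (d : ℕ) {k : ℕ} (hk : 1 ≤ k) {κ : ℝ} (hκ : 0 < κ) :
    ∃ C : ℝ, 0 < C ∧ ∀ {Ω : Set (𝔼 d)} {T : Triangulation Ω} {h : ℝ}, RegularMesh T κ h →
      ∀ {V : (𝔼 d) → ℝ}, MemFESpace T k V → ∀ s ∈ T.cells, ∀ x ∈ openSimplex s,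
        ∀ (a : ℝ) (b : 𝔼 d) (ε : ℝ),
          (∀ y ∈ openSimplex s, |V y - (a + inner ℝ b (y - x))| ≤ ε * h) →
            ‖gradient V x - b‖ ≤ C * ε := by
  obtain ⟨C, hC, hinv⟩ := exists_inverse_estimate_mesh d k hκ
  refine ⟨C, hC, fun {Ω T h} hT {V} hV s hs x hx a b ε hε => ?_⟩
  have h1 := (hinv hT (hV.sub ((memFESpace_affine T a b x).mono hk)) s hs).2 (ε * h) hε x hx
  rw [mul_div_cancel_right₀ _ hT.pos.ne'] at h1
  have h2 := (hV.differentiableAt hs hx).hasGradientAt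
  have h3 : HasGradientAt (fun y => V y - (a + inner ℝ b (y - x))) (gradient V x - b) x := by
    rw [hasGradientAt_iff_hasFDerivAt] at h2 ⊢
    have h4 := (hasGradientAt_iff_hasFDerivAt.1 (hasGradientAt_affine a b x x))
    rw [map_sub]
    exact h2.sub h4
  rwa [h3.gradient] at h1

/-! ### Approximation by finite element functions -/

/-- Moments of the exponential weight convert growth of f² away from `x₀` into matching powers of
`h`. Two powers are kept so that a sharp bound near `x₀` can be combined with a crude one far away.
-/
theorem exists_projection_local_bound (d : ℕ) {k : ℕ} (hk : 1 ≤ k) {κ : ℝ} (hκ : 0 < κ) (l m : ℕ) :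
    ∃ C : ℝ, 0 ≤ C ∧ ∀ {Ω : Set (𝔼 d)}, IsOpen Ω → Bornology.IsBounded Ω →
      ∀ {T : Triangulation Ω} {h : ℝ}, RegularMesh T κ h → ∀ {f w : (𝔼 d) → ℝ},
        BddMeasurableOn Ω f → IsL2Projection T k f w → ∀ x₀, ∀ a b : ℝ, 0 ≤ a → 0 ≤ b →
          (∀ y ∈ Ω, f y ^ 2 ≤ a * dist y x₀ ^ l + b * dist y x₀ ^ m) →
            ∀ x ∈ Ω, dist x x₀ ≤ h → w x ^ 2 ≤ C * (a * h ^ l + b * h ^ m) := by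
  obtain ⟨β, hβ, C, hC, hmain⟩ := exists_projection_weighted_bound d hk hκ
  obtain ⟨J, hJ0, hJ⟩ := exists_weighted_moment_le d hβ l
  obtain ⟨K, hK0, hK⟩ := exists_weighted_moment_le d hβ m
  refine ⟨C * (J + K), by positivity, fun {Ω} hΩ hΩb {T h} hT {f w} hf hw x₀ a b ha hb hab x hx
    hxx => (hmain hΩ hΩb hT hf hw x₀ x hx hxx).trans ?_⟩
  have hh := hT.pos
  obtain ⟨i1, h1⟩ := hJ x₀ hh
  obtain ⟨i2, h2⟩ := hK x₀ hh
  have i3 := (i1.const_mul a).add (i2.const_mul b)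
  have h3 : ∫ y in Ω, Real.exp (-(β * (dist y x₀ / h))) * f y ^ 2 ≤
      a * (∫ y, Real.exp (-(β * (dist y x₀ / h))) * dist y x₀ ^ l) +
        b * ∫ y, Real.exp (-(β * (dist y x₀ / h))) * dist y x₀ ^ m := by
    rw [← integral_const_mul, ← integral_const_mul,
      ← integral_add (i1.const_mul a) (i2.const_mul b)]
    refine le_trans ?_ (setIntegral_le_integral (s := Ω) i3
      (Eventually.of_forall fun y => by simp only [Pi.zero_apply]; positivity))
    refine integral_mono_of_nonneg (Eventually.of_forall fun y => by positivity) i3.integrableOn ?_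
    filter_upwards [ae_restrict_mem hΩ.measurableSet] with y hy
    calc Real.exp (-(β * (dist y x₀ / h))) * f y ^ 2
        ≤ Real.exp (-(β * (dist y x₀ / h))) * (a * dist y x₀ ^ l + b * dist y x₀ ^ m) :=
          mul_le_mul_of_nonneg_left (hab y hy) (Real.exp_pos _).le
      _ = _ := by ring
  have hhl : 0 ≤ h ^ l := by positivity
  have hhm : 0 ≤ h ^ m := by positivity
  calc C * ((h ^ d)⁻¹ * ∫ y in Ω, Real.exp (-(β * (dist y x₀ / h))) * f y ^ 2)
      ≤ C * ((h ^ d)⁻¹ * (a * (∫ y, Real.exp (-(β * (dist y x₀ / h))) * dist y x₀ ^ l) +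
          b * ∫ y, Real.exp (-(β * (dist y x₀ / h))) * dist y x₀ ^ m)) := by gcongr
    _ = C * (a * ((h ^ d)⁻¹ * ∫ y, Real.exp (-(β * (dist y x₀ / h))) * dist y x₀ ^ l) +
          b * ((h ^ d)⁻¹ * ∫ y, Real.exp (-(β * (dist y x₀ / h))) * dist y x₀ ^ m)) := by ring
    _ ≤ C * (a * (J * h ^ l) + b * (K * h ^ m)) := by gcongr
    _ ≤ C * (J + K) * (a * h ^ l + b * h ^ m) := by
        have e1 : 0 ≤ C * (a * (K * h ^ l)) := by positivity
        have e2 : 0 ≤ C * (b * (J * h ^ m)) := by positivity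
        nlinarith

/-- The projection fixes finite element functions, so `V` may be subtracted before a local bound is
applied. -/
theorem IsL2Projection.sub {T : Triangulation Ω} {k : ℕ} {f w V : (𝔼 d) → ℝ} (hΩ : IsOpen Ω)
    (hΩb : Bornology.IsBounded Ω) (hf : BddMeasurableOn Ω f) (hw : IsL2Projection T k f w)
    (hV : MemFESpace T k V) : IsL2Projection T k (fun x => f x - V x) fun x => w x - V x := by
  refine ⟨hw.mem.sub hV, fun Φ hΦ => ?_⟩
  have hΦ' := hΦ.bddMeasurableOn hΩ
  have i1 := ((hw.mem.bddMeasurableOn hΩ).mul hΦ').integrableOn hΩ hΩb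
  have i2 := ((hV.bddMeasurableOn hΩ).mul hΦ').integrableOn hΩ hΩb
  have i3 := (hf.mul hΦ').integrableOn hΩ hΩb
  simp only [sub_mul]
  rw [integral_sub i1 i2, integral_sub i3 i2, hw.integral_eq Φ hΦ]

theorem SegLip.bddMeasurableOn (hΩ : IsOpen Ω) {L B : ℝ} (hL : 0 ≤ L) {f : (𝔼 d) → ℝ}
    (hf : SegLip Ω L f) (hB : ∀ x ∈ Ω, |f x| ≤ B) : BddMeasurableOn Ω f :=
  ⟨(hf.continuousOn hΩ hL).aestronglyMeasurable hΩ.measurableSet, B, hB⟩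

/-- After subtracting a first-order approximant of `f`, the local bound with both exponents zero
serves as L^∞ stability of the projection. -/
theorem exists_projection_error (d : ℕ) {k : ℕ} (hk : 1 ≤ k) {κ : ℝ} (hκ : 0 < κ) :
    ∃ C : ℝ, 0 ≤ C ∧ ∀ {Ω : Set (𝔼 d)}, IsOpen Ω → Bornology.IsBounded Ω →
      ∀ {T : Triangulation Ω} {h : ℝ}, RegularMesh T κ h → ∀ {L B : ℝ}, 0 ≤ L →
        ∀ {f w : (𝔼 d) → ℝ}, SegLip Ω L f → (∀ x ∈ Ω, |f x| ≤ B) → IsL2Projection T k f w →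
          ∀ x ∈ Ω, |w x - f x| ≤ C * (L * h) := by
  obtain ⟨C, hC, hmain⟩ := exists_projection_local_bound d hk hκ 0 0
  set D : ℝ := 2 * (κ ^ d)⁻¹ + 1 with hD
  have hD0 : 0 ≤ D := by positivity
  refine ⟨√C * D + D, by positivity, fun {Ω} hΩ hΩb {T h} hT {L B} hL {f w} hf hB hw x hx => ?_⟩
  have hh := hT.pos
  obtain ⟨V, hV, hVf⟩ := hf.exists_memFESpace_abs_sub_le hΩ hκ hT hL
  have hV' := hV.mono hk
  have hfb := hf.bddMeasurableOn hΩ hL hB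
  have h1 := hmain hΩ hΩb hT (hfb.sub (hV'.bddMeasurableOn hΩ)) (hw.sub hΩ hΩb hfb hV') x
    ((D * (L * h)) ^ 2) 0 (sq_nonneg _) le_rfl (fun y hy => by
      rw [pow_zero, mul_one, zero_mul, add_zero, ← sq_abs]
      have := hVf y hy
      rw [abs_sub_comm] at this
      gcongr) x hx (by rw [dist_self]; exact hh.le)
  rw [pow_zero, mul_one, mul_one, add_zero] at h1
  have h2 : |w x - V x| ≤ √C * (D * (L * h)) := by
    refine abs_le_of_sq_le_sq (h1.trans (le_of_eq ?_)) (by positivity)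
    rw [mul_pow √C, Real.sq_sqrt hC]
  calc |w x - f x| ≤ |w x - V x| + |V x - f x| := abs_sub_le _ _ _
    _ ≤ √C * (D * (L * h)) + D * (L * h) := add_le_add h2 (hVf x hx)
    _ = _ := by ring

/-- On the cell of `x`, `V` differs from the constant `f x` by at most (D + L) h, so the inverse
estimate bounds its gradient independently of `h`. -/
theorem exists_norm_gradient_le (d : ℕ) {k : ℕ} (hk : 1 ≤ k) {κ : ℝ} (hκ : 0 < κ) :
    ∃ C : ℝ, 0 < C ∧ ∀ {Ω : Set (𝔼 d)}, IsOpen Ω → ∀ {T : Triangulation Ω} {h : ℝ},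
      RegularMesh T κ h → ∀ {L D : ℝ}, 0 ≤ L → ∀ {f V : (𝔼 d) → ℝ}, SegLip Ω L f →
        MemFESpace T k V → (∀ x ∈ Ω, |V x - f x| ≤ D * h) →
          ∀ᵐ x ∂(volume.restrict Ω), ‖gradient V x‖ ≤ C * (D + L) := by
  obtain ⟨C, hC, hmain⟩ := exists_gradient_sub_le d hk hκ
  refine ⟨C, hC, fun {Ω} hΩ {T h} hT {L D} hL {f V} hf hV hD => ?_⟩
  filter_upwards [T.ae_mem_openSimplex hΩ] with x hx
  obtain ⟨s, hs, hxs⟩ := hx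
  have h1 := hmain hT hV s hs x hxs (f x) 0 (D + L) fun y hy => by
    rw [inner_zero_left, add_zero]
    have e1 := hD y (T.subset s hs hy)
    have e2 := hf.abs_sub_le_cell hT hL hs hy (T.subset s hs hxs) (openSimplex_subset s hxs)
    calc |V y - f x| ≤ |V y - f y| + |f y - f x| := abs_sub_le _ _ _
      _ ≤ D * h + L * h := add_le_add e1 e2
      _ = _ := by ring
  rwa [sub_zero] at h1

theorem exists_forall_abs_sub_affine_le {f : (𝔼 d) → ℝ} {x : 𝔼 d}
    (hf : DifferentiableAt ℝ f x) {ε : ℝ} (hε : 0 < ε) :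
    ∃ δ > 0, ∀ y, dist y x < δ → |f y - (f x + inner ℝ (gradient f x) (y - x))| ≤ ε * dist y x := by
  have h1 := (hasGradientAt_iff_isLittleO.1 hf.hasGradientAt).def hε
  obtain ⟨δ, hδ, h2⟩ := Metric.eventually_nhds_iff.1 h1
  refine ⟨δ, hδ, fun y hy => ?_⟩
  have := h2 hy
  rwa [Real.norm_eq_abs, sub_sub, ← dist_eq_norm] at this

/-- Subtract the tangent affine function at `x`. Differentiability bounds the squared remainder by
η² dist² near `x`; farther away boundedness gives a multiple of dist³. The cubic term contributes
only h³, of lower size than h², so the projected remainder is at most ε' h on the cell of `x`, and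
the inverse estimate gives the gradient. -/
theorem tendsto_gradient_projection (hΩ : IsOpen Ω) (hΩb : Bornology.IsBounded Ω) {k : ℕ}
    (hk : 1 ≤ k) {κ : ℝ} (hκ : 0 < κ) {T : ℕ → Triangulation Ω} {h : ℕ → ℝ}
    (hT : ∀ n, RegularMesh (T n) κ (h n)) (hh : Tendsto h atTop (𝓝 0)) {f : (𝔼 d) → ℝ}
    {w : ℕ → (𝔼 d) → ℝ} (hf : BddMeasurableOn Ω f) (hw : ∀ n, IsL2Projection (T n) k f (w n))
    {x : 𝔼 d} (hx : ∀ n, ∃ s ∈ (T n).cells, x ∈ openSimplex s) (hfx : DifferentiableAt ℝ f x) :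
    Tendsto (fun n => gradient (w n) x) atTop (𝓝 (gradient f x)) := by
  obtain ⟨C, hC, hloc⟩ := exists_projection_local_bound d hk hκ 2 3
  obtain ⟨C', hC', hgrad⟩ := exists_gradient_sub_le d hk hκ
  rw [Metric.tendsto_nhds]
  intro ε hε
  set ε' := ε / (2 * C') with hε'
  have hε'0 : 0 < ε' := by positivity
  set η := ε' / (2 * (C + 1)) with hη
  have hη0 : 0 < η := by positivity
  obtain ⟨δ, hδ, hδf⟩ := exists_forall_abs_sub_affine_le hfx hη0
  set ℓ : (𝔼 d) → ℝ := fun y => f x + inner ℝ (gradient f x) (y - x) with hℓ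
  have hℓV : ∀ n, MemFESpace (T n) k ℓ := fun n => (memFESpace_affine (T n) _ _ _).mono hk
  have hfℓ : BddMeasurableOn Ω fun y => f y - ℓ y := hf.sub ((hℓV 0).bddMeasurableOn hΩ)
  obtain ⟨M, hM⟩ := hfℓ.exists_bound
  have hsq : ∀ y ∈ Ω, (f y - ℓ y) ^ 2 ≤ η ^ 2 * dist y x ^ 2 + (M ^ 2 / δ ^ 3) * dist y x ^ 3 := by
    intro y hy
    rw [← sq_abs]
    by_cases hyx : dist y x < δ
    · have h1 := hδf y hyx
      calc |f y - ℓ y| ^ 2 ≤ (η * dist y x) ^ 2 := by gcongr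
        _ = η ^ 2 * dist y x ^ 2 + 0 := by ring
        _ ≤ _ := by gcongr; positivity
    · rw [not_lt] at hyx
      have h1 : |f y - ℓ y| ^ 2 ≤ M ^ 2 := pow_le_pow_left₀ (abs_nonneg _) (hM y hy) 2
      have h2 : M ^ 2 ≤ M ^ 2 / δ ^ 3 * dist y x ^ 3 := by
        rw [div_mul_eq_mul_div, le_div_iff₀ (by positivity)]
        gcongr
      have h3 : 0 ≤ η ^ 2 * dist y x ^ 2 := by positivity
      linarith
  have hlim : Tendsto (fun n => C * (M ^ 2 / δ ^ 3 * h n)) atTop (𝓝 0) := by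
    have := (hh.const_mul (M ^ 2 / δ ^ 3)).const_mul C
    simpa using this
  filter_upwards [hlim.eventually (Iio_mem_nhds (show 0 < ε' ^ 2 / 2 by positivity))] with n hn
  have hn' : C * (M ^ 2 / δ ^ 3 * h n) < ε' ^ 2 / 2 := hn
  obtain ⟨s, hs, hxs⟩ := hx n
  have hn0 := (hT n).pos
  have h1 : ‖gradient (w n) x - gradient f x‖ ≤ C' * ε' := by
    refine hgrad (hT n) (hw n).mem s hs x hxs (f x) (gradient f x) ε' fun y hy => ?_
    have h2 := hloc hΩ hΩb (hT n) hfℓ ((hw n).sub hΩ hΩb hf (hℓV n)) x _ _ (by positivity)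
      (by positivity) hsq y ((T n).subset s hs hy) ((hT n).dist_le s hs y (openSimplex_subset s hy)
        x (openSimplex_subset s hxs))
    refine abs_le_of_sq_le_sq (h2.trans ?_) (by positivity)
    have h3 : C * η ^ 2 ≤ ε' ^ 2 / 2 := by
      rw [hη, div_pow, mul_div_assoc', div_le_div_iff₀ (by positivity) (by positivity)]
      nlinarith [sq_nonneg ε', mul_nonneg hC (sq_nonneg ε'), mul_nonneg (mul_nonneg hC hC) (sq_nonneg ε')]
    calc C * (η ^ 2 * h n ^ 2 + M ^ 2 / δ ^ 3 * h n ^ 3)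
        = (C * η ^ 2 + C * (M ^ 2 / δ ^ 3 * h n)) * h n ^ 2 := by ring
      _ ≤ (ε' ^ 2 / 2 + ε' ^ 2 / 2) * h n ^ 2 := by gcongr
      _ = (ε' * h n) ^ 2 := by ring
  rw [dist_eq_norm]
  refine h1.trans_lt ?_
  rw [hε', mul_div_assoc', div_lt_iff₀ (by positivity)]
  nlinarith

/-- Piecewise affine interpolation of test functions. -/
theorem exists_interpolation (hΩ : IsOpen Ω) {k : ℕ} (hk : 1 ≤ k) {κ : ℝ} (hκ : 0 < κ)
    {T : ℕ → Triangulation Ω} {h : ℕ → ℝ} (hT : ∀ n, RegularMesh (T n) κ (h n))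
    (hh : Tendsto h atTop (𝓝 0)) {φ : (𝔼 d) → ℝ} (hφ : IsTestFunction Ω φ) :
    ∃ V : ℕ → (𝔼 d) → ℝ, (∀ n, MemFESpace (T n) k (V n)) ∧ (∀ᶠ n in atTop, EqOnBoundary Ω (V n) 0) ∧
      (∃ C, ∀ n, ∀ᵐ x ∂(volume.restrict Ω), ‖gradient (V n) x‖ ≤ C) ∧
      ∀ᵐ x ∂(volume.restrict Ω), Tendsto (fun n => gradient (V n) x) atTop (𝓝 (gradient φ x)) := by
  classical
  obtain ⟨C, hC, hbound⟩ := exists_norm_gradient_le d hk hκ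
  obtain ⟨C', hC', hgrad⟩ := exists_gradient_sub_le d hk hκ
  have h1 : ∀ n, ∃ V, MemFESpace (T n) 1 V ∧ ∀ s ∈ (T n).cells, ∀ x ∈ Ω,
      x ∈ convexHull ℝ (s : Set (𝔼 d)) → V x = ∑ v ∈ s, baryCoord s x v * φ v := fun n =>
    (T n).exists_nodal hΩ (fun _ v => φ v) fun _ _ _ _ _ _ _ => rfl
  choose V hV hVe using h1
  obtain ⟨K, hK⟩ := (hφ.smooth.of_le (by simp)).lipschitzWith_of_hasCompactSupport hφ.compact
    one_ne_zero
  have hseg : SegLip Ω K φ := fun x y _ => by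
    rw [← Real.dist_eq]; exact hK.dist_le_mul x y
  -- Nodal interpolation reproduces affine functions, so the error against one is a barycentric
  -- average of the errors at the vertices.
  have hsum : ∀ n, ∀ s ∈ (T n).cells, ∀ x ∈ Ω, x ∈ convexHull ℝ (s : Set (𝔼 d)) → ∀ c : ℝ, ∀ b z : 𝔼 d,
      V n x - (c + inner ℝ b (x - z)) = ∑ v ∈ s, baryCoord s x v * (φ v - (c + inner ℝ b (v - z))) := by
    intro n s hs x hx hxs c b z
    have hc := (T n).isCell hs
    simp only [mul_sub, mul_add, Finset.sum_sub_distrib, Finset.sum_add_distrib]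
    rw [← hVe n s hs x hx hxs, ← Finset.sum_mul, hc.bary_spec.2.2.1 x, one_mul]
    congr 2
    have e1 : ∑ v ∈ s, baryCoord s x v • (v - z) = x - z := by
      simp only [smul_sub, Finset.sum_sub_distrib]
      rw [hc.bary_spec.2.2.2.1 x, ← Finset.sum_smul, hc.bary_spec.2.2.1 x, one_smul]
    rw [← e1, inner_sum]
    exact Finset.sum_congr rfl fun v _ => by rw [inner_smul_right]
  have hvx : ∀ n, ∀ s ∈ (T n).cells, ∀ x ∈ convexHull ℝ (s : Set (𝔼 d)), ∀ v ∈ s,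
      dist v x ≤ h n := fun n s hs x hxs v hv =>
    (hT n).dist_le s hs v (subset_convexHull ℝ _ hv) x hxs
  refine ⟨V, fun n => (hV n).mono hk, ?_, ⟨C * (K + K), fun n => ?_⟩, ?_⟩
  -- Once h < δ, a cell reaching close to ∂Ω has no vertex where φ is nonzero, so the interpolant
  -- vanishes there.
  · obtain ⟨δ, hδ, hδΩ⟩ := hφ.compact.isCompact.exists_thickening_subset_open hΩ hφ.support
    filter_upwards [hh.eventually (Iio_mem_nhds hδ)] with n hn x hx
    have hn' : h n < δ := hn
    refine tendsto_const_nhds.congr' ?_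
    filter_upwards [mem_nhdsWithin_of_mem_nhds (Metric.ball_mem_nhds x (sub_pos.2 hn')),
      self_mem_nhdsWithin] with y hy hyΩ
    obtain ⟨s, hs, hys⟩ := (T n).exists_cell hyΩ
    rw [hVe n s hs y hyΩ hys, Pi.zero_apply, sub_zero, Finset.sum_eq_zero]
    intro v hv
    by_cases hφv : φ v = 0
    · rw [hφv, mul_zero]
    · exfalso
      have hxΩ : x ∈ Ω := hδΩ (Metric.mem_thickening_iff.2 ⟨v, subset_tsupport _ hφv, by
        have e1 := hvx n s hs y hys v hv
        have e2 := Metric.mem_ball.1 hy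
        rw [dist_comm] at e1 e2
        linarith [dist_triangle x y v]⟩)
      rw [hΩ.frontier_eq] at hx
      exact hx.2 hxΩ
  · refine hbound hΩ (hT n) K.2 hseg ((hV n).mono hk) fun x hx => ?_
    obtain ⟨s, hs, hxs⟩ := (T n).exists_cell hx
    have e1 := hsum n s hs x hx hxs (φ x) 0 x
    simp only [inner_zero_left, add_zero] at e1
    rw [e1]
    refine ((T n).isCell hs).abs_sum_baryCoord_mul_le hxs fun v hv => ?_
    rw [← Real.dist_eq]
    refine (hK.dist_le_mul v x).trans ?_
    gcongr
    exact hvx n s hs x hxs v hv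
  · have h2 : ∀ᵐ x ∂(volume.restrict Ω), ∀ n, ∃ s ∈ (T n).cells, x ∈ openSimplex s :=
      ae_all_iff.2 fun n => (T n).ae_mem_openSimplex hΩ
    filter_upwards [h2] with x hx
    have hφx : DifferentiableAt ℝ φ x := hφ.smooth.contDiffAt.differentiableAt (by simp)
    rw [Metric.tendsto_nhds]
    intro ε hε
    have hη : 0 < ε / (2 * C') := by positivity
    obtain ⟨δ, hδ, hδφ⟩ := exists_forall_abs_sub_affine_le hφx hη
    filter_upwards [hh.eventually (Iio_mem_nhds hδ)] with n hn
    have hn' : h n < δ := hn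
    obtain ⟨s, hs, hxs⟩ := hx n
    have h3 : ‖gradient (V n) x - gradient φ x‖ ≤ C' * (ε / (2 * C')) := by
      refine hgrad (hT n) ((hV n).mono hk) s hs x hxs (φ x) (gradient φ x) _ fun y hy => ?_
      rw [hsum n s hs y ((T n).subset s hs hy) (openSimplex_subset s hy)]
      refine ((T n).isCell hs).abs_sum_baryCoord_mul_le (openSimplex_subset s hy) fun v hv => ?_
      have h4 := hvx n s hs x (openSimplex_subset s hxs) v hv
      refine (hδφ v (h4.trans_lt hn')).trans ?_
      gcongr
    rw [dist_eq_norm]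
    refine h3.trans_lt ?_
    rw [mul_div_assoc', div_lt_iff₀ (by positivity)]
    nlinarith

/-! ### Closure properties -/

theorem IsTestFunction.sub {φ ψ : (𝔼 d) → ℝ} (hφ : IsTestFunction Ω φ) (hψ : IsTestFunction Ω ψ) :
    IsTestFunction Ω fun x => φ x - ψ x := by
  refine ⟨hφ.smooth.sub hψ.smooth, hφ.compact.sub hψ.compact, ?_⟩
  exact (tsupport_sub φ ψ).trans (Set.union_subset hφ.support hψ.support)

theorem IsTestFunction.gradient_sub {φ ψ : (𝔼 d) → ℝ} (hφ : IsTestFunction Ω φ)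
    (hψ : IsTestFunction Ω ψ) (x : 𝔼 d) :
    gradient (fun x => φ x - ψ x) x = gradient φ x - gradient ψ x := by
  have h1 : DifferentiableAt ℝ φ x := hφ.smooth.contDiffAt.differentiableAt (by simp)
  have h2 : DifferentiableAt ℝ ψ x := hψ.smooth.contDiffAt.differentiableAt (by simp)
  rw [gradient, fderiv_fun_sub h1 h2, map_sub]
  rfl

theorem MemW1.sub (hΩ : IsOpen Ω) {p : ℝ≥0∞} {u v : (𝔼 d) → ℝ} (hu : MemW1 Ω p u)
    (hv : MemW1 Ω p v) : MemW1 Ω p (fun x => u x - v x) ∧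
      weakGrad Ω (fun x => u x - v x) =ᵐ[volume.restrict Ω] weakGrad Ω u - weakGrad Ω v := by
  have h1 := (hasWeakGradient_weakGrad hu.exists_grad).sub (hasWeakGradient_weakGrad hv.exists_grad)
  have h2 := h1.weakGrad_ae_eq hΩ
  exact ⟨⟨hu.memLp.sub hv.memLp, ⟨_, h1⟩,
    (memLp_congr_ae h2).2 (hu.memLp_grad.sub hv.memLp_grad)⟩, h2⟩

theorem eLpNorm_sub_sub_tendsto {α F : Type*} [MeasurableSpace α] {μ : Measure α}
    [NormedAddCommGroup F] {p : ℝ≥0∞} (hp : 1 ≤ p) {f g : α → F} {φ ψ : ℕ → α → F}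
    (hf : AEStronglyMeasurable f μ) (hg : AEStronglyMeasurable g μ)
    (hφ : ∀ n, AEStronglyMeasurable (φ n) μ) (hψ : ∀ n, AEStronglyMeasurable (ψ n) μ)
    (h1 : Tendsto (fun n => eLpNorm (f - φ n) p μ) atTop (𝓝 0))
    (h2 : Tendsto (fun n => eLpNorm (g - ψ n) p μ) atTop (𝓝 0)) :
    Tendsto (fun n => eLpNorm ((f - g) - (φ n - ψ n)) p μ) atTop (𝓝 0) := by
  have h3 := h1.add h2
  rw [add_zero] at h3
  refine tendsto_of_tendsto_of_tendsto_of_le_of_le tendsto_const_nhds h3 (fun _ => zero_le)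
    fun n => ?_
  rw [show (f - g) - (φ n - ψ n) = (f - φ n) - (g - ψ n) by abel]
  exact eLpNorm_sub_le (hf.sub (hφ n)) (hg.sub (hψ n)) hp

theorem MemW10.sub (hΩ : IsOpen Ω) {p : ℝ≥0∞} (hp : 1 ≤ p) {u v : (𝔼 d) → ℝ}
    (hu : MemW10 Ω p u) (hv : MemW10 Ω p v) : MemW10 Ω p fun x => u x - v x := by
  obtain ⟨φ, hφ, h1, h2⟩ := hu.approx
  obtain ⟨ψ, hψ, h3, h4⟩ := hv.approx
  obtain ⟨hm, hg⟩ := hu.memW1.sub hΩ hv.memW1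
  refine ⟨hm, fun n x => φ n x - ψ n x, fun n => (hφ n).sub (hψ n), ?_, ?_⟩
  · exact eLpNorm_sub_sub_tendsto hp hu.memW1.memLp.1 hv.memW1.memLp.1
      (fun n => (hφ n).smooth.continuous.aestronglyMeasurable)
      (fun n => (hψ n).smooth.continuous.aestronglyMeasurable) h1 h3
  · refine (eLpNorm_sub_sub_tendsto hp hu.memW1.memLp_grad.1 hv.memW1.memLp_grad.1
      (fun n => (measurable_gradient (φ n)).aestronglyMeasurable)
      (fun n => (measurable_gradient (ψ n)).aestronglyMeasurable) h2 h4).congr fun n => ?_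
    refine eLpNorm_congr_ae ?_
    filter_upwards [hg] with x hx
    rw [hx, (hφ n).gradient_sub (hψ n)]
    rfl

theorem EqOnBoundary.add {u v : (𝔼 d) → ℝ} (hu : EqOnBoundary Ω u 0) (hv : EqOnBoundary Ω v 0) :
    EqOnBoundary Ω (fun x => u x + v x) 0 := by
  intro x hx
  simpa using (hu x hx).add (hv x hx)

namespace MemFESpace

variable {T : Triangulation Ω} {k : ℕ} {V W : (𝔼 d) → ℝ}

theorem memW1 (hΩ : IsOpen Ω) (hΩb : Bornology.IsBounded Ω) (hV : MemFESpace T k V) (p : ℝ≥0∞) :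
    MemW1 Ω p V := by
  obtain ⟨L, hL, hVL⟩ := hV.exists_segLip hΩ
  obtain ⟨B, -, hB⟩ := hV.exists_bound
  exact hVL.memW1 hΩ hΩb hL hB p

theorem weakGrad_ae_eq (hΩ : IsOpen Ω) (hV : MemFESpace T k V) :
    weakGrad Ω V =ᵐ[volume.restrict Ω] gradient V := by
  obtain ⟨L, hL, hVL⟩ := hV.exists_segLip hΩ
  exact (hVL.hasWeakGradient hΩ hL).weakGrad_ae_eq hΩ

theorem memLp_gradient (hΩ : IsOpen Ω) (hΩb : Bornology.IsBounded Ω) (hV : MemFESpace T k V)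
    (p : ℝ≥0∞) : MemLp (gradient V) p (volume.restrict Ω) :=
  (memLp_congr_ae (hV.weakGrad_ae_eq hΩ)).1 (hV.memW1 hΩ hΩb p).memLp_grad

theorem gradient_sub_ae_eq (hΩ : IsOpen Ω) (hV : MemFESpace T k V) (hW : MemFESpace T k W) :
    gradient (fun x => V x - W x) =ᵐ[volume.restrict Ω] gradient V - gradient W := by
  obtain ⟨L, hL, hVL⟩ := hV.exists_segLip hΩ
  obtain ⟨M, hM, hWM⟩ := hW.exists_segLip hΩ
  filter_upwards [hVL.ae_differentiableAt hΩ hL, hWM.ae_differentiableAt hΩ hM] with x h1 h2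
  rw [gradient, fderiv_fun_sub h1 h2, map_sub]
  rfl

theorem gradient_add_ae_eq (hΩ : IsOpen Ω) (hV : MemFESpace T k V) (hW : MemFESpace T k W) :
    gradient (fun x => V x + W x) =ᵐ[volume.restrict Ω] gradient V + gradient W := by
  obtain ⟨L, hL, hVL⟩ := hV.exists_segLip hΩ
  obtain ⟨M, hM, hWM⟩ := hW.exists_segLip hΩ
  filter_upwards [hVL.ae_differentiableAt hΩ hL, hWM.ae_differentiableAt hΩ hM] with x h1 h2
  rw [gradient, fderiv_fun_add h1 h2, map_add]
  rfl

theorem memW10 (hd : 1 ≤ d) (hΩ : IsOpen Ω) (hΩb : Bornology.IsBounded Ω) (hV : MemFESpace T k V)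
    (h0 : EqOnBoundary Ω V 0) {p : ℝ} (hp : 1 ≤ p) : MemW10 Ω (ENNReal.ofReal p) V := by
  obtain ⟨L, hL, hVL⟩ := hV.exists_segLip hΩ
  exact hVL.memW10 hd hΩ hΩb hL h0 hp

end MemFESpace

/-! ### Minimality of the discrete and the weak solution -/

/-- V - U is an admissible test function, so `U` is critical in that direction, and convexity of the
energy makes it minimal. -/
theorem IsDiscreteSolution.eLpNorm_gradient_le (hΩ : IsOpen Ω) (hΩb : Bornology.IsBounded Ω)
    {T : Triangulation Ω} {k : ℕ} {p : ℝ} (hp : 1 < p) {g U V : (𝔼 d) → ℝ}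
    (hU : IsDiscreteSolution T k p g U) (hV : MemFESpace T k V)
    (h0 : EqOnBoundary Ω (fun x => V x - U x) 0) :
    eLpNorm (gradient U) (ENNReal.ofReal p) (volume.restrict Ω) ≤
      eLpNorm (gradient V) (ENNReal.ofReal p) (volume.restrict Ω) := by
  have hVU := hV.sub hU.mem
  have hg := hV.gradient_sub_ae_eq hΩ hU.mem
  have h1 : eLpNorm (gradient U) (ENNReal.ofReal p) (volume.restrict Ω) ≤
      eLpNorm (gradient U + gradient fun x => V x - U x) (ENNReal.ofReal p)
        (volume.restrict Ω) := by
    refine eLpNorm_le_of_integral_eq_zero hp (hU.mem.memLp_gradient hΩ hΩb _)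
      (hVU.memLp_gradient hΩ hΩb _) ?_
    rw [← hU.eq_zero _ hVU h0, pLaplaceForm]
    refine integral_congr_ae ?_
    filter_upwards [hU.mem.weakGrad_ae_eq hΩ, hVU.weakGrad_ae_eq hΩ] with x e1 e2
    rw [e1, e2]
  refine h1.trans (le_of_eq (eLpNorm_congr_ae ?_))
  filter_upwards [hg] with x hx
  rw [Pi.add_apply, hx, Pi.sub_apply, add_sub_cancel]

/-- The scalar `c` allows the direct use of c = 1/2, which produces the midpoints needed for uniform
convexity. -/
theorem IsWeakSolution.eLpNorm_weakGrad_le {p : ℝ} (hp : 1 < p) {g u v : (𝔼 d) → ℝ}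
    (hu : IsWeakSolution Ω p g u) (hv : MemW10 Ω (ENNReal.ofReal p) v) (c : ℝ) :
    eLpNorm (weakGrad Ω u) (ENNReal.ofReal p) (volume.restrict Ω) ≤
      eLpNorm (weakGrad Ω u + c • weakGrad Ω v) (ENNReal.ofReal p) (volume.restrict Ω) := by
  refine eLpNorm_le_of_integral_eq_zero hp hu.mem.memW1.memLp_grad
    (hv.memW1.memLp_grad.const_smul c) ?_
  have h1 := hu.eq_zero v hv
  rw [pLaplaceForm] at h1
  rw [← mul_zero c, ← h1, ← integral_const_mul]
  refine integral_congr_ae (Eventually.of_forall fun x => ?_)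
  simp only [Pi.smul_apply, inner_smul_right]
  ring

/-! ### Uniform limits -/

theorem ContinuousOn.forall_le_of_ae_le (hΩ : IsOpen Ω) {f : (𝔼 d) → ℝ} (hf : ContinuousOn f Ω)
    {c : ℝ} (h : ∀ᵐ x ∂(volume.restrict Ω), f x ≤ c) : ∀ x ∈ Ω, f x ≤ c := by
  have h1 : Set.EqOn (fun x => max (f x) c) (fun _ => c) Ω := by
    refine Measure.eqOn_open_of_ae_eq (μ := volume) ?_ hΩ (by fun_prop) continuousOn_const
    filter_upwards [h] with x hx using max_eq_right hx
  intro x hx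
  have := h1 hx
  simp only at this
  rw [← this]
  exact le_max_left _ _

/-- Almost everywhere bounds on differences of continuous functions hold everywhere on an open set,
so the sequence is uniformly Cauchy. Its limit is the continuous representative. -/
theorem exists_tendstoUniformlyOn_of_ae (hΩ : IsOpen Ω) {U : ℕ → (𝔼 d) → ℝ} {u : (𝔼 d) → ℝ}
    (hU : ∀ n, ContinuousOn (U n) Ω) {δ : ℕ → ℝ} (hδ : Tendsto δ atTop (𝓝 0))
    (h : ∀ n, ∀ᵐ x ∂(volume.restrict Ω), |U n x - u x| ≤ δ n) :
    ∃ u' : (𝔼 d) → ℝ, ContinuousOn u' Ω ∧ u' =ᵐ[volume.restrict Ω] u ∧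
      TendstoUniformlyOn U u' atTop Ω := by
  have h1 : ∀ n m, ∀ x ∈ Ω, |U n x - U m x| ≤ δ n + δ m := by
    intro n m
    refine ContinuousOn.forall_le_of_ae_le hΩ ((hU n).sub (hU m)).abs ?_
    filter_upwards [h n, h m] with x hn hm
    rw [abs_sub_comm] at hm
    exact (abs_sub_le _ (u x) _).trans (add_le_add hn hm)
  have h2 : ∀ x ∈ Ω, ∃ l, Tendsto (fun n => U n x) atTop (𝓝 l) := by
    intro x hx
    refine cauchySeq_tendsto_of_complete (Metric.cauchySeq_iff.2 fun ε hε => ?_)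
    obtain ⟨N, hN⟩ := eventually_atTop.1 (hδ.eventually (Iio_mem_nhds (half_pos hε)))
    refine ⟨N, fun m hm n hn => (h1 m n x hx).trans_lt ?_⟩
    have e1 : δ m < ε / 2 := hN m hm
    have e2 : δ n < ε / 2 := hN n hn
    linarith
  choose! u' hu' using h2
  have h3 : ∀ n, ∀ x ∈ Ω, |U n x - u' x| ≤ δ n := by
    intro n x hx
    have e1 : Tendsto (fun m => |U n x - U m x|) atTop (𝓝 |U n x - u' x|) :=
      ((hu' x hx).const_sub _).abs
    have e2 : Tendsto (fun m => δ n + δ m) atTop (𝓝 (δ n + 0)) := hδ.const_add _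
    rw [add_zero] at e2
    exact le_of_tendsto_of_tendsto' e1 e2 fun m => h1 n m x hx
  have h4 : TendstoUniformlyOn U u' atTop Ω := by
    rw [Metric.tendstoUniformlyOn_iff]
    intro ε hε
    filter_upwards [hδ.eventually (Iio_mem_nhds hε)] with n hn x hx
    rw [dist_comm, Real.dist_eq]
    exact (h3 n x hx).trans_lt hn
  refine ⟨u', h4.continuousOn (Frequently.of_forall hU), ?_, h4⟩
  filter_upwards [ae_all_iff.2 h, ae_restrict_mem hΩ.measurableSet] with x hx hxΩ
  refine tendsto_nhds_unique (hu' x hxΩ) ?_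
  rw [tendsto_iff_norm_sub_tendsto_zero]
  exact tendsto_of_tendsto_of_tendsto_of_le_of_le tendsto_const_nhds hδ (fun _ => norm_nonneg _) hx

/-! ### Convergence of the scheme -/

/-- Functions in `W^{1,∞}` have a representative with bounded difference quotients. -/
theorem MemW1.exists_segLip (hΩ : IsOpen Ω) {g : (𝔼 d) → ℝ} (hg : MemW1 Ω ⊤ g) :
    ∃ g' L B, 0 ≤ L ∧ SegLip Ω L g' ∧ (∀ x ∈ Ω, |g' x| ≤ B) ∧ g' =ᵐ[volume.restrict Ω] g := by
  have hbd : ∀ {F : Type} [NormedAddCommGroup F] {f : (𝔼 d) → F},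
      MemLp f ⊤ (volume.restrict Ω) → ∃ B : ℝ, 0 ≤ B ∧ ∀ᵐ x ∂(volume.restrict Ω), ‖f x‖ ≤ B := by
    intro F _ f hf
    refine ⟨(eLpNorm f ⊤ (volume.restrict Ω)).toReal, ENNReal.toReal_nonneg, ?_⟩
    filter_upwards [ae_le_eLpNormEssSup (f := f) (μ := volume.restrict Ω)] with x hx
    rw [← eLpNorm_exponent_top] at hx
    have := ENNReal.toReal_mono hf.2.ne hx
    rwa [toReal_enorm] at this
  obtain ⟨B, -, hB⟩ := hbd hg.memLp
  obtain ⟨L, hL, hLg⟩ := hbd hg.memLp_grad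
  obtain ⟨g', hg', he⟩ := (hasWeakGradient_weakGrad hg.exists_grad).exists_segLip hΩ
    (B := B) hB hg.memLp.1 hL hLg
  refine ⟨g', L, B, hL, hg', ?_, he⟩
  refine ContinuousOn.forall_le_of_ae_le hΩ (hg'.continuousOn hΩ hL).abs ?_
  filter_upwards [he, hB] with x h1 h2
  rwa [h1]

theorem tendsto_eLpNorm_sub_of_bounded {α F : Type*} [MeasurableSpace α] {μ : Measure α}
    [IsFiniteMeasure μ] [NormedAddCommGroup F] {p : ℝ} (hp : 0 < p) {H : ℕ → α → F} {G : α → F}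
    {C D : ℝ} (hm : ∀ n, AEStronglyMeasurable (H n) μ) (hG : AEStronglyMeasurable G μ)
    (hC : ∀ n, ∀ᵐ x ∂μ, ‖H n x‖ ≤ C) (hD : ∀ᵐ x ∂μ, ‖G x‖ ≤ D)
    (h0 : ∀ᵐ x ∂μ, Tendsto (fun n => H n x) atTop (𝓝 (G x))) :
    Tendsto (fun n => eLpNorm (H n - G) (ENNReal.ofReal p) μ) atTop (𝓝 0) := by
  refine tendsto_eLpNorm_zero_of_bounded hp (C := C + D) (fun n => (hm n).sub hG) (fun n => ?_) ?_
  · filter_upwards [hC n, hD] with x h1 h2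
    exact (norm_sub_le _ _).trans (add_le_add h1 h2)
  · filter_upwards [h0] with x hx
    exact tendsto_sub_nhds_zero_iff.2 hx

/-- The discrete energies are asymptotically at most the energy of the weak solution. -/
theorem eventually_eLpNorm_gradient_le (hΩ : IsOpen Ω) (hΩb : Bornology.IsBounded Ω) {p : ℝ}
    (hp : 1 < p) {k : ℕ} (hk : 1 ≤ k) {κ : ℝ} (hκ : 0 < κ) {T : ℕ → Triangulation Ω} {h : ℕ → ℝ}
    (hT : ∀ n, RegularMesh (T n) κ (h n)) (hh : Tendsto h atTop (𝓝 0))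
    {g u : (𝔼 d) → ℝ} (hug : MemW10 Ω (ENNReal.ofReal p) fun x => u x - g x)
    {G : (𝔼 d) → 𝔼 d} (hG : MemLp G (ENNReal.ofReal p) (volume.restrict Ω))
    (hgrad : weakGrad Ω (fun x => u x - g x) =ᵐ[volume.restrict Ω] weakGrad Ω u - G)
    (hu : MemLp (weakGrad Ω u) (ENNReal.ofReal p) (volume.restrict Ω))
    {g₀ U w : ℕ → (𝔼 d) → ℝ} (hU : ∀ n, IsDiscreteSolution (T n) k p (g₀ n) (U n))
    (hw : ∀ n, MemFESpace (T n) k (w n)) (hUw : ∀ n, EqOnBoundary Ω (U n) (w n))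
    (hwG : Tendsto (fun n => eLpNorm (gradient (w n) - G) (ENNReal.ofReal p) (volume.restrict Ω))
      atTop (𝓝 0)) {ε : ℝ} (hε : 0 < ε) :
    ∀ᶠ n in atTop, eLpNorm (gradient (U n)) (ENNReal.ofReal p) (volume.restrict Ω) ≤
      eLpNorm (weakGrad Ω u) (ENNReal.ofReal p) (volume.restrict Ω) + ENNReal.ofReal ε := by
  have hfin : IsFiniteMeasure (volume.restrict Ω) :=
    isFiniteMeasure_restrict.2 hΩb.measure_lt_top.ne
  have hp1 : 1 ≤ ENNReal.ofReal p := by simpa using ENNReal.ofReal_le_ofReal hp.le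
  set P := ENNReal.ofReal p with hP
  set μ := volume.restrict Ω with hμ
  obtain ⟨φ, hφ, -, hφu⟩ := hug.approx
  have hε3 : 0 < ENNReal.ofReal (ε / 3) := ENNReal.ofReal_pos.2 (by positivity)
  -- A test function whose gradient is within ε / 3 of that of u - g. The other two thirds pay for
  -- its interpolation and for the convergence of the projected datum; adding the interpolant to `w
  -- n` gives a competitor for `U n`.
  obtain ⟨m, hm⟩ := (hφu.eventually (Iio_mem_nhds hε3)).exists
  have hm' : eLpNorm (fun x => weakGrad Ω (fun x => u x - g x) x - gradient (φ m) x) P μ <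
    ENNReal.ofReal (ε / 3) := hm
  have hψ := hφ m
  set ψ := φ m with hψdef
  obtain ⟨V, hV, hV0, ⟨C, hVC⟩, hVt⟩ := exists_interpolation hΩ hk hκ hT hh hψ
  have hψm : AEStronglyMeasurable (gradient ψ) μ := (measurable_gradient ψ).aestronglyMeasurable
  obtain ⟨D, hD⟩ : ∃ D, ∀ x, ‖gradient ψ x‖ ≤ D := by
    obtain ⟨D, hD⟩ := (hψ.compact.fderiv (𝕜 := ℝ)).exists_bound_of_continuous
      (hψ.smooth.continuous_fderiv (by simp))
    exact ⟨D, fun x => by rw [gradient, LinearIsometryEquiv.norm_map]; exact hD x⟩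
  have hVψ : Tendsto (fun n => eLpNorm (gradient (V n) - gradient ψ) P μ) atTop (𝓝 0) :=
    tendsto_eLpNorm_sub_of_bounded (by linarith)
      (fun n => (measurable_gradient _).aestronglyMeasurable) hψm hVC (Eventually.of_forall hD) hVt
  have hGψ : eLpNorm (G + gradient ψ) P μ ≤ eLpNorm (weakGrad Ω u) P μ + ENNReal.ofReal (ε / 3) := by
    have e1 : eLpNorm (weakGrad Ω u - G - gradient ψ) P μ < ENNReal.ofReal (ε / 3) := by
      refine lt_of_le_of_lt (le_of_eq (eLpNorm_congr_ae ?_)) hm'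
      filter_upwards [hgrad] with x hx
      rw [hx]; rfl
    rw [show G + gradient ψ = weakGrad Ω u - (weakGrad Ω u - G - gradient ψ) by abel]
    exact (eLpNorm_sub_le hu.1 ((hu.1.sub hG.1).sub hψm) hp1).trans (by gcongr)
  filter_upwards [hV0, hVψ.eventually (Iio_mem_nhds hε3), hwG.eventually (Iio_mem_nhds hε3)]
    with n h0 h1 h2
  have h1' : eLpNorm (gradient (V n) - gradient ψ) P μ < ENNReal.ofReal (ε / 3) := h1
  have h2' : eLpNorm (gradient (w n) - G) P μ < ENNReal.ofReal (ε / 3) := h2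
  have hwV := (hw n).add (hV n)
  have h3 : EqOnBoundary Ω (fun x => w n x + V n x - U n x) 0 := by
    have e1 : EqOnBoundary Ω (fun x => w n x - U n x) 0 := by
      intro x hx
      have := (hUw n x hx).neg
      simpa using this
    have := e1.add h0
    refine fun x hx => (this x hx).congr fun y => ?_
    simp only [Pi.zero_apply]; ring
  have hwm : ∀ f : (𝔼 d) → ℝ, AEStronglyMeasurable (gradient f) μ := fun f =>
    (measurable_gradient f).aestronglyMeasurable
  calc eLpNorm (gradient (U n)) P μ ≤ eLpNorm (gradient fun x => w n x + V n x) P μ :=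
        (hU n).eLpNorm_gradient_le hΩ hΩb hp hwV h3
    _ = eLpNorm ((G + gradient ψ) + ((gradient (w n) - G) + (gradient (V n) - gradient ψ))) P μ := by
        refine eLpNorm_congr_ae (((hw n).gradient_add_ae_eq hΩ (hV n)).trans (ae_of_all _ fun x => ?_))
        simp only [Pi.add_apply, Pi.sub_apply]; abel
    _ ≤ eLpNorm (G + gradient ψ) P μ +
          (eLpNorm (gradient (w n) - G) P μ + eLpNorm (gradient (V n) - gradient ψ) P μ) := by
        refine (eLpNorm_add_le (hG.1.add hψm) (((hwm _).sub hG.1).add ((hwm _).sub hψm)) hp1).trans ?_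
        gcongr
        exact eLpNorm_add_le ((hwm _).sub hG.1) ((hwm _).sub hψm) hp1
    _ ≤ (eLpNorm (weakGrad Ω u) P μ + ENNReal.ofReal (ε / 3)) +
          (ENNReal.ofReal (ε / 3) + ENNReal.ofReal (ε / 3)) := by gcongr
    _ = eLpNorm (weakGrad Ω u) P μ + ENNReal.ofReal ε := by
        rw [add_assoc, ← ENNReal.ofReal_add (by positivity) (by positivity),
          ← ENNReal.ofReal_add (by positivity) (by positivity)]
        congr 2; ring

end

theorem mainTheorem4 {d : ℕ} (hd : 1 ≤ d) (Ω : Set (EuclideanSpace ℝ (Fin d)))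
    (hΩ : IsOpen Ω) (hΩb : Bornology.IsBounded Ω)
    (p : ℝ) (hp : (d : ℝ) < p)
    (g : EuclideanSpace ℝ (Fin d) → ℝ) (hg : MemW1 Ω ∞ g)
    (k : ℕ) (hk : 1 ≤ k)
    (T : ℕ → Triangulation Ω) (hshape : ShapeRegular T) (hquasi : Quasiuniform T)
    (hmesh : Tendsto (fun n => (T n).meshWidth) atTop (𝓝 0))
    (U : ℕ → EuclideanSpace ℝ (Fin d) → ℝ) (hU : ∀ n, IsDiscreteSolution (T n) k p g (U n))
    (u : EuclideanSpace ℝ (Fin d) → ℝ) (hu : IsWeakSolution Ω p g u) :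
    ∃ u' : EuclideanSpace ℝ (Fin d) → ℝ, ContinuousOn u' Ω ∧
      u' =ᵐ[volume.restrict Ω] u ∧ TendstoUniformlyOn U u' atTop Ω := by
  have hd1 : (1 : ℝ) ≤ d := by exact_mod_cast hd
  have hp1 : 1 < p := hd1.trans_lt hp
  have hP1 : 1 ≤ ENNReal.ofReal p := by simpa using ENNReal.ofReal_le_ofReal hp1.le
  rcases Ω.eq_empty_or_nonempty with rfl | hne
  · exact ⟨u, by simp, by simp, by simp [TendstoUniformlyOn]⟩
  have hfin : IsFiniteMeasure (volume.restrict Ω) :=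
    isFiniteMeasure_restrict.2 hΩb.measure_lt_top.ne
  obtain ⟨κ, hκ, hT⟩ := exists_regularMesh hne hshape hquasi
  obtain ⟨g', L, B, hL, hg', hB, hgg⟩ := hg.exists_segLip hΩ
  choose w hwg hUw using fun n => (hU n).boundary
  -- The projection sees its argument only up to null sets, so `g` may be replaced by its regular
  -- representative.
  have hw : ∀ n, IsL2Projection (T n) k g' (w n) := fun n => ⟨(hwg n).mem, fun Φ hΦ => by
    rw [(hwg n).integral_eq Φ hΦ]
    refine integral_congr_ae ?_
    filter_upwards [hgg] with x hx
    rw [hx]⟩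
  obtain ⟨C₁, hC₁, herr⟩ := exists_projection_error d hk hκ
  obtain ⟨C₂, hC₂, hgb⟩ := exists_norm_gradient_le d hk hκ
  have hwerr : ∀ n, ∀ x ∈ Ω, |w n x - g' x| ≤ (C₁ * L) * (T n).meshWidth := fun n x hx =>
    (herr hΩ hΩb (hT n) hL hg' hB (hw n) x hx).trans (le_of_eq (by ring))
  set P := ENNReal.ofReal p with hP
  set μ := volume.restrict Ω with hμ
  have hG : MemLp (gradient g') P μ := MemLp.of_bound (measurable_gradient g').aestronglyMeasurable L
    (by filter_upwards [ae_restrict_mem hΩ.measurableSet] with x hx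
          using hg'.norm_gradient_le hΩ hL hx)
  have hwG : Tendsto (fun n => eLpNorm (gradient (w n) - gradient g') P μ) atTop (𝓝 0) := by
    refine tendsto_eLpNorm_sub_of_bounded (by linarith)
      (fun n => (measurable_gradient _).aestronglyMeasurable) hG.1
      (fun n => hgb hΩ (hT n) hL hg' (hw n).mem (hwerr n)) (D := L) ?_ ?_
    · filter_upwards [ae_restrict_mem hΩ.measurableSet] with x hx
        using hg'.norm_gradient_le hΩ hL hx
    · have h2 : ∀ᵐ x ∂(volume.restrict Ω), ∀ n, ∃ s ∈ (T n).cells, x ∈ openSimplex s :=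
        ae_all_iff.2 fun n => (T n).ae_mem_openSimplex hΩ
      filter_upwards [h2, hg'.ae_differentiableAt hΩ hL] with x hx hgx
      exact tendsto_gradient_projection hΩ hΩb hk hκ hT hmesh (hg'.bddMeasurableOn hΩ hL hB) hw hx hgx
  have huG : weakGrad Ω (fun x => u x - g x) =ᵐ[μ] weakGrad Ω u - gradient g' :=
    ((hasWeakGradient_weakGrad hu.mem.memW1.exists_grad).sub
      ((hg'.hasWeakGradient hΩ hL).congr_ae hΩ hgg)).weakGrad_ae_eq hΩ
  have hDu := hu.mem.memW1.memLp_grad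
  have hDU : ∀ n, MemLp (gradient (U n)) P μ := fun n => (hU n).mem.memLp_gradient hΩ hΩb P
  have hDw : ∀ n, MemLp (gradient (w n)) P μ := fun n => (hw n).mem.memLp_gradient hΩ hΩb P
  -- U n - u need not have zero boundary values, because the discrete datum is a projection of `g`;
  -- the corrected difference does.
  set e : ℕ → (EuclideanSpace ℝ (Fin d)) → ℝ := fun n x => (U n x - w n x) - (u x - g x) with he
  have heW : ∀ n, MemW10 Ω P (e n) := fun n =>
    (((hU n).mem.sub (hw n).mem).memW10 hd hΩ hΩb (fun x hx => by
      simpa using hUw n x hx) hp1.le).sub hΩ hP1 hu.mem.boundary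
  set A : ℕ → EuclideanSpace ℝ (Fin d) → EuclideanSpace ℝ (Fin d) := fun n =>
    gradient (U n) - gradient (w n) + gradient g' with hA
  have hAm : ∀ n, MemLp (A n) P μ := fun n => ((hDU n).sub (hDw n)).add hG
  have heA : ∀ n, weakGrad Ω (e n) =ᵐ[μ] A n - weakGrad Ω u := by
    intro n
    have hUwF := (hU n).mem.sub (hw n).mem
    have h1 := ((hUwF.memW1 hΩ hΩb P).sub hΩ hu.mem.boundary.memW1).2
    filter_upwards [h1, hUwF.weakGrad_ae_eq hΩ, (hU n).mem.gradient_sub_ae_eq hΩ (hw n).mem, huG]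
      with x e1 e2 e3 e4
    simp only [he]
    rw [e1, Pi.sub_apply, e2, e3, e4]
    simp only [hA, Pi.sub_apply, Pi.add_apply]
    abel
  have hAu : Tendsto (fun n => eLpNorm (A n - weakGrad Ω u) P μ) atTop (𝓝 0) := by
    refine tendsto_of_midpoint hp1 hDu hAm (fun n => ?_) fun ε hε => ?_
    -- The midpoint of `A n` and Du is Du plus half the gradient of `e n`, an admissible variation
    -- of the weak solution.
    · refine (hu.eLpNorm_weakGrad_le hp1 (heW n) (1 / 2)).trans (le_of_eq (eLpNorm_congr_ae ?_))
      filter_upwards [heA n] with x hx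
      simp only [Pi.add_apply, Pi.smul_apply, hx, Pi.sub_apply]
      module
    · have hε2 : 0 < ENNReal.ofReal (ε / 2) := ENNReal.ofReal_pos.2 (by positivity)
      filter_upwards [eventually_eLpNorm_gradient_le hΩ hΩb hp1 hk hκ hT hmesh hu.mem.boundary hG huG
        hDu hU (fun n => (hw n).mem) hUw hwG (half_pos hε), hwG.eventually (Iio_mem_nhds hε2)]
        with n h1 h2
      have h2' : eLpNorm (gradient (w n) - gradient g') P μ < ENNReal.ofReal (ε / 2) := h2
      -- `A n` differs from the discrete gradient only by the projection error in the gradient,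
      -- which tends to zero, so the energy bound carries over.
      rw [show A n = gradient (U n) - (gradient (w n) - gradient g') by simp only [hA]; abel]
      refine (eLpNorm_sub_le (hDU n).1 ((hDw n).1.sub hG.1) hP1).trans ?_
      refine (add_le_add h1 h2'.le).trans (le_of_eq ?_)
      rw [add_assoc, ← ENNReal.ofReal_add (by positivity) (by positivity), add_halves]
  obtain ⟨M, hM, hmorrey⟩ := exists_morrey_const hd hΩb hp
  have hMtop : ∀ n, M * eLpNorm (A n - weakGrad Ω u) P μ ≠ ⊤ := fun n =>
    ENNReal.mul_ne_top hM ((hAm n).sub hDu).2.ne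
  have hδ : Tendsto (fun n => (M * eLpNorm (A n - weakGrad Ω u) P μ).toReal +
      (C₁ * L) * (T n).meshWidth) atTop (𝓝 0) := by
    have h1 := ENNReal.Tendsto.const_mul hAu (Or.inr hM) (a := M)
    rw [mul_zero] at h1
    have h2 := ((ENNReal.tendsto_toReal ENNReal.zero_ne_top).comp h1).add
      (hmesh.const_mul (C₁ * L))
    simpa using h2
  refine exists_tendstoUniformlyOn_of_ae hΩ (fun n => (hU n).mem.continuousOn) hδ fun n => ?_
  filter_upwards [(heW n).ae_enorm_le hp1.le hM hmorrey, hgg, ae_restrict_mem hΩ.measurableSet]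
    with x h1 h2 hx
  rw [eLpNorm_congr_ae (heA n)] at h1
  have h3 := ENNReal.toReal_mono (hMtop n) h1
  rw [toReal_enorm, Real.norm_eq_abs] at h3
  have h4 : U n x - u x = e n x + (w n x - g' x) := by
    rw [he, h2]; ring
  rw [h4]
  exact (abs_add_le _ _).trans (add_le_add h3 (hwerr n x hx))
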